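/- Let $\mu>0$ and $c\in\mathbb R$. A function $\varphi\in H^1_{loc}(\mathbb R)$ (identified with its continuous representative) is called a \emph{traveling wave} of speed $c$ of the equation $-u_{txx}=-2\mu u_x+2u_xu_{xx}+uu_{xxx}$, with $u(t,x)=\varphi(x-ct)$, if for some $a\in\mathbb R$ $$\varphi_x^2=-4\mu\varphi+\big((\varphi-c)^2\big)_{xx}+a\qquad\text{in the sense of distributions.}$$ It has the parameters $(m,M)$ if $\varphi_x^2=\dfrac{2\mu(M-\varphi)(\varphi-m)}{c-\varphi}$ wherever $\varphi\neq c$. A cusp (anticusp) is a point at which $\varphi$ is continuous, on both sides of which $\varphi$ is smooth, and at which $\varphi_x$ tends to $+\infty$ from the left and $-\infty$ from the right (respectively $-\infty$ and $+\infty$); at a peak the one-sided limits of $\varphi_x$ are $l$ and $-l$ with $0<l<\infty$. A periodic wave is called cusped (anticusped, peaked) if it attains the value $c$ exactly once per period, has a cusp (anticusp, peak) there, and is smooth elsewhere. Then the following hold. (a) (Smooth periodic) If $m<M<c$, there is, uniquely up to translation, a smooth periodic traveling wave with parameters $(m,M)$, $\min\varphi=m$ and $\max\varphi=M$. (a') (Peaked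 periodic) If $m<M=c$, there is, uniquely up to translation, a peaked periodic traveling wave with parameters $(m,c)$, $\min\varphi=m$ and $\max\varphi=c$. (b) (Cusped periodic) If $m<c<M$, there is, uniquely up to translation, a cusped periodic traveling wave with parameters $(m,M)$, $\min\varphi=m$ and $\max\varphi=c$. (c) (Anticusped periodic) If $c<m<M$, there is, uniquely up to translation, an anticusped periodic traveling wave with parameters $(m,M)$, $\min\varphi=c$ and $\max\varphi=m$. (d) (Anticusped on the line) If $c<m=M$, there is, uniquely up to translation, a traveling wave with parameters $(m,m)$ that attains the value $c$ at exactly one point, has an anticusp there and is smooth elsewhere, with $\min\varphi=c$ and $\lim_{x\to\pm\infty}\varphi(x)=\sup\varphi=m$. (e), (f) (Composite waves and plateaus) Call $\varphi:\mathbb R\to\mathbb R$ a composite wave with sum $S$ if on every connected component $E$ of $\{\varphi\neq c\}$ it coincides with a wave $w$ from (a')--(d) whose parameters satisfy $m+M=S$ and for which $E$ is a connected component of $\{w\neq c\}$ (the parameters may depend on $E$; there are at most countably many components). A composite wave with sum $S$ that is not identically $c$ is a traveling wave if and only if the set $\{\varphi=c\}$ has Lebesgue measure zero or $S=2c$. In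 particular segments may be glued at their crests (the points of height $c$) whenever their values of $m+M$ agree, and plateaus, i.e. intervals on which $\varphi\equiv c$, may occur exactly when $m+M=2c$. (Completeness) A bounded function $\varphi:\mathbb R\to\mathbb R$ is a traveling wave of speed $c$ if and only if it is constant, or a smooth periodic wave as in (a), or a composite wave with some sum $S$ such that $\{\varphi=c\}$ has Lebesgue measure zero or $S=2c$. -/

import Mathlib

open Set Filter Topology MeasureTheory
open scoped ContDiff

namespace MuHS

/-- Test functions on the line: smooth and compactly supported. -/
def IsTestFunction (ψ : ℝ → ℝ) : Prop :=
  ContDiff ℝ ∞ ψ ∧ HasCompactSupport ψ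

/-- Membership in `L²_loc(ℝ)`. -/
def MemL2Loc (f : ℝ → ℝ) : Prop :=
  ∀ K : Set ℝ, IsCompact K → MemLp f 2 (volume.restrict K)

/-- `g` is the distributional derivative of `f`. -/
def IsWeakDeriv (f g : ℝ → ℝ) : Prop :=
  LocallyIntegrable f ∧ LocallyIntegrable g ∧
    ∀ ψ : ℝ → ℝ, IsTestFunction ψ → ∫ x, f x * deriv ψ x = -∫ x, g x * ψ x

/-- `φ ∈ H¹_loc(ℝ)` with weak derivative `g`. Elements of `H¹_loc(ℝ)` are identified, as usual,
with their continuous representatives. -/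
def IsH1LocWithDeriv (φ g : ℝ → ℝ) : Prop :=
  Continuous φ ∧ MemL2Loc φ ∧ MemL2Loc g ∧ IsWeakDeriv φ g

/-- `φ ∈ H¹_loc(ℝ)` is the profile of a traveling wave `φ (x - c t)` of speed `c` of
`-u_txx = -2 μ u_x + 2 u_x u_xx + u u_xxx`: for some real `a`,
`φ_x² = -4 μ φ + ((φ - c)²)_xx + a` in the sense of distributions. -/
def IsTravelingWave (μ c : ℝ) (φ : ℝ → ℝ) : Prop :=
  ∃ g : ℝ → ℝ, IsH1LocWithDeriv φ g ∧
    ∃ a : ℝ, ∀ ψ : ℝ → ℝ, IsTestFunction ψ →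
      ∫ x, (g x) ^ 2 * ψ x =
        (∫ x, (-4 * μ * φ x + a) * ψ x) + ∫ x, (φ x - c) ^ 2 * deriv (deriv ψ) x

/-- `φ` has the parameters `(m, M)`: where `φ ≠ c` it is differentiable and
`φ_x² = 2 μ (M - φ) (φ - m) / (c - φ)`. -/
def HasParameters (μ c m M : ℝ) (φ : ℝ → ℝ) : Prop :=
  ∀ x, φ x ≠ c → DifferentiableAt ℝ φ x ∧
    (deriv φ x) ^ 2 = 2 * μ * (M - φ x) * (φ x - m) / (c - φ x)

/-- `φ` is smooth near `x`, on each side of `x`. -/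
def SmoothOnBothSides (φ : ℝ → ℝ) (x : ℝ) : Prop :=
  ∃ ε > 0, ContDiffOn ℝ ∞ φ (Ioo (x - ε) x) ∧ ContDiffOn ℝ ∞ φ (Ioo x (x + ε))

/-- A cusp pointing upwards. -/
def HasCuspAt (φ : ℝ → ℝ) (x : ℝ) : Prop :=
  ContinuousAt φ x ∧ SmoothOnBothSides φ x ∧
    Tendsto (deriv φ) (𝓝[<] x) atTop ∧ Tendsto (deriv φ) (𝓝[>] x) atBot

/-- A cusp pointing downwards. -/
def HasAnticuspAt (φ : ℝ → ℝ) (x : ℝ) : Prop :=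
  ContinuousAt φ x ∧ SmoothOnBothSides φ x ∧
    Tendsto (deriv φ) (𝓝[<] x) atBot ∧ Tendsto (deriv φ) (𝓝[>] x) atTop

/-- A corner pointing upwards, with opposite finite one-sided slopes. -/
def HasPeakAt (φ : ℝ → ℝ) (x : ℝ) : Prop :=
  ContinuousAt φ x ∧ SmoothOnBothSides φ x ∧
    ∃ l > 0, Tendsto (deriv φ) (𝓝[<] x) (𝓝 l) ∧ Tendsto (deriv φ) (𝓝[>] x) (𝓝 (-l))

/-- `φ` is periodic, reaches the height `c` exactly once per period, is smooth elsewhere, and has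
a singularity of the kind `Q` at each point of height `c`. -/
def IsPeriodicWithCrests (c : ℝ) (Q : (ℝ → ℝ) → ℝ → Prop) (φ : ℝ → ℝ) : Prop :=
  ∃ x₀ T : ℝ, 0 < T ∧ Function.Periodic φ T ∧
    (∀ x, φ x = c ↔ ∃ k : ℤ, x = x₀ + k * T) ∧
    ContDiffOn ℝ ∞ φ {x | φ x ≠ c} ∧ ∀ x, φ x = c → Q φ x

/-- Smooth periodic traveling wave with parameters `(m, M)`, minimum `m`, maximum `M`. -/
structure IsSmoothPeriodicWave (μ c m M : ℝ) (φ : ℝ → ℝ) : Prop where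
  wave : IsTravelingWave μ c φ
  parameters : HasParameters μ c m M φ
  smooth : ContDiff ℝ ∞ φ
  periodic : ∃ T > 0, Function.Periodic φ T
  minimum : IsLeast (range φ) m
  maximum : IsGreatest (range φ) M

/-- Peaked periodic traveling wave with parameters `(m, c)`, minimum `m`, maximum `c`. -/
structure IsPeakedPeriodicWave (μ c m : ℝ) (φ : ℝ → ℝ) : Prop where
  wave : IsTravelingWave μ c φ
  parameters : HasParameters μ c m c φ
  peaks : IsPeriodicWithCrests c HasPeakAt φ
  minimum : IsLeast (range φ) m
  maximum : IsGreatest (range φ) c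

/-- Cusped periodic traveling wave with parameters `(m, M)`, minimum `m`, maximum `c`. -/
structure IsCuspedPeriodicWave (μ c m M : ℝ) (φ : ℝ → ℝ) : Prop where
  wave : IsTravelingWave μ c φ
  parameters : HasParameters μ c m M φ
  cusps : IsPeriodicWithCrests c HasCuspAt φ
  minimum : IsLeast (range φ) m
  maximum : IsGreatest (range φ) c

/-- Anticusped periodic traveling wave with parameters `(m, M)`, minimum `c`, maximum `m`. -/
structure IsAnticuspedPeriodicWave (μ c m M : ℝ) (φ : ℝ → ℝ) : Prop where
  wave : IsTravelingWave μ c φ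
  parameters : HasParameters μ c m M φ
  anticusps : IsPeriodicWithCrests c HasAnticuspAt φ
  minimum : IsLeast (range φ) c
  maximum : IsGreatest (range φ) m

/-- Anticusped traveling wave on the line with parameters `(m, m)`: one anticusp, at height `c`
(the minimum), and limit `m` (the supremum) at both ends. -/
structure IsAnticuspedLineWave (μ c m : ℝ) (φ : ℝ → ℝ) : Prop where
  wave : IsTravelingWave μ c φ
  parameters : HasParameters μ c m m φ
  smooth : ContDiffOn ℝ ∞ φ {x | φ x ≠ c}
  anticusp : ∃ x₀, (∀ x, φ x = c ↔ x = x₀) ∧ HasAnticuspAt φ x₀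
  minimum : IsLeast (range φ) c
  supremum : IsLUB (range φ) m
  limit_right : Tendsto φ atTop (𝓝 m)
  limit_left : Tendsto φ atBot (𝓝 m)

/-- There is a profile with the property `P`, and the profiles with the property `P` are exactly
its translates. -/
def ExistsUniqueUpToTranslation (P : (ℝ → ℝ) → Prop) : Prop :=
  ∃ φ, P φ ∧ ∀ ψ, P ψ ↔ ∃ s : ℝ, ∀ x, ψ x = φ (x + s)

/-- `w` is a wave that reaches the height `c`, with parameters `(m, M)`. -/
def IsElementaryWave (μ c m M : ℝ) (w : ℝ → ℝ) : Prop :=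
  (m < c ∧ M = c ∧ IsPeakedPeriodicWave μ c m w) ∨
  (m < c ∧ c < M ∧ IsCuspedPeriodicWave μ c m M w) ∨
  (c < m ∧ m < M ∧ IsAnticuspedPeriodicWave μ c m M w) ∨
  (c < m ∧ m = M ∧ IsAnticuspedLineWave μ c m w)

/-- `φ` is glued together, at the height `c`, from segments of elementary waves that all have
`m + M = S`: on each connected component of `{φ ≠ c}` it coincides with such a wave `w`, and
that component is a component of `{w ≠ c}`, i.e. reaches from one crest of `w` to the next. -/
def IsComposite (μ c S : ℝ) (φ : ℝ → ℝ) : Prop :=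
  ∀ x, φ x ≠ c → ∃ (m M : ℝ) (w : ℝ → ℝ), m + M = S ∧ IsElementaryWave μ c m M w ∧
    connectedComponentIn {y | φ y ≠ c} x = connectedComponentIn {y | w y ≠ c} x ∧
    EqOn φ w (connectedComponentIn {y | φ y ≠ c} x)

end MuHS

/-! The weak equation says two separate things. Where `φ ≠ c` it is the ODE `2 (φ - c) φ'' + φ'² = 4
μ φ - a` (`SolvesOff`); on `{φ = c}` it only decides whether plateaus are allowed.

From weak to classical (`exists_solvesOff_of_weak`): `(φ - c)²` has a locally integrable second
derivative, hence is differentiable with continuous derivative. So `φ` is continuously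
differentiable off the height `c`, its weak derivative is the classical one there, and a second pass
gives the ODE. From classical to weak: truncations of `(φ - c)²` that vanish near `{φ = c}` are
twice differentiable and may be integrated by parts against test functions. Their error term has a
sign, so Fatou gives `φ' ∈ L²_loc`. Dominated convergence then yields the weak equation up to the
defect `(4 μ c - a) ∫_{φ = c} ψ` (`SolvesOff.integral_sq_mul`). Thus a solution off `c` satisfies
the weak equation with the constant `a` exactly when `{φ = c}` is null or `a = 4 μ c`. No further
matching condition holds at the crests, so segments with the same `a` can be glued freely.

The ODE has the first integral `(φ - c) φ'² - 2 μ φ² + a φ`. If `a = 2 μ (m + M)` and its value is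
`2 μ m M`, this is the equation that defines the parameters; so the sum `S` encodes `a`, and the
exceptional case is `S = 2 c`. The substitution `dx = √|φ - c| dy` makes the ODE linear: `W = |φ -
c|` satisfies `W'' = 2 μ (s W - κ)`, with `s` the sign of `φ - c`. Cosines below `c`, hyperbolic
cosines above `c` and an exponential for the double root give all waves, as arches between zeros of
`W`. Slopes at the crests are read off the parameter equation: infinite, unless `M = c` cancels the
denominator. Uniqueness is ODE uniqueness off `c`.

For completeness (`SolvesOff.trichotomy`), take a point with `φ ≠ c` and let `m ≤ M` be the roots of
the quadratic given by the first integral. The order of `m`, `M`, `c` and `φ x` leaves three cases: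
`φ` is unbounded or constant; `φ` is a smooth periodic wave; some elementary wave has the same value
and slope, and then the two share the whole component.

Continuity of a composite wave at height `c` is the one global issue, since infinitely many
components may accumulate. A bound on `|w - c| w'²` makes `|w - c|^(3/2)` Lipschitz away from a
crest, and short components have amplitude controlled by `S` alone
(`IsElementaryWave.amplitude_le`), so the estimate is uniform (`IsComposite.continuous`). -/

namespace MuHS

/-! ### Test functions -/

lemma IsTestFunction.continuous {ψ : ℝ → ℝ} (h : IsTestFunction ψ) : Continuous ψ :=
  h.1.continuous

lemma IsTestFunction.hasDerivAt {ψ : ℝ → ℝ} (h : IsTestFunction ψ) (x : ℝ) :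
    HasDerivAt ψ (deriv ψ x) x :=
  (h.1.differentiable (by simp) x).hasDerivAt

protected lemma IsTestFunction.deriv {ψ : ℝ → ℝ} (h : IsTestFunction ψ) : IsTestFunction (deriv ψ) :=
  ⟨(contDiff_infty_iff_deriv.1 h.1).2, h.2.deriv⟩

lemma IsTestFunction.integrable_mul {ψ f : ℝ → ℝ} (h : IsTestFunction ψ)
    (hf : LocallyIntegrable f) : Integrable fun x => f x * ψ x := by
  simpa using hf.integrable_smul_right_of_hasCompactSupport h.continuous h.2

/-- A nonnegative test function that equals `1` on a prescribed bounded interval. -/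
lemma exists_isTestFunction_eq_one (R : ℝ) :
    ∃ ψ : ℝ → ℝ, IsTestFunction ψ ∧ (∀ x, 0 ≤ ψ x) ∧ ∀ x, |x| ≤ R → ψ x = 1 := by
  let f : ContDiffBump (0 : ℝ) := ⟨|R| + 1, |R| + 2, by positivity, by linarith⟩
  refine ⟨f, ⟨f.contDiff, f.hasCompactSupport⟩, fun x => f.nonneg, fun x hx => ?_⟩
  apply f.one_of_mem_closedBall
  rw [mem_closedBall_zero_iff, Real.norm_eq_abs]
  exact hx.trans ((le_abs_self R).trans (by simp [f]))

/-- Integration by parts against a test function. -/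
lemma integral_mul_deriv_test {F F' ψ : ℝ → ℝ} (hψ : IsTestFunction ψ)
    (hF : ∀ x ∈ tsupport ψ, HasDerivAt F (F' x) x) (h0 : LocallyIntegrable F)
    (h1 : Integrable (F' * ψ)) :
    ∫ x, F x * deriv ψ x = -∫ x, F' x * ψ x :=
  integral_mul_deriv_eq_deriv_mul_of_integrable hF
    (fun x _ => hψ.hasDerivAt x) (hψ.deriv.integrable_mul h0) h1 (hψ.integrable_mul h0)

lemma eq_zero_ae_of_forall_test {f : ℝ → ℝ} (hf : LocallyIntegrable f)
    (h : ∀ ψ, IsTestFunction ψ → ∫ x, f x * ψ x = 0) : ∀ᵐ x, f x = 0 := by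
  refine ae_eq_zero_of_integral_contDiff_smul_eq_zero hf fun g h1 h2 => ?_
  rw [← h g ⟨h1, h2⟩]
  simp [mul_comm]

/-! ### Solutions away from the singular height -/

/-- `φ` is continuous and, where `φ ≠ c`, twice differentiable with
`2 (φ - c) φ'' + φ'² = 4 μ φ - a`. -/
structure SolvesOff (μ c a : ℝ) (φ : ℝ → ℝ) : Prop where
  continuous : Continuous φ
  differentiableAt : ∀ x, φ x ≠ c → DifferentiableAt ℝ φ x
  hasDerivAt_deriv : ∀ x, φ x ≠ c → HasDerivAt (deriv φ)
    ((4 * μ * φ x - a - deriv φ x ^ 2) / (2 * (φ x - c))) x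

/-- The derivative of `φ` where `φ ≠ c`, and zero elsewhere. -/
noncomputable def offDeriv (c : ℝ) (φ : ℝ → ℝ) : ℝ → ℝ :=
  {x | φ x ≠ c}.indicator (deriv φ)

lemma offDeriv_of_ne {c : ℝ} {φ : ℝ → ℝ} {x : ℝ} (h : φ x ≠ c) :
    offDeriv c φ x = deriv φ x := indicator_of_mem (s := {x | φ x ≠ c}) h _

lemma offDeriv_of_eq {c : ℝ} {φ : ℝ → ℝ} {x : ℝ} (h : φ x = c) :
    offDeriv c φ x = 0 := indicator_of_notMem (s := {x | φ x ≠ c}) (by simpa using h) _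

lemma isOpen_ne_height {c : ℝ} {φ : ℝ → ℝ} (h : Continuous φ) : IsOpen {x | φ x ≠ c} :=
  isOpen_ne_fun h continuous_const

lemma eventually_ne_height {c : ℝ} {φ : ℝ → ℝ} {x : ℝ} (h : Continuous φ) (hx : φ x ≠ c) :
    ∀ᶠ y in 𝓝 x, φ y ≠ c :=
  (isOpen_ne_height h).mem_nhds hx

lemma measurable_offDeriv {c : ℝ} {φ : ℝ → ℝ} (h : Continuous φ) : Measurable (offDeriv c φ) :=
  (measurable_deriv φ).indicator (isOpen_ne_height h).measurableSet

lemma SolvesOff.hasDerivAt {μ c a : ℝ} {φ : ℝ → ℝ} (h : SolvesOff μ c a φ) {x : ℝ}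
    (hx : φ x ≠ c) : HasDerivAt φ (deriv φ x) x :=
  (h.differentiableAt x hx).hasDerivAt

lemma offDeriv_eventuallyEq {c : ℝ} {φ : ℝ → ℝ} (h : Continuous φ) {x : ℝ} (hx : φ x ≠ c) :
    offDeriv c φ =ᶠ[𝓝 x] deriv φ := by
  filter_upwards [eventually_ne_height h hx] with y hy using offDeriv_of_ne hy

lemma SolvesOff.hasDerivAt_offDeriv {μ c a : ℝ} {φ : ℝ → ℝ} (h : SolvesOff μ c a φ) {x : ℝ}
    (hx : φ x ≠ c) : HasDerivAt (offDeriv c φ)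
    ((4 * μ * φ x - a - deriv φ x ^ 2) / (2 * (φ x - c))) x :=
  (h.hasDerivAt_deriv x hx).congr_of_eventuallyEq (offDeriv_eventuallyEq h.continuous hx)

/-! ### Truncations of the square near zero -/

/-- A `C²` truncation of `s ↦ s²` that vanishes for `s² ≤ ε`. -/
noncomputable def truncSq (ε s : ℝ) : ℝ := max (s ^ 2 - ε) 0 ^ 3 / s ^ 4

/-- The cutoff factor in `(truncSq ε)' = 2 s * cutoff ε s`. -/
noncomputable def cutoff (ε s : ℝ) : ℝ := max (s ^ 2 - ε) 0 ^ 2 * (s ^ 2 + 2 * ε) / s ^ 6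

/-- The error term in `(s * cutoff ε s)' = cutoff ε s + 2 * cutoffErr ε s`. -/
noncomputable def cutoffErr (ε s : ℝ) : ℝ := 6 * ε ^ 2 * max (s ^ 2 - ε) 0 / s ^ 6

/-- Only the kink at `0` needs care: there `|max y 0| ≤ |y|`, so the function is dominated by `y ^
(n + 2)`, which is `o(y)`. -/
lemma hasDerivAt_max_zero_pow (n : ℕ) (x : ℝ) :
    HasDerivAt (fun y : ℝ => max y 0 ^ (n + 2)) ((n + 2) * max x 0 ^ (n + 1)) x := by
  rcases lt_trichotomy x 0 with h | h | h
  · have : (fun y : ℝ => max y 0 ^ (n + 2)) =ᶠ[𝓝 x] fun _ => 0 := by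
      filter_upwards [Iio_mem_nhds h] with y hy
      simp [max_eq_right (mem_Iio.1 hy).le]
    simpa [max_eq_right h.le] using (hasDerivAt_const x (0 : ℝ)).congr_of_eventuallyEq this
  · subst h
    have h1 : HasDerivAt (fun y : ℝ => y ^ (n + 2)) 0 0 := by
      simpa using hasDerivAt_pow (n + 2) (0 : ℝ)
    rw [hasDerivAt_iff_isLittleO] at h1 ⊢
    refine (Asymptotics.IsBigO.of_bound 1 (Eventually.of_forall fun y => ?_)).trans_isLittleO h1
    simp only [max_self, ne_eq, Nat.add_eq_zero_iff, one_ne_zero, and_false, not_false_eq_true,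
      zero_pow, mul_zero, smul_zero, sub_zero, norm_pow, Real.norm_eq_abs, one_mul,
      OfNat.ofNat_ne_zero]
    refine pow_le_pow_left₀ (abs_nonneg _) ?_ _
    rcases le_total y 0 with h | h <;> simp [h, abs_nonneg]
  · have : (fun y : ℝ => max y 0 ^ (n + 2)) =ᶠ[𝓝 x] fun y => y ^ (n + 2) := by
      filter_upwards [Ioi_mem_nhds h] with y hy
      simp [max_eq_left (mem_Ioi.1 hy).le]
    have h2 := (hasDerivAt_pow (n + 2) x).congr_of_eventuallyEq this
    simpa [max_eq_left h.le] using h2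

lemma hasDerivAt_truncSq {s : ℝ} (ε : ℝ) (hs : s ≠ 0) :
    HasDerivAt (truncSq ε) (2 * s * cutoff ε s) s := by
  have h1 : HasDerivAt (fun s : ℝ => s ^ 2 - ε) (2 * s) s := by
    simpa using (hasDerivAt_pow 2 s).sub_const ε
  have h2 := (hasDerivAt_max_zero_pow 1 (s ^ 2 - ε)).comp s h1
  have h3 := h2.div (hasDerivAt_pow 4 s) (pow_ne_zero 4 hs)
  refine h3.congr_deriv ?_
  simp only [cutoff, Function.comp]
  rcases le_total (s ^ 2 - ε) 0 with h | h
  · simp [h]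
  · rw [max_eq_left h]
    field_simp
    push_cast
    ring

lemma hasDerivAt_mul_cutoff {s : ℝ} (ε : ℝ) (hs : s ≠ 0) :
    HasDerivAt (fun s => s * cutoff ε s) (cutoff ε s + 2 * cutoffErr ε s) s := by
  have h1 : HasDerivAt (fun s : ℝ => s ^ 2 - ε) (2 * s) s := by
    simpa using (hasDerivAt_pow 2 s).sub_const ε
  have h1' : HasDerivAt (fun s : ℝ => s ^ 2 + 2 * ε) (2 * s) s := by
    simpa using (hasDerivAt_pow 2 s).add_const (2 * ε)
  have h2 := (hasDerivAt_max_zero_pow 0 (s ^ 2 - ε)).comp s h1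
  have h3 := (h2.mul h1').div (hasDerivAt_pow 6 s) (pow_ne_zero 6 hs)
  have h4 := (hasDerivAt_id s).mul h3
  refine h4.congr_deriv ?_
  simp only [cutoff, cutoffErr, Function.comp_apply, id, Pi.mul_apply, Pi.div_apply]
  rcases le_total (s ^ 2 - ε) 0 with h | h
  · simp [h]
  · simp only [max_eq_left h]
    field_simp
    push_cast
    ring

lemma cutoff_nonneg {ε : ℝ} (hε : 0 < ε) (s : ℝ) : 0 ≤ cutoff ε s := by
  unfold cutoff; positivity

lemma cutoffErr_nonneg {ε : ℝ} (s : ℝ) : 0 ≤ cutoffErr ε s := by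
  unfold cutoffErr; positivity

lemma truncSq_nonneg (ε s : ℝ) : 0 ≤ truncSq ε s := by
  unfold truncSq; positivity

lemma cutoff_le_one {ε : ℝ} (hε : 0 < ε) (s : ℝ) : cutoff ε s ≤ 1 := by
  unfold cutoff
  apply div_le_one_of_le₀ _ (by positivity)
  rcases le_total (s ^ 2 - ε) 0 with h | h
  · rw [max_eq_right h]
    linarith [show 0 ≤ s ^ 6 by positivity]
  · rw [max_eq_left h]
    -- With `t = s²`, the numerator is `(t - ε)² (t + 2 ε) = t³ - ε² (3 (t - ε) + ε)`.
    nlinarith [mul_nonneg (sq_nonneg ε) h, pow_pos hε 3, sq_nonneg ε]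

lemma cutoffErr_le {ε : ℝ} (hε : 0 < ε) (s : ℝ) : cutoffErr ε s ≤ 6 := by
  unfold cutoffErr
  apply div_le_of_le_mul₀ (by positivity) (by norm_num)
  rcases le_total (s ^ 2 - ε) 0 with h | h
  · rw [max_eq_right h]
    linarith [show 0 ≤ s ^ 6 by positivity]
  · rw [max_eq_left h, mul_assoc]
    have h1 : ε ^ 2 ≤ (s ^ 2) ^ 2 := pow_le_pow_left₀ hε.le (by linarith) 2
    have h2 : ε ^ 2 * (s ^ 2 - ε) ≤ (s ^ 2) ^ 2 * s ^ 2 :=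
      mul_le_mul h1 (by linarith) h (by positivity)
    nlinarith

lemma truncSq_le {ε : ℝ} (hε : 0 < ε) (s : ℝ) : truncSq ε s ≤ s ^ 2 := by
  unfold truncSq
  apply div_le_of_le_mul₀ (by positivity) (by positivity)
  have h : max (s ^ 2 - ε) 0 ≤ s ^ 2 := max_le (by linarith) (by positivity)
  calc max (s ^ 2 - ε) 0 ^ 3 ≤ (s ^ 2) ^ 3 := pow_le_pow_left₀ (le_max_right _ _) h 3
    _ = _ := by ring

lemma truncSq_of_le {ε s : ℝ} (h : s ^ 2 ≤ ε) : truncSq ε s = 0 := by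
  simp [truncSq, max_eq_right (sub_nonpos.2 h)]

lemma cutoff_of_le {ε s : ℝ} (h : s ^ 2 ≤ ε) : cutoff ε s = 0 := by
  simp [cutoff, max_eq_right (sub_nonpos.2 h)]

lemma cutoffErr_of_le {ε s : ℝ} (h : s ^ 2 ≤ ε) : cutoffErr ε s = 0 := by
  simp [cutoffErr, max_eq_right (sub_nonpos.2 h)]

lemma continuousAt_cutoff {s : ℝ} (ε : ℝ) (hs : s ≠ 0) : ContinuousAt (cutoff ε) s := by
  unfold cutoff
  exact ContinuousAt.div (by fun_prop) (by fun_prop) (pow_ne_zero 6 hs)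

lemma continuousAt_cutoffErr {s : ℝ} (ε : ℝ) (hs : s ≠ 0) : ContinuousAt (cutoffErr ε) s := by
  unfold cutoffErr
  exact ContinuousAt.div (by fun_prop) (by fun_prop) (pow_ne_zero 6 hs)

lemma tendsto_cutoff {s : ℝ} (hs : s ≠ 0) : Tendsto (fun ε => cutoff ε s) (𝓝 0) (𝓝 1) := by
  have h : Continuous fun ε => cutoff ε s := by unfold cutoff; fun_prop
  have h0 : cutoff 0 s = 1 := by
    have : max (s ^ 2) 0 = s ^ 2 := max_eq_left (by positivity)
    simp only [cutoff, sub_zero, this]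
    field_simp
    simp
  simpa [h0] using h.tendsto 0

lemma tendsto_cutoffErr (s : ℝ) : Tendsto (fun ε => cutoffErr ε s) (𝓝 0) (𝓝 0) := by
  have h : Continuous fun ε => cutoffErr ε s := by unfold cutoffErr; fun_prop
  simpa [cutoffErr] using h.tendsto 0

lemma tendsto_truncSq (s : ℝ) : Tendsto (fun ε => truncSq ε s) (𝓝 0) (𝓝 (s ^ 2)) := by
  have h : Continuous fun ε => truncSq ε s := by unfold truncSq; fun_prop
  have h0 : truncSq 0 s = s ^ 2 := by
    have : max (s ^ 2) 0 = s ^ 2 := max_eq_left (by positivity)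
    simp only [truncSq, sub_zero, this]
    rcases eq_or_ne s 0 with rfl | hs
    · simp
    · field_simp
  simpa [h0] using h.tendsto 0


/-! ### The weak form of the equation for solutions away from the singular height -/

section Weak

variable {μ c a : ℝ} {φ : ℝ → ℝ}

lemma eventually_sq_sub_le (hφ : Continuous φ) {ε : ℝ} (hε : 0 < ε) {x : ℝ} (hx : φ x = c) :
    ∀ᶠ y in 𝓝 x, (φ y - c) ^ 2 ≤ ε := by
  have h : Continuous fun y => (φ y - c) ^ 2 := by fun_prop
  have h2 : (fun y => (φ y - c) ^ 2) x < ε := by simpa [hx] using hε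
  filter_upwards [h.continuousAt.eventually_lt continuousAt_const h2] with y hy using hy.le

/-- Near a point of height `c` the factor `q (φ - c)` is identically zero, so `f` may be arbitrarily
bad there. This is how the truncation removes the singular set. -/
lemma continuous_comp_mul_of_cutoff (hφ : Continuous φ) {ε : ℝ} (hε : 0 < ε) {q f : ℝ → ℝ}
    (hq0 : ∀ s, s ^ 2 ≤ ε → q s = 0) (hq : ∀ s, s ≠ 0 → ContinuousAt q s)
    (hf : ∀ x, φ x ≠ c → ContinuousAt f x) : Continuous fun x => q (φ x - c) * f x := by
  rw [continuous_iff_continuousAt]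
  intro x
  by_cases hx : φ x = c
  · have : (fun x => q (φ x - c) * f x) =ᶠ[𝓝 x] fun _ => 0 := by
      filter_upwards [eventually_sq_sub_le hφ hε hx] with y hy
      rw [hq0 _ hy, zero_mul]
    exact continuousAt_const.congr this.symm
  · refine ContinuousAt.mul ?_ (hf x hx)
    exact ContinuousAt.comp (g := q) (f := fun x => φ x - c) (hq _ (sub_ne_zero.2 hx))
      (by fun_prop)

lemma SolvesOff.continuousAt_offDeriv (h : SolvesOff μ c a φ) {x : ℝ} (hx : φ x ≠ c) :
    ContinuousAt (offDeriv c φ) x :=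
  (h.hasDerivAt_offDeriv hx).continuousAt

lemma SolvesOff.hasDerivAt_truncSq (h : SolvesOff μ c a φ) {ε : ℝ} (hε : 0 < ε) (x : ℝ) :
    HasDerivAt (fun x => truncSq ε (φ x - c))
      (2 * ((φ x - c) * cutoff ε (φ x - c)) * offDeriv c φ x) x := by
  by_cases hx : φ x = c
  · have : (fun x => truncSq ε (φ x - c)) =ᶠ[𝓝 x] fun _ => 0 := by
      filter_upwards [eventually_sq_sub_le h.continuous hε hx] with y hy using truncSq_of_le hy
    simpa [offDeriv_of_eq hx] using (hasDerivAt_const x (0 : ℝ)).congr_of_eventuallyEq this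
  · have h1 := (MuHS.hasDerivAt_truncSq ε (sub_ne_zero.2 hx)).comp x ((h.hasDerivAt hx).sub_const c)
    refine h1.congr_deriv ?_
    rw [offDeriv_of_ne hx]
    ring

lemma SolvesOff.hasDerivAt_mul_cutoff (h : SolvesOff μ c a φ) {ε : ℝ} (hε : 0 < ε) (x : ℝ) :
    HasDerivAt (fun x => (φ x - c) * cutoff ε (φ x - c))
      ((cutoff ε (φ x - c) + 2 * cutoffErr ε (φ x - c)) * offDeriv c φ x) x := by
  by_cases hx : φ x = c
  · have : (fun x => (φ x - c) * cutoff ε (φ x - c)) =ᶠ[𝓝 x] fun _ => 0 := by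
      filter_upwards [eventually_sq_sub_le h.continuous hε hx] with y hy
      rw [cutoff_of_le hy, mul_zero]
    simpa [offDeriv_of_eq hx] using (hasDerivAt_const x (0 : ℝ)).congr_of_eventuallyEq this
  · have h1 := (MuHS.hasDerivAt_mul_cutoff ε (sub_ne_zero.2 hx)).comp x
      ((h.hasDerivAt hx).sub_const c)
    rwa [offDeriv_of_ne hx]

/-- The second derivative of the truncation of `(φ - c)²`. -/
noncomputable def truncSecond (μ c a ε : ℝ) (φ : ℝ → ℝ) (x : ℝ) : ℝ :=
  cutoff ε (φ x - c) * (offDeriv c φ x ^ 2 + (4 * μ * φ x - a)) +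
    cutoffErr ε (φ x - c) * (4 * offDeriv c φ x ^ 2)

/-- This is where the equation enters: it trades `2 (φ - c) φ''` for `4 μ φ - a - φ'²`, so neither a
second derivative nor a division by `φ - c` survives outside the cutoffs. -/
lemma SolvesOff.hasDerivAt_truncSecond (h : SolvesOff μ c a φ) {ε : ℝ} (hε : 0 < ε) (x : ℝ) :
    HasDerivAt (fun x => 2 * ((φ x - c) * cutoff ε (φ x - c)) * offDeriv c φ x)
      (truncSecond μ c a ε φ x) x := by
  by_cases hx : φ x = c
  · have : (fun x => 2 * ((φ x - c) * cutoff ε (φ x - c)) * offDeriv c φ x) =ᶠ[𝓝 x]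
        fun _ => 0 := by
      filter_upwards [eventually_sq_sub_le h.continuous hε hx] with y hy
      rw [cutoff_of_le hy]; ring
    have h0 : (φ x - c) ^ 2 ≤ ε := by simp [hx, hε.le]
    simpa [truncSecond, cutoff_of_le h0, cutoffErr_of_le h0] using
      (hasDerivAt_const x (0 : ℝ)).congr_of_eventuallyEq this
  · have h1 := ((h.hasDerivAt_mul_cutoff hε x).const_mul 2).mul (h.hasDerivAt_offDeriv hx)
    refine h1.congr_deriv ?_
    rw [offDeriv_of_ne hx, truncSecond, offDeriv_of_ne hx]
    have := sub_ne_zero.2 hx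
    field_simp
    ring

lemma SolvesOff.continuous_truncSecond (h : SolvesOff μ c a φ) {ε : ℝ} (hε : 0 < ε) :
    Continuous (truncSecond μ c a ε φ) := by
  have hc := h.continuous
  refine Continuous.add ?_ ?_
  · exact continuous_comp_mul_of_cutoff hc hε (fun s => cutoff_of_le)
      (fun s => continuousAt_cutoff ε)
      (fun x hx => ((h.continuousAt_offDeriv hx).pow 2).add (by fun_prop))
  · exact continuous_comp_mul_of_cutoff hc hε (fun s => cutoffErr_of_le)
      (fun s => continuousAt_cutoffErr ε)
      (fun x hx => continuousAt_const.mul ((h.continuousAt_offDeriv hx).pow 2))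

lemma SolvesOff.integral_truncSq (h : SolvesOff μ c a φ) {ε : ℝ} (hε : 0 < ε) {ψ : ℝ → ℝ}
    (hψ : IsTestFunction ψ) :
    ∫ x, truncSq ε (φ x - c) * deriv (deriv ψ) x = ∫ x, truncSecond μ c a ε φ x * ψ x := by
  have c0 : Continuous fun x => truncSq ε (φ x - c) :=
    continuous_iff_continuousAt.2 fun x => (h.hasDerivAt_truncSq hε x).continuousAt
  have c1 : Continuous fun x => 2 * ((φ x - c) * cutoff ε (φ x - c)) * offDeriv c φ x :=
    continuous_iff_continuousAt.2 fun x => (h.hasDerivAt_truncSecond hε x).continuousAt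
  rw [integral_mul_deriv_test hψ.deriv (fun x _ => h.hasDerivAt_truncSq hε x)
      c0.locallyIntegrable (hψ.deriv.integrable_mul c1.locallyIntegrable),
    integral_mul_deriv_test hψ (fun x _ => h.hasDerivAt_truncSecond hε x)
      c1.locallyIntegrable
      (hψ.integrable_mul (h.continuous_truncSecond hε).locallyIntegrable), neg_neg]

lemma measurable_cutoff (ε : ℝ) : Measurable (cutoff ε) := by unfold cutoff; fun_prop

lemma measurable_cutoffErr (ε : ℝ) : Measurable (cutoffErr ε) := by unfold cutoffErr; fun_prop

lemma measurable_truncSq (ε : ℝ) : Measurable (truncSq ε) := by unfold truncSq; fun_prop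

/-- A sequence of positive truncation parameters with limit zero. -/
noncomputable def truncParam (n : ℕ) : ℝ := 1 / ((n : ℝ) + 1)

lemma truncParam_pos (n : ℕ) : 0 < truncParam n := by unfold truncParam; positivity

lemma tendsto_truncParam : Tendsto truncParam atTop (𝓝 0) :=
  tendsto_one_div_add_atTop_nhds_zero_nat

/-- After testing with `ψ ≥ 0`, the `cutoffErr` term is nonnegative and can be dropped. What remains
is bounded independently of `ε`, as Fatou's lemma will require. -/
lemma SolvesOff.integral_cutoff_mul_sq_le (h : SolvesOff μ c a φ) {ε : ℝ} (hε : 0 < ε)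
    {ψ : ℝ → ℝ} (hψ : IsTestFunction ψ) (h0 : ∀ x, 0 ≤ ψ x) :
    Integrable (fun x => cutoff ε (φ x - c) * offDeriv c φ x ^ 2 * ψ x) ∧
    ∫ x, cutoff ε (φ x - c) * offDeriv c φ x ^ 2 * ψ x ≤
      (∫ x, |(φ x - c) ^ 2 * deriv (deriv ψ) x|) + ∫ x, |(4 * μ * φ x - a) * ψ x| := by
  have hc := h.continuous
  have k1 : Continuous fun x => cutoff ε (φ x - c) * offDeriv c φ x ^ 2 :=
    continuous_comp_mul_of_cutoff hc hε (fun s => cutoff_of_le)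
      (fun s => continuousAt_cutoff ε) (fun x hx => (h.continuousAt_offDeriv hx).pow 2)
  have i1 := hψ.integrable_mul k1.locallyIntegrable
  refine ⟨i1, ?_⟩
  have i2 := hψ.integrable_mul (h.continuous_truncSecond hε).locallyIntegrable
  have i3 : Integrable fun x => |(4 * μ * φ x - a) * ψ x| :=
    (hψ.integrable_mul (f := fun x => 4 * μ * φ x - a)
      (Continuous.locallyIntegrable (by fun_prop))).abs
  have i4 : Integrable fun x => |(φ x - c) ^ 2 * deriv (deriv ψ) x| :=
    (hψ.deriv.deriv.integrable_mul (f := fun x => (φ x - c) ^ 2)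
      (Continuous.locallyIntegrable (by fun_prop))).abs
  have i5 : Integrable fun x => truncSq ε (φ x - c) * deriv (deriv ψ) x := by
    refine i4.mono ?_ (Eventually.of_forall fun x => ?_)
    · exact ((measurable_truncSq ε).comp (hc.measurable.sub_const c)).aestronglyMeasurable.mul
        hψ.deriv.deriv.continuous.aestronglyMeasurable
    · simp only [norm_mul, Real.norm_eq_abs, abs_abs, abs_mul, abs_of_nonneg (truncSq_nonneg _ _),
        abs_of_nonneg (sq_nonneg (φ x - c))]
      exact mul_le_mul_of_nonneg_right (truncSq_le hε _) (abs_nonneg _)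
  calc ∫ x, cutoff ε (φ x - c) * offDeriv c φ x ^ 2 * ψ x
      ≤ ∫ x, (truncSecond μ c a ε φ x * ψ x + |(4 * μ * φ x - a) * ψ x|) := by
        refine integral_mono i1 (i2.add i3) fun x => ?_
        have e1 : -|(4 * μ * φ x - a) * ψ x| ≤
            cutoff ε (φ x - c) * ((4 * μ * φ x - a) * ψ x) := by
          have := abs_le.1 ((abs_mul (cutoff ε (φ x - c)) ((4 * μ * φ x - a) * ψ x)).le.trans
            (mul_le_of_le_one_left (abs_nonneg _)
              ((abs_of_nonneg (cutoff_nonneg hε (φ x - c))).le.trans (cutoff_le_one hε _))))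
          exact this.1
        have e2 : 0 ≤ cutoffErr ε (φ x - c) * (4 * offDeriv c φ x ^ 2) * ψ x :=
          mul_nonneg (mul_nonneg (cutoffErr_nonneg _) (by positivity)) (h0 x)
        simp only [truncSecond]
        nlinarith
    _ = (∫ x, truncSq ε (φ x - c) * deriv (deriv ψ) x) + ∫ x, |(4 * μ * φ x - a) * ψ x| := by
        rw [integral_add i2 i3, h.integral_truncSq hε hψ]
    _ ≤ _ := by
        refine add_le_add (integral_mono i5 i4 fun x => ?_) le_rfl
        · beta_reduce
          rw [abs_mul, abs_of_nonneg (sq_nonneg (φ x - c))]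
          exact (mul_le_mul_of_nonneg_left (le_abs_self _) (truncSq_nonneg _ _)).trans
            (mul_le_mul_of_nonneg_right (truncSq_le hε _) (abs_nonneg _))

/-- Fatou along `truncParam`: the cutoffs tend to `1` where `φ ≠ c`, and elsewhere `offDeriv` is
zero, so the uniform bound passes to the limit. Testing with a function equal to `1` on the given
compact set localizes it. -/
lemma SolvesOff.locallyIntegrable_sq (h : SolvesOff μ c a φ) :
    LocallyIntegrable fun x => offDeriv c φ x ^ 2 := by
  have hc := h.continuous
  have hm : Measurable fun x => offDeriv c φ x ^ 2 := (measurable_offDeriv hc).pow_const 2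
  rw [locallyIntegrable_iff]
  intro K hK
  obtain ⟨R, hR⟩ := hK.isBounded.exists_norm_le
  obtain ⟨ψ, hψ, h0, h1⟩ := exists_isTestFunction_eq_one R
  suffices H : Integrable fun x => offDeriv c φ x ^ 2 * ψ x by
    refine (H.integrableOn (s := K)).congr_fun (fun x hx => ?_) hK.measurableSet
    simp [h1 x (hR x hx)]
  refine ⟨(hm.mul hψ.continuous.measurable).aestronglyMeasurable, ?_⟩
  rw [hasFiniteIntegral_iff_ofReal
    (Eventually.of_forall fun x => mul_nonneg (sq_nonneg _) (h0 x))]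
  set C := (∫ x, |(φ x - c) ^ 2 * deriv (deriv ψ) x|) + ∫ x, |(4 * μ * φ x - a) * ψ x|
  let f : ℕ → ℝ → ENNReal := fun n x =>
    ENNReal.ofReal (cutoff (truncParam n) (φ x - c) * offDeriv c φ x ^ 2 * ψ x)
  have hf : ∀ n, Measurable (f n) := fun n =>
    ((((measurable_cutoff _).comp (hc.measurable.sub_const c)).mul hm).mul
      hψ.continuous.measurable).ennreal_ofReal
  have hlim : ∀ x, ENNReal.ofReal (offDeriv c φ x ^ 2 * ψ x) = liminf (fun n => f n x) atTop := by
    intro x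
    symm
    apply Tendsto.liminf_eq
    apply ENNReal.tendsto_ofReal
    by_cases hx : φ x = c
    · simp [offDeriv_of_eq hx]
    · have := (tendsto_cutoff (sub_ne_zero.2 hx)).comp tendsto_truncParam
      simpa using (this.mul_const (offDeriv c φ x ^ 2)).mul_const (ψ x)
  simp_rw [hlim]
  refine (lintegral_liminf_le hf).trans_lt (lt_of_le_of_lt ?_ (ENNReal.ofReal_lt_top (r := C)))
  refine liminf_le_of_le (by isBoundedDefault) fun b hb => ?_
  obtain ⟨n, hn⟩ := hb.exists
  refine hn.trans ?_
  obtain ⟨i1, i2⟩ := h.integral_cutoff_mul_sq_le (truncParam_pos n) hψ h0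
  rw [← ofReal_integral_eq_lintegral_ofReal i1 (Eventually.of_forall fun x =>
    mul_nonneg (mul_nonneg (cutoff_nonneg (truncParam_pos n) _) (sq_nonneg _)) (h0 x))]
  exact ENNReal.ofReal_le_ofReal i2

lemma memL2Loc_of_sq {f : ℝ → ℝ} (hf : Measurable f) (h : LocallyIntegrable fun x => f x ^ 2) :
    MemL2Loc f := fun K hK =>
  (memLp_two_iff_integrable_sq hf.aestronglyMeasurable).2
    (locallyIntegrable_iff.1 h K hK)

lemma MemL2Loc.locallyIntegrable {f : ℝ → ℝ} (h : MemL2Loc f) : LocallyIntegrable f := by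
  rw [locallyIntegrable_iff]
  intro K hK
  have : IsFiniteMeasure (volume.restrict K) := ⟨by simpa using hK.measure_lt_top⟩
  exact (h K hK).integrable (by norm_num)

lemma MemL2Loc.sq {f : ℝ → ℝ} (h : MemL2Loc f) : LocallyIntegrable fun x => f x ^ 2 := by
  rw [locallyIntegrable_iff]
  intro K hK
  exact (memLp_two_iff_integrable_sq (h K hK).1).1 (h K hK)

lemma SolvesOff.memL2Loc_offDeriv (h : SolvesOff μ c a φ) : MemL2Loc (offDeriv c φ) :=
  memL2Loc_of_sq (measurable_offDeriv h.continuous) h.locallyIntegrable_sq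

/-- Integrate the truncation `(φ - c) * cutoff` of `φ - c` by parts and let `ε → 0`. It vanishes
near `{φ = c}`, so the crests contribute nothing, and local integrability of `offDeriv` provides the
dominating function. -/
lemma SolvesOff.isWeakDeriv (h : SolvesOff μ c a φ) : IsWeakDeriv φ (offDeriv c φ) := by
  have hc := h.continuous
  have hl := h.memL2Loc_offDeriv.locallyIntegrable
  refine ⟨hc.locallyIntegrable, hl, fun ψ hψ => ?_⟩
  have key : ∀ n, ∫ x, (φ x - c) * cutoff (truncParam n) (φ x - c) * deriv ψ x =
      -∫ x, (cutoff (truncParam n) (φ x - c) + 2 * cutoffErr (truncParam n) (φ x - c)) *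
        offDeriv c φ x * ψ x := by
    intro n
    have hε := truncParam_pos n
    have c0 : Continuous fun x => (φ x - c) * cutoff (truncParam n) (φ x - c) :=
      continuous_iff_continuousAt.2 fun x => (h.hasDerivAt_mul_cutoff hε x).continuousAt
    have c1 : Continuous fun x => (cutoff (truncParam n) (φ x - c) +
        2 * cutoffErr (truncParam n) (φ x - c)) * offDeriv c φ x :=
      continuous_comp_mul_of_cutoff hc hε
        (q := fun s => cutoff (truncParam n) s + 2 * cutoffErr (truncParam n) s)
        (fun s hs => by simp [cutoff_of_le hs, cutoffErr_of_le hs])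
        (fun s hs => (continuousAt_cutoff _ hs).add
          (continuousAt_const.mul (continuousAt_cutoffErr _ hs)))
        (fun x hx => h.continuousAt_offDeriv hx)
    exact integral_mul_deriv_test hψ (fun x _ => h.hasDerivAt_mul_cutoff hε x)
      c0.locallyIntegrable (hψ.integrable_mul c1.locallyIntegrable)
  have mc : ∀ n, Measurable fun x => cutoff (truncParam n) (φ x - c) := fun n =>
    (measurable_cutoff _).comp (hc.measurable.sub_const c)
  have mr : ∀ n, Measurable fun x => cutoffErr (truncParam n) (φ x - c) := fun n =>
    (measurable_cutoffErr _).comp (hc.measurable.sub_const c)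
  have mD := measurable_offDeriv (c := c) hc
  have lim1 : Tendsto (fun n => ∫ x, (φ x - c) * cutoff (truncParam n) (φ x - c) * deriv ψ x)
      atTop (𝓝 (∫ x, (φ x - c) * deriv ψ x)) := by
    refine tendsto_integral_of_dominated_convergence (fun x => |(φ x - c) * deriv ψ x|)
      (fun n => (((hc.measurable.sub_const c).mul (mc n)).mul
        hψ.deriv.continuous.measurable).aestronglyMeasurable)
      (hψ.deriv.integrable_mul (f := fun x => φ x - c)
        (Continuous.locallyIntegrable (by fun_prop))).abs
      (fun n => Eventually.of_forall fun x => ?_) (Eventually.of_forall fun x => ?_)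
    · have e1 := cutoff_nonneg (truncParam_pos n) (φ x - c)
      have e2 := cutoff_le_one (truncParam_pos n) (φ x - c)
      rw [mul_right_comm, norm_mul, Real.norm_eq_abs, Real.norm_eq_abs, abs_of_nonneg e1]
      exact mul_le_of_le_one_right (abs_nonneg _) e2
    · by_cases hx : φ x = c
      · simp [hx]
      · have := (tendsto_cutoff (sub_ne_zero.2 hx)).comp tendsto_truncParam
        simpa using (this.const_mul (φ x - c)).mul_const (deriv ψ x)
  have lim2 : Tendsto (fun n => ∫ x, (cutoff (truncParam n) (φ x - c) +
      2 * cutoffErr (truncParam n) (φ x - c)) * offDeriv c φ x * ψ x)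
      atTop (𝓝 (∫ x, offDeriv c φ x * ψ x)) := by
    -- `13 = 1 + 2 * 6`, from `cutoff ≤ 1` and `cutoffErr ≤ 6`.
    refine tendsto_integral_of_dominated_convergence (fun x => 13 * |offDeriv c φ x * ψ x|)
      (fun n => ((((mc n).add ((mr n).const_mul 2)).mul mD).mul
        hψ.continuous.measurable).aestronglyMeasurable)
      ((hψ.integrable_mul hl).abs.const_mul 13)
      (fun n => Eventually.of_forall fun x => ?_) (Eventually.of_forall fun x => ?_)
    · have e1 := cutoff_nonneg (truncParam_pos n) (φ x - c)
      have e2 := cutoff_le_one (truncParam_pos n) (φ x - c)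
      have e3 := cutoffErr_nonneg (ε := truncParam n) (φ x - c)
      have e4 := cutoffErr_le (truncParam_pos n) (φ x - c)
      rw [mul_assoc, norm_mul, Real.norm_eq_abs, Real.norm_eq_abs, abs_of_nonneg (by linarith)]
      exact mul_le_mul_of_nonneg_right (by linarith) (abs_nonneg _)
    · by_cases hx : φ x = c
      · simp [offDeriv_of_eq hx]
      · have t1 := (tendsto_cutoff (sub_ne_zero.2 hx)).comp tendsto_truncParam
        have t2 := (tendsto_cutoffErr (φ x - c)).comp tendsto_truncParam
        simpa using ((t1.add (t2.const_mul 2)).mul_const (offDeriv c φ x)).mul_const (ψ x)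
  simp_rw [key] at lim1
  have e := tendsto_nhds_unique lim1 lim2.neg
  -- The truncations converge to `φ - c` rather than `φ`; constants are invisible to derivatives of
  -- test functions.
  have hz : ∫ x, c * deriv ψ x = 0 := by
    have := integral_mul_deriv_test (F := fun _ => c) (F' := fun _ => 0) hψ
      (fun x _ => hasDerivAt_const x c) continuous_const.locallyIntegrable
      (by simp [Pi.mul_def])
    simpa using this
  rw [← e]
  rw [← sub_eq_zero, ← integral_sub (hψ.deriv.integrable_mul hc.locallyIntegrable)
    (hψ.deriv.integrable_mul (f := fun x => φ x - c)
        (Continuous.locallyIntegrable (by fun_prop))), ← hz]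
  congr 1 with x
  ring

/-- The weak form of the equation, with a defect supported where `φ = c`. -/
lemma SolvesOff.integral_sq_mul (h : SolvesOff μ c a φ) {ψ : ℝ → ℝ} (hψ : IsTestFunction ψ) :
    ∫ x, offDeriv c φ x ^ 2 * ψ x =
      (∫ x, (-4 * μ * φ x + a) * ψ x) + (∫ x, (φ x - c) ^ 2 * deriv (deriv ψ) x) +
        (4 * μ * c - a) * ∫ x in {x | φ x = c}, ψ x := by
  have hc := h.continuous
  have hl := h.locallyIntegrable_sq
  have hZ : MeasurableSet {x | φ x = c} := (isClosed_eq hc continuous_const).measurableSet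
  have mc : ∀ n, Measurable fun x => cutoff (truncParam n) (φ x - c) := fun n =>
    (measurable_cutoff _).comp (hc.measurable.sub_const c)
  have mr : ∀ n, Measurable fun x => cutoffErr (truncParam n) (φ x - c) := fun n =>
    (measurable_cutoffErr _).comp (hc.measurable.sub_const c)
  have mD := measurable_offDeriv (c := c) hc
  have mφ := hc.measurable
  have j1 : Integrable fun x => (4 * μ * φ x - a) * ψ x :=
    hψ.integrable_mul (f := fun x => 4 * μ * φ x - a) (Continuous.locallyIntegrable (by fun_prop))
  have j2 : Integrable fun x => offDeriv c φ x ^ 2 * ψ x := hψ.integrable_mul hl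
  have j3 : Integrable fun x => (φ x - c) ^ 2 * deriv (deriv ψ) x :=
    hψ.deriv.deriv.integrable_mul (f := fun x => (φ x - c) ^ 2)
      (Continuous.locallyIntegrable (by fun_prop))
  have j4 : Integrable fun x => {x | φ x = c}.indicator (fun x => (4 * μ * c - a) * ψ x) x :=
    ((hψ.continuous.integrable_of_hasCompactSupport hψ.2).const_mul (4 * μ * c - a)).indicator hZ
  have lim1 : Tendsto (fun n => ∫ x, truncSq (truncParam n) (φ x - c) * deriv (deriv ψ) x)
      atTop (𝓝 (∫ x, (φ x - c) ^ 2 * deriv (deriv ψ) x)) := by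
    refine tendsto_integral_of_dominated_convergence
      (fun x => |(φ x - c) ^ 2 * deriv (deriv ψ) x|)
      (fun n => (((measurable_truncSq _).comp (mφ.sub_const c)).mul
        hψ.deriv.deriv.continuous.measurable).aestronglyMeasurable) j3.abs
      (fun n => Eventually.of_forall fun x => ?_) (Eventually.of_forall fun x => ?_)
    · rw [norm_mul, abs_mul, Real.norm_eq_abs, Real.norm_eq_abs,
        abs_of_nonneg (truncSq_nonneg _ _), abs_of_nonneg (sq_nonneg (φ x - c))]
      exact mul_le_mul_of_nonneg_right (truncSq_le (truncParam_pos n) _) (abs_nonneg _)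
    · exact ((tendsto_truncSq _).comp tendsto_truncParam).mul_const _
  -- On `{φ = c}` both cutoffs vanish for every `n`, although `4 μ φ - a` need not; the indicator
  -- subtracts that term and is the source of the defect. The dominating constant is `25 = 1 + 4 *
  -- 6`.
  have lim2 : Tendsto (fun n => ∫ x, truncSecond μ c a (truncParam n) φ x * ψ x)
      atTop (𝓝 (∫ x, (offDeriv c φ x ^ 2 * ψ x + (4 * μ * φ x - a) * ψ x -
        {x | φ x = c}.indicator (fun x => (4 * μ * c - a) * ψ x) x))) := by
    refine tendsto_integral_of_dominated_convergence
      (fun x => 25 * |offDeriv c φ x ^ 2 * ψ x| + |(4 * μ * φ x - a) * ψ x|)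
      (fun n => ((h.continuous_truncSecond (truncParam_pos n)).mul
        hψ.continuous).aestronglyMeasurable)
      ((j2.abs.const_mul 25).add j1.abs)
      (fun n => Eventually.of_forall fun x => ?_) (Eventually.of_forall fun x => ?_)
    · have e1 := cutoff_nonneg (truncParam_pos n) (φ x - c)
      have e2 := cutoff_le_one (truncParam_pos n) (φ x - c)
      have e3 := cutoffErr_nonneg (ε := truncParam n) (φ x - c)
      have e4 := cutoffErr_le (truncParam_pos n) (φ x - c)
      have : truncSecond μ c a (truncParam n) φ x * ψ x =
          (cutoff (truncParam n) (φ x - c) + 4 * cutoffErr (truncParam n) (φ x - c)) *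
            (offDeriv c φ x ^ 2 * ψ x) +
          cutoff (truncParam n) (φ x - c) * ((4 * μ * φ x - a) * ψ x) := by
        simp only [truncSecond]; ring
      rw [this]
      refine (norm_add_le _ _).trans (add_le_add ?_ ?_)
      · rw [norm_mul, Real.norm_eq_abs, Real.norm_eq_abs, abs_of_nonneg (by linarith)]
        exact mul_le_mul_of_nonneg_right (by linarith) (abs_nonneg _)
      · rw [norm_mul, Real.norm_eq_abs, Real.norm_eq_abs, abs_of_nonneg e1]
        exact mul_le_of_le_one_left (abs_nonneg _) e2
    · by_cases hx : φ x = c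
      · have h0 : ∀ n, (φ x - c) ^ 2 ≤ truncParam n := fun n => by
          simp [hx, (truncParam_pos n).le]
        have hm : x ∈ {x | φ x = c} := hx
        simp only [truncSecond, cutoff_of_le (h0 _), cutoffErr_of_le (h0 _), offDeriv_of_eq hx,
          indicator_of_mem hm]
        simp [hx]
      · have t1 := (tendsto_cutoff (sub_ne_zero.2 hx)).comp tendsto_truncParam
        have t2 := (tendsto_cutoffErr (φ x - c)).comp tendsto_truncParam
        have hm : x ∉ {x | φ x = c} := hx
        rw [indicator_of_notMem hm]
        have := ((t1.mul_const (offDeriv c φ x ^ 2 + (4 * μ * φ x - a))).add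
          (t2.mul_const (4 * offDeriv c φ x ^ 2))).mul_const (ψ x)
        simp only [one_mul, zero_mul, add_zero, add_mul] at this
        simpa [truncSecond, add_mul] using this
  simp_rw [h.integral_truncSq (truncParam_pos _) hψ] at lim1
  have e := tendsto_nhds_unique lim1 lim2
  have j12 : Integrable fun x => offDeriv c φ x ^ 2 * ψ x + (4 * μ * φ x - a) * ψ x := j2.add j1
  rw [integral_sub j12 j4, integral_add j2 j1, integral_indicator hZ,
    integral_const_mul] at e
  have e2 : ∫ x, (-4 * μ * φ x + a) * ψ x = -∫ x, (4 * μ * φ x - a) * ψ x := by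
    rw [← integral_neg]
    congr 1 with x
    ring
  rw [e, e2]
  ring

lemma SolvesOff.isH1LocWithDeriv (h : SolvesOff μ c a φ) :
    IsH1LocWithDeriv φ (offDeriv c φ) :=
  ⟨h.continuous, memL2Loc_of_sq h.continuous.measurable (h.continuous.pow 2).locallyIntegrable,
    h.memL2Loc_offDeriv, h.isWeakDeriv⟩

theorem SolvesOff.isTravelingWave (h : SolvesOff μ c a φ)
    (h0 : volume {x | φ x = c} = 0 ∨ a = 4 * μ * c) : IsTravelingWave μ c φ := by
  refine ⟨offDeriv c φ, h.isH1LocWithDeriv, a, fun ψ hψ => ?_⟩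
  rw [h.integral_sq_mul hψ]
  rcases h0 with h0 | h0
  · simp [setIntegral_measure_zero _ h0]
  · simp [h0]

lemma IsWeakDeriv.ae_eq {f g₁ g₂ : ℝ → ℝ} (h₁ : IsWeakDeriv f g₁) (h₂ : IsWeakDeriv f g₂) :
    ∀ᵐ x, g₁ x = g₂ x := by
  have := eq_zero_ae_of_forall_test (h₁.2.1.sub h₂.2.1) fun ψ hψ => by
    have e := (h₁.2.2 ψ hψ).symm.trans (h₂.2.2 ψ hψ)
    simp only [Pi.sub_apply, sub_mul]
    rw [integral_sub (hψ.integrable_mul h₁.2.1) (hψ.integrable_mul h₂.2.1)]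
    linarith
  filter_upwards [this] with x hx using sub_eq_zero.1 hx

/-- A solution away from `c` that satisfies the weak equation with the same constant has no
plateau, unless the constant is the exceptional one. -/
theorem SolvesOff.volume_eq_zero_or (h : SolvesOff μ c a φ) {g : ℝ → ℝ}
    (hg : IsWeakDeriv φ g)
    (hw : ∀ ψ : ℝ → ℝ, IsTestFunction ψ → ∫ x, (g x) ^ 2 * ψ x =
        (∫ x, (-4 * μ * φ x + a) * ψ x) + ∫ x, (φ x - c) ^ 2 * deriv (deriv ψ) x) :
    volume {x | φ x = c} = 0 ∨ a = 4 * μ * c := by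
  by_contra! hcon
  have hZ : MeasurableSet {x | φ x = c} :=
    (isClosed_eq h.continuous continuous_const).measurableSet
  have hae := hg.ae_eq h.isWeakDeriv
  -- Comparing the weak equation with the identity containing the defect leaves `(4 μ c - a) ∫_{φ =
  -- c} ψ = 0` for all test functions, so the indicator of `{φ = c}` vanishes almost everywhere.
  have key := eq_zero_ae_of_forall_test (f := {x | φ x = c}.indicator fun _ => (1 : ℝ))
    (by exact (continuous_const.locallyIntegrable (μ := volume)).indicator hZ)
    fun ψ hψ => by
      have e1 := hw ψ hψ
      have e2 := h.integral_sq_mul hψ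
      have e3 : ∫ x, (g x) ^ 2 * ψ x = ∫ x, offDeriv c φ x ^ 2 * ψ x :=
        integral_congr_ae (by filter_upwards [hae] with x hx; rw [hx])
      have e4 : (4 * μ * c - a) * ∫ x in {x | φ x = c}, ψ x = 0 := by linarith
      have e5 := (mul_eq_zero.1 e4).resolve_left (sub_ne_zero.2 (Ne.symm hcon.2))
      rw [← e5, ← integral_indicator hZ]
      congr 1 with x
      by_cases hx : x ∈ {x | φ x = c} <;> simp only [indicator_of_mem, indicator_of_notMem, hx,
        not_false_eq_true, one_mul, zero_mul]
  apply hcon.1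
  rw [measure_eq_zero_iff_ae_notMem]
  filter_upwards [key] with x hx hm
  rw [indicator_of_mem (s := {x | φ x = c}) hm] at hx
  exact one_ne_zero hx

end Weak


/-! ### Continuous functions with vanishing weak derivatives -/

lemma exists_eq_zero_of_le_abs {ψ : ℝ → ℝ} (h : HasCompactSupport ψ) :
    ∃ R : ℝ, 0 < R ∧ ∀ x, R ≤ |x| → ψ x = 0 := by
  obtain ⟨R, hR⟩ := h.isCompact.isBounded.exists_norm_le
  refine ⟨|R| + 1, by positivity, fun x hx => ?_⟩
  by_contra hne
  have := hR x (subset_tsupport ψ hne)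
  rw [Real.norm_eq_abs] at this
  linarith [le_abs_self R]

lemma IsTestFunction.integrable {ψ : ℝ → ℝ} (h : IsTestFunction ψ) : Integrable ψ :=
  h.continuous.integrable_of_hasCompactSupport h.2

/-- The primitive started to the left of the support is zero there, and to the right of the support
it equals the total integral, which is zero too. -/
lemma IsTestFunction.exists_primitive {η : ℝ → ℝ} (h : IsTestFunction η) (h0 : ∫ x, η x = 0) :
    ∃ χ, IsTestFunction χ ∧ deriv χ = η := by
  obtain ⟨R, hR, hη⟩ := exists_eq_zero_of_le_abs h.2
  have hd : ∀ x, HasDerivAt (fun x => ∫ t in (-R)..x, η t) (η x) x := fun x =>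
    intervalIntegral.integral_hasDerivAt_right (h.continuous.intervalIntegrable _ _)
      (h.continuous.stronglyMeasurableAtFilter _ _) h.continuous.continuousAt
  have hder : deriv (fun x => ∫ t in (-R)..x, η t) = η := funext fun x => (hd x).deriv
  refine ⟨fun x => ∫ t in (-R)..x, η t, ⟨?_, ?_⟩, hder⟩
  · rw [contDiff_infty_iff_deriv, hder]
    exact ⟨fun x => (hd x).differentiableAt, h.1⟩
  · refine HasCompactSupport.of_support_subset_isCompact (K := Icc (-R) R) isCompact_Icc ?_
    intro x hx
    by_contra hxR
    apply hx
    rw [mem_Icc, not_and_or, not_le, not_le] at hxR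
    rcases hxR with hxR | hxR
    · beta_reduce
      rw [intervalIntegral.integral_congr (g := fun _ => (0 : ℝ)), intervalIntegral.integral_zero]
      intro t ht
      rw [uIcc_of_ge hxR.le] at ht
      exact hη t (by rw [abs_of_nonpos (by linarith [ht.2])]; linarith [ht.2])
    · have : Function.support η ⊆ Ioc (-R) x := by
        intro t ht
        by_contra hc
        apply ht
        apply hη
        rw [mem_Ioc, not_and_or, not_lt, not_le] at hc
        rcases hc with hc | hc
        · rw [abs_of_nonpos (by linarith)]; linarith
        · exact (hxR.trans hc).le.trans (le_abs_self t)
      exact (intervalIntegral.integral_eq_integral_of_support_subset this).trans h0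

lemma exists_isTestFunction_integral_one : ∃ θ, IsTestFunction θ ∧ ∫ x, θ x = 1 := by
  let f : ContDiffBump (0 : ℝ) := ⟨1, 2, one_pos, one_lt_two⟩
  exact ⟨f.normed volume, ⟨f.contDiff_normed, f.hasCompactSupport_normed⟩, f.integral_normed⟩

lemma IsTestFunction.sub_const_mul {ψ θ : ℝ → ℝ} (hψ : IsTestFunction ψ) (hθ : IsTestFunction θ)
    (k : ℝ) : IsTestFunction fun x => ψ x - k * θ x := by
  have h2 : HasCompactSupport fun x => k * θ x := hθ.2.mul_left
  refine ⟨hψ.1.sub (contDiff_const.mul hθ.1), ?_⟩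
  rw [hasCompactSupport_iff_eventuallyEq] at *
  filter_upwards [hasCompactSupport_iff_eventuallyEq.1 hψ.2, h2] with x h1 h2
  simp only [Pi.zero_apply] at *
  rw [h1, h2, sub_zero]

/-- Every test function is a multiple of a fixed one plus a derivative of a test function. -/
lemma IsTestFunction.exists_decomposition {ψ θ : ℝ → ℝ} (hψ : IsTestFunction ψ)
    (hθ : IsTestFunction θ) (h1 : ∫ x, θ x = 1) :
    ∃ χ, IsTestFunction χ ∧ ∀ x, ψ x = deriv χ x + (∫ t, ψ t) * θ x := by
  obtain ⟨χ, hχ, h⟩ := (hψ.sub_const_mul hθ (∫ t, ψ t)).exists_primitive (by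
    rw [integral_sub hψ.integrable (hθ.integrable.const_mul _), integral_const_mul, h1]
    ring)
  exact ⟨χ, hχ, fun x => by rw [h]; ring⟩

/-- Du Bois-Reymond: modulo derivatives every test function is its integral times `θ`, so `F` pairs
with `ψ` exactly as the constant `∫ F θ` does. -/
lemma eq_const_of_integral_mul_deriv_eq_zero {F : ℝ → ℝ} (hF : Continuous F)
    (h : ∀ ψ, IsTestFunction ψ → ∫ x, F x * deriv ψ x = 0) : ∃ k, ∀ x, F x = k := by
  obtain ⟨θ, hθ, h1⟩ := exists_isTestFunction_integral_one
  set k := ∫ x, F x * θ x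
  refine ⟨k, fun x => ?_⟩
  have hc : Continuous fun x => F x - k := by fun_prop
  have key := eq_zero_ae_of_forall_test hc.locallyIntegrable fun ψ hψ => by
    obtain ⟨χ, hχ, hd⟩ := hψ.exists_decomposition hθ h1
    have e1 : ∫ x, F x * ψ x = (∫ t, ψ t) * k := by
      calc ∫ x, F x * ψ x = ∫ x, (F x * deriv χ x + (∫ t, ψ t) * (F x * θ x)) := by
            congr 1 with x
            conv_lhs => rw [hd x]
            ring
        _ = _ := by
            rw [integral_add (hχ.deriv.integrable_mul hF.locallyIntegrable)
              ((hθ.integrable_mul hF.locallyIntegrable).const_mul _), h χ hχ, zero_add,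
              integral_const_mul]
    calc ∫ x, (F x - k) * ψ x = ∫ x, (F x * ψ x - k * ψ x) := by congr 1 with x; ring
      _ = 0 := by
        rw [integral_sub (hψ.integrable_mul hF.locallyIntegrable) (hψ.integrable.const_mul k), e1,
          integral_const_mul]
        ring
  have := (hc.ae_eq_iff_eq (μ := volume) continuous_const).1 key
  exact sub_eq_zero.1 (congrFun this x)

/-- Adding `k x` with `k = ∫ F θ'` cancels the one pairing that the hypothesis does not control, and
reduces the claim to the first-order case. -/
lemma eq_affine_of_integral_mul_deriv_deriv_eq_zero {F : ℝ → ℝ} (hF : Continuous F)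
    (h : ∀ ψ, IsTestFunction ψ → ∫ x, F x * deriv (deriv ψ) x = 0) :
    ∃ α β, ∀ x, F x = α * x + β := by
  obtain ⟨θ, hθ, h1⟩ := exists_isTestFunction_integral_one
  set k := ∫ x, F x * deriv θ x
  have hc : Continuous fun x => F x + k * x := by fun_prop
  obtain ⟨β, hβ⟩ := eq_const_of_integral_mul_deriv_eq_zero hc fun ψ hψ => by
    obtain ⟨χ, hχ, hd⟩ := hψ.exists_decomposition hθ h1
    have hd' : ∀ x, deriv ψ x = deriv (deriv χ) x + (∫ t, ψ t) * deriv θ x := fun x => by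
      have := (hχ.deriv.hasDerivAt x).add ((hθ.hasDerivAt x).const_mul (∫ t, ψ t))
      exact (this.congr_of_eventuallyEq (Eventually.of_forall hd)).deriv
    have e1 : ∫ x, F x * deriv ψ x = (∫ t, ψ t) * k := by
      calc ∫ x, F x * deriv ψ x
          = ∫ x, (F x * deriv (deriv χ) x + (∫ t, ψ t) * (F x * deriv θ x)) := by
            congr 1 with x
            rw [hd' x]
            ring
        _ = _ := by
            rw [integral_add (hχ.deriv.deriv.integrable_mul hF.locallyIntegrable)
              ((hθ.deriv.integrable_mul hF.locallyIntegrable).const_mul _), h χ hχ, zero_add,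
              integral_const_mul]
    have e2 : ∫ x, (k * x) * deriv ψ x = -∫ x, k * ψ x :=
      integral_mul_deriv_test (F := fun x => k * x) (F' := fun _ => k) hψ
        (fun x _ => by simpa using (hasDerivAt_id x).const_mul k)
        (Continuous.locallyIntegrable (by fun_prop)) (hψ.integrable.const_mul k)
    calc ∫ x, (F x + k * x) * deriv ψ x = ∫ x, (F x * deriv ψ x + (k * x) * deriv ψ x) := by
          congr 1 with x; ring
      _ = 0 := by
        rw [integral_add (hψ.deriv.integrable_mul hF.locallyIntegrable)
          (hψ.deriv.integrable_mul (f := fun x => k * x)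
            (Continuous.locallyIntegrable (by fun_prop))), e1, e2, integral_const_mul]
        ring
  exact ⟨-k, β, fun x => by linarith [hβ x]⟩

lemma _root_.MeasureTheory.LocallyIntegrable.intervalIntegrable {f : ℝ → ℝ}
    (hf : LocallyIntegrable f) (a b : ℝ) : IntervalIntegrable f volume a b :=
  ((locallyIntegrable_iff.1 hf) _ isCompact_uIcc).intervalIntegrable

/-- As `f` is merely locally integrable, its primitive is differentiable only almost everywhere. It
is absolutely continuous, however, and that suffices to integrate by parts on an interval beyond the
support of `ψ`. -/
lemma integral_primitive_mul_deriv {f : ℝ → ℝ} (hf : LocallyIntegrable f) {ψ : ℝ → ℝ}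
    (hψ : IsTestFunction ψ) :
    ∫ x, (∫ t in (0 : ℝ)..x, f t) * deriv ψ x = -∫ x, f x * ψ x := by
  obtain ⟨R, hR, h0⟩ := exists_eq_zero_of_le_abs hψ.2
  obtain ⟨R', hR', h0'⟩ := exists_eq_zero_of_le_abs hψ.deriv.2
  set r := max R R' + 1 with hr
  have r1 : R < r := by linarith [le_max_left R R']
  have r2 : R' < r := by linarith [le_max_right R R']
  have hsupp : ∀ {q : ℝ → ℝ} {s : ℝ} (p : ℝ → ℝ), (∀ x, s ≤ |x| → q x = 0) → s < r →
      ∫ x in (-r)..r, p x * q x = ∫ x, p x * q x := by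
    intro q s p hq hs
    apply intervalIntegral.integral_eq_integral_of_support_subset
    intro x hx
    by_contra hc
    apply hx
    rw [mem_Ioc, not_and_or, not_lt, not_le] at hc
    simp only
    rw [hq x, mul_zero]
    rcases hc with hc | hc
    · exact hs.le.trans ((by linarith : r ≤ -x).trans (neg_le_abs x))
    · exact (hs.trans hc).le.trans (le_abs_self x)
  have ac1 : AbsolutelyContinuousOnInterval (fun x => ∫ t in (0 : ℝ)..x, f t) (-r) r :=
    (hf.intervalIntegrable (-r) r).absolutelyContinuousOnInterval_intervalIntegral
      (by rw [uIcc_of_le (by linarith)]; constructor <;> linarith)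
  have ac2 : AbsolutelyContinuousOnInterval ψ (-r) r :=
    ((hψ.1.of_le (by simp)).contDiffOn).absolutelyContinuousOnInterval
  have e := ac1.integral_mul_deriv_eq_deriv_mul ac2
  rw [hsupp _ h0' r2, h0 r (r1.le.trans (le_abs_self r)),
    h0 (-r) (by rw [abs_neg]; exact r1.le.trans (le_abs_self r))] at e
  rw [e, ← hsupp f h0 r1]
  simp only [mul_zero, sub_zero, zero_sub, neg_inj]
  apply intervalIntegral.integral_congr_ae
  filter_upwards [(hf.intervalIntegrable (-r) r).ae_hasDerivAt_integral] with x hx hm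
  rw [(hx (uIoc_subset_uIcc hm) 0
    (by rw [uIcc_of_le (by linarith)]; constructor <;> linarith)).deriv]

lemma continuous_primitive_zero {f : ℝ → ℝ} (hf : LocallyIntegrable f) :
    Continuous fun x => ∫ t in (0 : ℝ)..x, f t :=
  intervalIntegral.continuous_primitive (fun a b => hf.intervalIntegrable a b) 0

/-- A continuous function whose second weak derivative is locally integrable is continuously
differentiable, and its derivative is a primitive of the second derivative. -/
lemma hasDerivAt_of_weak_second_deriv {F f : ℝ → ℝ} (hF : Continuous F) (hf : LocallyIntegrable f)
    (h : ∀ ψ, IsTestFunction ψ → ∫ x, F x * deriv (deriv ψ) x = ∫ x, f x * ψ x) :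
    ∃ α, ∀ x, HasDerivAt F ((∫ t in (0 : ℝ)..x, f t) + α) x := by
  have cP := continuous_primitive_zero hf
  set P : ℝ → ℝ := fun x => ∫ t in (0 : ℝ)..x, f t with hP
  set Q : ℝ → ℝ := fun x => ∫ t in (0 : ℝ)..x, P t with hQ
  have dQ : ∀ x, HasDerivAt Q (P x) x := fun x =>
    intervalIntegral.integral_hasDerivAt_right (cP.intervalIntegrable _ _)
      (cP.stronglyMeasurableAtFilter _ _) cP.continuousAt
  have cQ : Continuous Q := continuous_primitive_zero cP.locallyIntegrable
  obtain ⟨α, β, hab⟩ := eq_affine_of_integral_mul_deriv_deriv_eq_zero (hF.sub cQ) fun ψ hψ => by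
    have e1 : ∫ x, Q x * deriv (deriv ψ) x = -∫ x, P x * deriv ψ x :=
      integral_mul_deriv_test hψ.deriv (fun x _ => dQ x) cQ.locallyIntegrable
        (hψ.deriv.integrable_mul cP.locallyIntegrable)
    have e2 := integral_primitive_mul_deriv hf hψ
    simp only [Pi.sub_apply, sub_mul]
    rw [integral_sub (hψ.deriv.deriv.integrable_mul hF.locallyIntegrable)
      (hψ.deriv.deriv.integrable_mul cQ.locallyIntegrable), h ψ hψ, e1, hP, e2]
    ring
  refine ⟨α, fun x => ?_⟩
  have hlin : HasDerivAt (fun x : ℝ => α * x + β) α x := by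
    simpa using ((hasDerivAt_id x).const_mul α).add_const β
  refine ((dQ x).add hlin).congr_of_eventuallyEq (Eventually.of_forall fun y => ?_)
  have := hab y
  simp only [Pi.sub_apply] at this
  simp only [Pi.add_apply]
  linarith

/-! ### Regularity of traveling waves -/

/-- A continuous function whose square is differentiable is differentiable where it does not
vanish. -/
lemma hasDerivAt_of_hasDerivAt_sq {v : ℝ → ℝ} (hv : Continuous v) {x d : ℝ} (hx : v x ≠ 0)
    (h : HasDerivAt (fun y => v y ^ 2) d x) : HasDerivAt v (d / (2 * v x)) x := by
  have hs : HasDerivAt (fun y => √(v y ^ 2)) (d / (2 * √(v x ^ 2))) x :=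
    h.sqrt (pow_ne_zero 2 hx)
  simp only [Real.sqrt_sq_eq_abs] at hs
  rcases lt_or_gt_of_ne hx with h0 | h0
  · rw [abs_of_neg h0] at hs
    have h1 : HasDerivAt v (-(d / (2 * -v x))) x := by
      refine hs.neg.congr_of_eventuallyEq ?_
      filter_upwards [hv.continuousAt.eventually_lt continuousAt_const h0] with y hy
      simp [abs_of_neg hy]
    refine h1.congr_deriv ?_
    field_simp
  · rw [abs_of_pos h0] at hs
    refine hs.congr_of_eventuallyEq ?_
    filter_upwards [continuousAt_const.eventually_lt hv.continuousAt h0] with y hy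
    simp [abs_of_pos hy]

/-- The weak equation prescribes the second derivative of `(φ - c)²` in `L¹_loc`. Regularity is
gained twice: first for `(φ - c)²`, hence for `φ` off `c`; then for the primitive `P`, once `g` is
known to be `φ'` there. -/
theorem exists_solvesOff_of_weak {μ c a : ℝ} {φ g : ℝ → ℝ} (hg : IsH1LocWithDeriv φ g)
    (hw : ∀ ψ : ℝ → ℝ, IsTestFunction ψ → ∫ x, (g x) ^ 2 * ψ x =
        (∫ x, (-4 * μ * φ x + a) * ψ x) + ∫ x, (φ x - c) ^ 2 * deriv (deriv ψ) x) :
    SolvesOff μ c a φ := by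
  obtain ⟨hc, -, hg2, hwd⟩ := hg
  have hU := isOpen_ne_height (c := c) hc
  have lg := hg2.sq
  have l1 : LocallyIntegrable fun x => 4 * μ * φ x - a :=
    Continuous.locallyIntegrable (by fun_prop)
  have lf : LocallyIntegrable fun x => g x ^ 2 + (4 * μ * φ x - a) := lg.add l1
  obtain ⟨α, hα⟩ := hasDerivAt_of_weak_second_deriv (F := fun x => (φ x - c) ^ 2) (by fun_prop) lf
    fun ψ hψ => by
      have e1 := hw ψ hψ
      have e2 : ∫ x, (-4 * μ * φ x + a) * ψ x = -∫ x, (4 * μ * φ x - a) * ψ x := by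
        rw [← integral_neg]
        congr 1 with x
        ring
      simp only [add_mul]
      rw [integral_add (hψ.integrable_mul lg) (hψ.integrable_mul l1)]
      linarith
  set P : ℝ → ℝ := fun x => ∫ t in (0 : ℝ)..x, (g t ^ 2 + (4 * μ * φ t - a)) with hP
  have cP : Continuous P := continuous_primitive_zero lf
  have dφ : ∀ x, φ x ≠ c → HasDerivAt φ ((P x + α) / (2 * (φ x - c))) x := fun x hx => by
    have := (hasDerivAt_of_hasDerivAt_sq (v := fun x => φ x - c) (by fun_prop)
      (sub_ne_zero.2 hx) (hα x)).add_const c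
    simpa using this
  have cd : ∀ x, φ x ≠ c → ContinuousAt (deriv φ) x := fun x hx => by
    have h1 : ContinuousAt (fun x => (P x + α) / (2 * (φ x - c))) x :=
      ContinuousAt.div (by fun_prop) (by fun_prop)
        (mul_ne_zero two_ne_zero (sub_ne_zero.2 hx))
    refine h1.congr ?_
    filter_upwards [eventually_ne_height hc hx] with y hy using (dφ y hy).deriv.symm
  have cdU : ContinuousOn (deriv φ) {x | φ x ≠ c} := fun x hx => (cd x hx).continuousWithinAt
  have hae : ∀ᵐ x, x ∈ {x | φ x ≠ c} → g x - deriv φ x = 0 := by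
    refine IsOpen.ae_eq_zero_of_integral_contDiff_smul_eq_zero hU
      ((hwd.2.1.locallyIntegrableOn _).sub
        (cdU.locallyIntegrableOn hU.measurableSet)) fun ψ h1 h2 h3 => ?_
    have hψ : IsTestFunction ψ := ⟨h1, h2⟩
    have i1 : Integrable (deriv φ * ψ) := by
      refine (integrableOn_iff_integrable_of_support_subset (s := tsupport ψ)
        ((Function.support_mul_subset_right _ _).trans (subset_tsupport ψ))).1 ?_
      exact ((cdU.mono h3).mul hψ.continuous.continuousOn).integrableOn_compact h2
    have e1 := integral_mul_deriv_test hψ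
      (fun x hx => (dφ x (h3 hx)).differentiableAt.hasDerivAt) hc.locallyIntegrable i1
    have e2 := hwd.2.2 ψ hψ
    have i2 : Integrable fun x => deriv φ x * ψ x := i1
    simp only [smul_eq_mul, mul_comm (ψ _), sub_mul]
    rw [integral_sub (hψ.integrable_mul hwd.2.1) i2]
    linarith
  classical
  -- `g` is known only almost everywhere. Replacing it by the continuous function `deriv φ` off `c`
  -- leaves the primitive unchanged and makes it classically differentiable there.
  set f : ℝ → ℝ := fun x => (if φ x = c then g x else deriv φ x) ^ 2 + (4 * μ * φ x - a)
    with hf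
  have hff : ∀ᵐ x, g x ^ 2 + (4 * μ * φ x - a) = f x := by
    filter_upwards [hae] with x hx
    by_cases h : φ x = c
    · simp [hf, h]
    · simp [hf, h, sub_eq_zero.1 (hx h)]
  have lf' : LocallyIntegrable f := lf.congr hff
  have hPf : P = fun x => ∫ t in (0 : ℝ)..x, f t := by
    funext x
    exact intervalIntegral.integral_congr_ae (by filter_upwards [hff] with t ht _ using ht)
  have dP : ∀ x, φ x ≠ c → HasDerivAt P (deriv φ x ^ 2 + (4 * μ * φ x - a)) x := fun x hx => by
    have h1 : f =ᶠ[𝓝 x] fun x => deriv φ x ^ 2 + (4 * μ * φ x - a) := by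
      filter_upwards [eventually_ne_height hc hx] with y hy
      simp [hf, hy]
    have h2 : ContinuousAt f x :=
      ContinuousAt.congr (((cd x hx).pow 2).add (by fun_prop)) h1.symm
    rw [hPf, ← h1.eq_of_nhds]
    exact intervalIntegral.integral_hasDerivAt_right (lf'.intervalIntegrable _ _)
      ⟨univ, univ_mem, lf'.aestronglyMeasurable.restrict⟩ h2
  refine ⟨hc, fun x hx => (dφ x hx).differentiableAt, fun x hx => ?_⟩
  have hne := sub_ne_zero.2 hx
  have h1 : deriv φ =ᶠ[𝓝 x] fun x => (P x + α) / (2 * (φ x - c)) := by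
    filter_upwards [eventually_ne_height hc hx] with y hy using (dφ y hy).deriv
  have h2 : P x + α = 2 * (φ x - c) * deriv φ x := by
    rw [(dφ x hx).deriv]; field_simp
  have h3 := ((dP x hx).add_const α).div
    (((dφ x hx).differentiableAt.hasDerivAt.sub_const c).const_mul 2)
    (mul_ne_zero two_ne_zero hne)
  refine (h3.congr_of_eventuallyEq h1).congr_deriv ?_
  rw [h2]
  field_simp
  ring

/-- A traveling wave solves the equation classically where `φ ≠ c`, and has no plateau at height
`c` unless the constant of integration is the exceptional one. -/
theorem IsTravelingWave.exists_solvesOff {μ c : ℝ} {φ : ℝ → ℝ} (h : IsTravelingWave μ c φ) :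
    ∃ a, SolvesOff μ c a φ ∧ (volume {x | φ x = c} = 0 ∨ a = 4 * μ * c) := by
  obtain ⟨g, hg, a, hw⟩ := h
  have hs := exists_solvesOff_of_weak hg hw
  exact ⟨a, hs, hs.volume_eq_zero_or hg.2.2.2 hw⟩


/-! ### Uniqueness, regularity and first integral of solutions away from the singular height -/

section Classical

variable {μ c a : ℝ} {φ w : ℝ → ℝ}

lemma SolvesOff.continuousAt_deriv (h : SolvesOff μ c a φ) {x : ℝ} (hx : φ x ≠ c) :
    ContinuousAt (deriv φ) x :=
  (h.hasDerivAt_deriv x hx).continuousAt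

/-- The right-hand side of the first-order system for `(φ, φ')`. -/
noncomputable def systemField (μ c a : ℝ) (p : ℝ × ℝ) : ℝ × ℝ :=
  (p.2, (4 * μ * p.1 - a - p.2 ^ 2) / (2 * (p.1 - c)))

/-- `systemField` is smooth away from the line `p.1 = c`, hence locally Lipschitz, and `(φ, φ')` is
an integral curve of it. -/
lemma SolvesOff.eventually_eq (h : SolvesOff μ c a φ) (hw : SolvesOff μ c a w) {x : ℝ}
    (hx : φ x ≠ c) (h0 : φ x = w x) (h1 : deriv φ x = deriv w x) :
    ∀ᶠ y in 𝓝 x, φ y = w y ∧ deriv φ y = deriv w y := by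
  have hv : ContDiffAt ℝ 1 (systemField μ c a) (φ x, deriv φ x) := by
    refine contDiffAt_snd.prodMk (ContDiffAt.div ?_ ?_ ?_)
    · fun_prop
    · fun_prop
    · exact mul_ne_zero two_ne_zero (sub_ne_zero.2 hx)
  obtain ⟨K, t, ht, hK⟩ := hv.exists_lipschitzOnWith
  have hf : ∀ {f : ℝ → ℝ}, SolvesOff μ c a f → f x = φ x → deriv f x = deriv φ x →
      ∀ᶠ y in 𝓝 x, HasDerivAt (fun y => (f y, deriv f y))
        (systemField μ c a (f y, deriv f y)) y ∧ (f y, deriv f y) ∈ t := by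
    intro f hf e0 e1
    have hfx : f x ≠ c := by rwa [e0]
    have hct : ContinuousAt (fun y => (f y, deriv f y)) x :=
      hf.continuous.continuousAt.prodMk (hf.continuousAt_deriv hfx)
    filter_upwards [eventually_ne_height hf.continuous hfx,
      hct.eventually_mem (by rw [e0, e1]; exact ht)] with y hy hyt
    exact ⟨(hf.hasDerivAt hy).prodMk (hf.hasDerivAt_deriv y hy), hyt⟩
  have key := ODE_solution_unique_of_eventually (v := fun _ => systemField μ c a) (s := fun _ => t)
    (K := K) (Eventually.of_forall fun _ => hK) (hf h rfl rfl) (hf hw h0.symm h1.symm)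
    (by simp [h0, h1])
  filter_upwards [key] with y hy
  exact Prod.ext_iff.1 hy

/-- Two solutions with the same data at a point agree on every connected set containing the point
on which one of them avoids the singular height. -/
theorem SolvesOff.eqOn (h : SolvesOff μ c a φ) (hw : SolvesOff μ c a w) {x : ℝ} {s : Set ℝ}
    (hs : IsPreconnected s) (hxs : x ∈ s) (hsc : ∀ y ∈ s, φ y ≠ c)
    (h0 : φ x = w x) (h1 : deriv φ x = deriv w x) : EqOn φ w s := by
  set u : Set ℝ := {y | φ y ≠ c ∧ φ y = w y ∧ deriv φ y = deriv w y}
  have hu : IsOpen u := by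
    rw [isOpen_iff_mem_nhds]
    rintro y ⟨hy, hy0, hy1⟩
    filter_upwards [eventually_ne_height h.continuous hy, h.eventually_eq hw hy hy0 hy1]
      with z hz hz' using ⟨hz, hz'⟩
  have hsu : s ⊆ u := by
    refine hs.subset_of_closure_inter_subset hu ⟨x, hxs, hsc x hxs, h0, h1⟩ ?_
    rintro y ⟨hyu, hys⟩
    have hy := hsc y hys
    have hfr : ∃ᶠ z in 𝓝 y, z ∈ u := mem_closure_iff_frequently.1 hyu
    have e0 : φ y = w y := by
      have hcl : IsClosed {z | φ z = w z} := isClosed_eq h.continuous hw.continuous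
      exact hcl.closure_subset_iff.2 (fun z hz => hz.2.1) hyu
    refine ⟨hy, e0, ?_⟩
    by_contra hne
    have c1 := h.continuousAt_deriv hy
    have c2 := hw.continuousAt_deriv (e0 ▸ hy)
    have hev : ∀ᶠ z in 𝓝 y, deriv φ z - deriv w z ≠ 0 :=
      (c1.sub c2).eventually_ne (sub_ne_zero.2 hne)
    obtain ⟨z, hz, hz'⟩ := (hfr.and_eventually hev).exists
    exact hz' (sub_eq_zero.2 hz.2.2)
  exact fun y hy => (hsu hy).2.1

/-- Agreement spreads over the component of either function; on it the other function therefore also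
avoids `c`, so each component contains the other. -/
theorem SolvesOff.connectedComponentIn_eq (h : SolvesOff μ c a φ) (hw : SolvesOff μ c a w)
    {x : ℝ} (hx : φ x ≠ c) (h0 : φ x = w x) (h1 : deriv φ x = deriv w x) :
    connectedComponentIn {y | φ y ≠ c} x = connectedComponentIn {y | w y ≠ c} x ∧
      EqOn φ w (connectedComponentIn {y | φ y ≠ c} x) := by
  have hwx : w x ≠ c := h0 ▸ hx
  have e1 := h.eqOn hw (isPreconnected_connectedComponentIn (F := {y | φ y ≠ c}))
    (mem_connectedComponentIn hx) (fun y hy => connectedComponentIn_subset _ _ hy) h0 h1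
  have e2 := hw.eqOn h (isPreconnected_connectedComponentIn (F := {y | w y ≠ c}))
    (mem_connectedComponentIn hwx) (fun y hy => connectedComponentIn_subset _ _ hy) h0.symm h1.symm
  refine ⟨Subset.antisymm ?_ ?_, e1⟩
  · refine isPreconnected_connectedComponentIn.subset_connectedComponentIn
      (mem_connectedComponentIn hx) fun y hy => ?_
    have : φ y ≠ c := connectedComponentIn_subset _ _ hy
    rwa [e1 hy] at this
  · refine isPreconnected_connectedComponentIn.subset_connectedComponentIn
      (mem_connectedComponentIn hwx) fun y hy => ?_
    have : w y ≠ c := connectedComponentIn_subset _ _ hy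
    rwa [e2 hy] at this

/-- Bootstrap on the pair `(φ, φ')`: the equation expresses `φ''` rationally in both, with
denominator `2 (φ - c)`. -/
lemma SolvesOff.contDiffOn (h : SolvesOff μ c a φ) : ContDiffOn ℝ ∞ φ {x | φ x ≠ c} := by
  have hU := isOpen_ne_height (c := c) h.continuous
  have key : ∀ n : ℕ, ContDiffOn ℝ n φ {x | φ x ≠ c} ∧ ContDiffOn ℝ n (deriv φ) {x | φ x ≠ c} := by
    intro n
    induction n with
    | zero =>
      refine ⟨contDiffOn_zero.2 h.continuous.continuousOn, contDiffOn_zero.2 fun x hx => ?_⟩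
      exact (h.continuousAt_deriv hx).continuousWithinAt
    | succ n ih =>
      obtain ⟨i0, i1⟩ := ih
      constructor
      · push_cast
        rw [contDiffOn_succ_iff_deriv_of_isOpen hU]
        exact ⟨fun x hx => (h.differentiableAt x hx).differentiableWithinAt, by simp, i1⟩
      · push_cast
        rw [contDiffOn_succ_iff_deriv_of_isOpen hU]
        refine ⟨fun x hx => (h.hasDerivAt_deriv x hx).differentiableAt.differentiableWithinAt,
          by simp, ?_⟩
        have : ContDiffOn ℝ n (fun x => (4 * μ * φ x - a - deriv φ x ^ 2) / (2 * (φ x - c)))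
            {x | φ x ≠ c} := by
          refine ContDiffOn.div (((contDiffOn_const.mul i0).sub contDiffOn_const).sub (i1.pow 2))
            (contDiffOn_const.mul (i0.sub contDiffOn_const)) fun x hx => ?_
          exact mul_ne_zero two_ne_zero (sub_ne_zero.2 hx)
        exact this.congr fun x hx => (h.hasDerivAt_deriv x hx).deriv
  exact contDiffOn_infty.2 fun n => (key n).1

lemma SolvesOff.comp_add_const (h : SolvesOff μ c a φ) (s : ℝ) :
    SolvesOff μ c a fun x => φ (x + s) := by
  have hd : deriv (fun x => φ (x + s)) = fun x => deriv φ (x + s) :=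
    funext fun x => deriv_comp_add_const φ s x
  refine ⟨h.continuous.comp (continuous_add_const s), fun x hx => ?_, fun x hx => ?_⟩
  · exact ((h.hasDerivAt hx).comp_add_const x s).differentiableAt
  · rw [hd]
    exact (h.hasDerivAt_deriv (x + s) hx).comp_add_const x s

lemma SolvesOff.comp_neg (h : SolvesOff μ c a φ) : SolvesOff μ c a fun x => φ (-x) := by
  have hd : deriv (fun x => φ (-x)) = fun x => -deriv φ (-x) := funext fun x => deriv_comp_neg φ x
  refine ⟨h.continuous.comp continuous_neg, fun x hx => ?_, fun x hx => ?_⟩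
  · exact (h.differentiableAt (-x) hx).comp x differentiableAt_id.neg
  · rw [hd]
    have := ((h.hasDerivAt_deriv (-x) hx).comp x (hasDerivAt_neg x)).neg
    refine this.congr_deriv ?_
    ring

/-- The equation can be solved for `a` at any regular point. Hence the constant in the weak equation
of a nontrivial composite wave must be the one belonging to its sum. -/
lemma SolvesOff.eq_const (h : SolvesOff μ c a φ) {a' x : ℝ} (h' : SolvesOff μ c a' w)
    (hx : φ x ≠ c) (he : φ =ᶠ[𝓝 x] w) : a = a' := by
  have e0 := he.eq_of_nhds
  have e1 := he.deriv
  have hne := sub_ne_zero.2 hx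
  have := (h.hasDerivAt_deriv x hx).unique
    ((h'.hasDerivAt_deriv x (e0 ▸ hx)).congr_of_eventuallyEq e1)
  rw [← e0, ← e1.eq_of_nhds] at this
  field_simp at this
  linarith

/-- The first integral `(φ - c) φ'² - 2 μ φ² + a φ`. -/
noncomputable def firstIntegral (μ c a : ℝ) (φ : ℝ → ℝ) (x : ℝ) : ℝ :=
  (φ x - c) * deriv φ x ^ 2 - 2 * μ * φ x ^ 2 + a * φ x

lemma SolvesOff.hasDerivAt_firstIntegral (h : SolvesOff μ c a φ) {x : ℝ} (hx : φ x ≠ c) :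
    HasDerivAt (firstIntegral μ c a φ) 0 x := by
  have d0 := h.hasDerivAt hx
  have d1 := h.hasDerivAt_deriv x hx
  have hne := sub_ne_zero.2 hx
  have := (((d0.sub_const c).mul (d1.pow 2)).sub ((d0.pow 2).const_mul (2 * μ))).add
    (d0.const_mul a)
  refine this.congr_deriv ?_
  simp only [Pi.pow_apply]
  field_simp
  ring

lemma SolvesOff.firstIntegral_eq (h : SolvesOff μ c a φ) {s : Set ℝ} (ho : IsOpen s)
    (hs : IsPreconnected s) (hsc : ∀ y ∈ s, φ y ≠ c) {x y : ℝ} (hx : x ∈ s) (hy : y ∈ s) :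
    firstIntegral μ c a φ x = firstIntegral μ c a φ y :=
  ho.is_const_of_deriv_eq_zero hs
    (fun z hz => (h.hasDerivAt_firstIntegral (hsc z hz)).differentiableAt.differentiableWithinAt)
    (fun z hz => (h.hasDerivAt_firstIntegral (hsc z hz)).deriv) hx hy

lemma HasParameters.mul_sq {m M : ℝ} (h : HasParameters μ c m M φ) {x : ℝ} (hx : φ x ≠ c) :
    (c - φ x) * deriv φ x ^ 2 = 2 * μ * (M - φ x) * (φ x - m) := by
  have : c - φ x ≠ 0 := sub_ne_zero.2 hx.symm
  rw [(h x hx).2]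
  field_simp

/-- The parameter equation turns the first integral into `(a - 2 μ (m + M)) φ + 2 μ m M`. This is
locally constant, so its first coefficient vanishes wherever `φ' ≠ 0`. -/
lemma SolvesOff.eq_of_hasParameters (h : SolvesOff μ c a φ) {m M : ℝ}
    (hp : HasParameters μ c m M φ) {x : ℝ} (hx : φ x ≠ c) (hd : deriv φ x ≠ 0) :
    a = 2 * μ * (m + M) := by
  have e1 : firstIntegral μ c a φ =ᶠ[𝓝 x]
      fun y => (a - 2 * μ * (m + M)) * φ y + 2 * μ * m * M := by
    filter_upwards [eventually_ne_height h.continuous hx] with y hy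
    have := hp.mul_sq hy
    simp only [firstIntegral]
    linarith
  have d1 := (((h.hasDerivAt hx).const_mul (a - 2 * μ * (m + M))).add_const
    (2 * μ * m * M)).congr_of_eventuallyEq e1
  have := d1.unique (h.hasDerivAt_firstIntegral hx)
  have := (mul_eq_zero.1 this).resolve_right hd
  linarith

/-- A traveling wave with given parameters that takes a regular value solves the equation with
the constant determined by the parameters. -/
theorem IsTravelingWave.solvesOff_of_hasParameters (hμ : 0 < μ) (h : IsTravelingWave μ c φ)
    {m M : ℝ} (hp : HasParameters μ c m M φ) {x : ℝ} (hc : φ x ≠ c) (hm : φ x ≠ m)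
    (hM : φ x ≠ M) : SolvesOff μ c (2 * μ * (m + M)) φ := by
  obtain ⟨a, ha, -⟩ := h.exists_solvesOff
  have hd : deriv φ x ≠ 0 := by
    intro h0
    have := hp.mul_sq hc
    rw [h0] at this
    have h2 : 2 * μ * (M - φ x) * (φ x - m) ≠ 0 :=
      mul_ne_zero (mul_ne_zero (by positivity) (sub_ne_zero.2 hM.symm)) (sub_ne_zero.2 hm)
    exact h2 (by rw [← this]; ring)
  rwa [ha.eq_of_hasParameters hp hc hd] at ha

lemma SolvesOff.hasParameters_of_firstIntegral (h : SolvesOff μ c a φ) {m M : ℝ}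
    (ha : a = 2 * μ * (m + M))
    (hb : ∀ x, φ x ≠ c → firstIntegral μ c a φ x = 2 * μ * m * M) : HasParameters μ c m M φ := by
  intro x hx
  refine ⟨h.differentiableAt x hx, ?_⟩
  have := hb x hx
  rw [firstIntegral, ha] at this
  rw [eq_div_iff (sub_ne_zero.2 hx.symm)]
  linarith

end Classical


/-! ### Construction of solutions by a change of the independent variable -/

/-- The variable `x` as a function of the parameter, for a solution of modulus `W`. -/
noncomputable def arcX (W : ℝ → ℝ) (y : ℝ) : ℝ := ∫ t in (0 : ℝ)..y, √(W t)

section Arc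

variable {W W' : ℝ → ℝ}

lemma hasDerivAt_arcX (hW : Continuous W) (y : ℝ) : HasDerivAt (arcX W) (√(W y)) y :=
  intervalIntegral.integral_hasDerivAt_right (hW.sqrt.intervalIntegrable _ _)
    (hW.sqrt.stronglyMeasurableAtFilter _ _) hW.sqrt.continuousAt

lemma strictMono_arcX (hW : Continuous W) (h0 : ∀ y, 0 ≤ W y)
    (hz : ∀ y z, y < z → ∃ t ∈ Icc y z, W t ≠ 0) : StrictMono (arcX W) := by
  intro y z hyz
  have h1 : arcX W z - arcX W y = ∫ t in y..z, √(W t) :=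
    intervalIntegral.integral_interval_sub_left (hW.sqrt.intervalIntegrable _ _)
      (hW.sqrt.intervalIntegrable _ _)
  obtain ⟨t, ht, hWt⟩ := hz y z hyz
  have h2 : 0 < ∫ t in y..z, √(W t) :=
    intervalIntegral.integral_pos hyz hW.sqrt.continuousOn (fun t _ => Real.sqrt_nonneg _)
      ⟨t, ht, Real.sqrt_pos.2 (lt_of_le_of_ne (h0 t) hWt.symm)⟩
  linarith

lemma arcX_zero : arcX W 0 = 0 := intervalIntegral.integral_same

lemma exists_orderIso_arcX (hW : Continuous W) (h0 : ∀ y, 0 ≤ W y)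
    (hz : ∀ y z, y < z → ∃ t ∈ Icc y z, W t ≠ 0) (ht : Tendsto (arcX W) atTop atTop)
    (hb : Tendsto (arcX W) atBot atBot) : ∃ Y : ℝ ≃o ℝ, ∀ y, Y.symm y = arcX W y := by
  have hs : Function.Surjective (arcX W) :=
    (continuous_iff_continuousAt.2 fun y => (hasDerivAt_arcX hW y).continuousAt).surjective ht hb
  exact ⟨((strictMono_arcX hW h0 hz).orderIsoOfSurjective _ hs).symm, fun y => rfl⟩

lemma exists_orderIso_arcX_periodic (hW : Continuous W) (h0 : ∀ y, 0 ≤ W y)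
    (hz : ∀ y z, y < z → ∃ t ∈ Icc y z, W t ≠ 0) {L : ℝ} (hper : Function.Periodic W L)
    (hL : 0 < L) : ∃ Y : ℝ ≃o ℝ, (∀ y, Y.symm y = arcX W y) ∧ 0 < arcX W L ∧
      ∀ x, Y (x + arcX W L) = Y x + L := by
  have hperS : Function.Periodic (fun y => √(W y)) L := fun y => by
    simp only [hper y]
  have hT : 0 < arcX W L := by
    have := strictMono_arcX hW h0 hz hL
    rwa [arcX_zero] at this
  obtain ⟨Y, hY⟩ := exists_orderIso_arcX hW h0 hz
    (hperS.tendsto_atTop_intervalIntegral_of_pos hT hL)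
    (hperS.tendsto_atBot_intervalIntegral_of_pos hT hL)
  refine ⟨Y, hY, hT, fun x => ?_⟩
  have hXadd : ∀ y, arcX W (y + L) = arcX W y + arcX W L := by
    intro y
    have h1 : arcX W (y + L) - arcX W y = ∫ t in y..(y + L), √(W t) :=
      intervalIntegral.integral_interval_sub_left (hW.sqrt.intervalIntegrable _ _)
        (hW.sqrt.intervalIntegrable _ _)
    have h2 := hperS.intervalIntegral_add_eq y 0
    rw [zero_add] at h2
    have h3 : arcX W L = ∫ t in (0 : ℝ)..L, √(W t) := rfl
    linarith
  rw [← Y.symm.injective.eq_iff, OrderIso.symm_apply_apply, hY (Y x + L), hXadd, ← hY (Y x),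
    OrderIso.symm_apply_apply]

variable {μ c κ s : ℝ} {Y : ℝ ≃o ℝ}

/-- Inverse function rule. It fails exactly at the zeros of `W`, where `arcX` has derivative zero;
these become the crests. -/
lemma hasDerivAt_param (hW : Continuous W) (hY : ∀ y, Y.symm y = arcX W y) {x : ℝ}
    (h0 : 0 < W (Y x)) : HasDerivAt Y (√(W (Y x)))⁻¹ x := by
  refine HasDerivAt.of_local_left_inverse (f := arcX W) Y.continuous.continuousAt
    (hasDerivAt_arcX hW (Y x)) (Real.sqrt_pos.2 h0).ne' (Eventually.of_forall fun z => ?_)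
  rw [← hY, OrderIso.symm_apply_apply]

lemma hasDerivAt_profile (hW : Continuous W) (h0 : ∀ y, 0 ≤ W y)
    (hY : ∀ y, Y.symm y = arcX W y) (hd : ∀ y, W y ≠ 0 → HasDerivAt W (W' y) y) {x : ℝ}
    (hx : W (Y x) ≠ 0) :
    HasDerivAt (fun x => c + s * W (Y x)) (s * (W' (Y x) / √(W (Y x)))) x := by
  have h1 := (hd _ hx).comp x (hasDerivAt_param hW hY (lt_of_le_of_ne (h0 _) hx.symm))
  exact ((h1.const_mul s).const_add c).congr_deriv (by rw [div_eq_mul_inv])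

/-- A nonnegative solution `W` of `W'' = 2 μ (s W - κ)` yields, after a change of variable, a
solution `c + s W` of the traveling wave equation. -/
theorem solvesOff_profile (hs : s ^ 2 = 1) (hW : Continuous W) (h0 : ∀ y, 0 ≤ W y)
    (hY : ∀ y, Y.symm y = arcX W y) (hd : ∀ y, W y ≠ 0 → HasDerivAt W (W' y) y)
    (hd' : ∀ y, W y ≠ 0 → HasDerivAt W' (2 * μ * (s * W y - κ)) y) :
    SolvesOff μ c (4 * μ * (c + κ)) fun x => c + s * W (Y x) := by
  have hs0 : s ≠ 0 := by rintro rfl; norm_num at hs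
  have hne : ∀ x, c + s * W (Y x) ≠ c → W (Y x) ≠ 0 := fun x hx h => hx (by rw [h]; ring)
  have hcW : Continuous fun x => W (Y x) := hW.comp Y.continuous
  refine ⟨by fun_prop, fun x hx => (hasDerivAt_profile hW h0 hY hd (hne x hx)).differentiableAt,
    fun x hx => ?_⟩
  have hx0 := hne x hx
  have hpos : 0 < W (Y x) := lt_of_le_of_ne (h0 _) hx0.symm
  have he : deriv (fun x => c + s * W (Y x)) =ᶠ[𝓝 x] fun x => s * (W' (Y x) / √(W (Y x))) := by
    filter_upwards [hcW.continuousAt.eventually_ne hx0] with z hz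
    exact (hasDerivAt_profile hW h0 hY hd hz).deriv
  have hYd := hasDerivAt_param hW hY hpos
  have h1 := (hd' _ hx0).comp x hYd
  have h2 := ((hd _ hx0).comp x hYd).sqrt hx0
  have hr := Real.sqrt_pos.2 hpos
  have h3 := (h1.div h2 hr.ne').const_mul s
  refine (h3.congr_of_eventuallyEq he).congr_deriv ?_
  rw [he.eq_of_nhds]
  simp only [Function.comp_apply]
  have hsq : W (Y x) = √(W (Y x)) ^ 2 := (Real.sq_sqrt (h0 _)).symm
  set r := √(W (Y x))
  rw [hsq]
  have hr0 := hr.ne'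
  have hden : c + s * r ^ 2 - c = s * r ^ 2 := by ring
  rw [hden]
  field_simp
  rw [hs]
  ring

end Arc

/-! ### Arches -/

/-- `φ` is periodic with period `T`, takes the value `c` exactly on `x₀ + T ℤ`, and on
`(x₀, x₀ + T)` it is a solution that moves strictly away from `c` (upwards if `s = 1`, downwards
if `s = -1`) up to the point `p`, where it has the value `m`, and strictly back afterwards. -/
structure IsArchWave (μ c a s m : ℝ) (φ : ℝ → ℝ) (x₀ T p : ℝ) : Prop where
  solves : SolvesOff μ c a φ
  period_pos : 0 < T
  periodic : Function.Periodic φ T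
  zeros : ∀ x, φ x = c ↔ ∃ k : ℤ, x = x₀ + k * T
  mem : p ∈ Ioo x₀ (x₀ + T)
  value : φ p = m
  critical : deriv φ p = 0
  sign_left : ∀ x ∈ Ioo x₀ p, 0 < s * deriv φ x
  sign_right : ∀ x ∈ Ioo p (x₀ + T), s * deriv φ x < 0

/-- The sawtooth with values in `[-j, j)` and period `2 j`. -/
noncomputable def sawtooth (j y : ℝ) : ℝ := 2 * j * Int.fract (y / (2 * j)) - j

section Sawtooth

variable {j : ℝ}

lemma sawtooth_of_mem (hj : 0 < j) {y : ℝ} {k : ℤ} (h : y ∈ Ico (2 * j * k) (2 * j * (k + 1))) :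
    sawtooth j y = y - 2 * j * k - j := by
  have hf : ⌊y / (2 * j)⌋ = k := by
    rw [Int.floor_eq_iff, le_div_iff₀ (by positivity), div_lt_iff₀ (by positivity)]
    constructor <;> linarith [h.1, h.2]
  rw [sawtooth, Int.fract, hf]
  field_simp

lemma exists_mem_Ico (hj : 0 < j) (y : ℝ) : ∃ k : ℤ, y ∈ Ico (2 * j * k) (2 * j * (k + 1)) := by
  refine ⟨⌊y / (2 * j)⌋, ?_, ?_⟩
  · have := Int.floor_le (y / (2 * j))
    rw [le_div_iff₀ (by positivity)] at this
    linarith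
  · have := Int.lt_floor_add_one (y / (2 * j))
    rw [div_lt_iff₀ (by positivity)] at this
    linarith

lemma sawtooth_mem (hj : 0 < j) (y : ℝ) : sawtooth j y ∈ Ico (-j) j := by
  obtain ⟨k, hk⟩ := exists_mem_Ico hj y
  rw [sawtooth_of_mem hj hk]
  constructor <;> linarith [hk.1, hk.2]

lemma sawtooth_eq_neg_iff (hj : 0 < j) (y : ℝ) :
    sawtooth j y = -j ↔ ∃ k : ℤ, y = 2 * j * k := by
  constructor
  · intro h
    obtain ⟨k, hk⟩ := exists_mem_Ico hj y
    rw [sawtooth_of_mem hj hk] at h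
    exact ⟨k, by linarith⟩
  · rintro ⟨k, rfl⟩
    rw [sawtooth_of_mem hj (k := k) ⟨le_rfl, by nlinarith⟩]
    ring

lemma sawtooth_periodic (hj : 0 < j) : Function.Periodic (sawtooth j) (2 * j) := by
  intro y
  have h : (y + 2 * j) / (2 * j) = y / (2 * j) + 1 := by field_simp
  rw [sawtooth, h, Int.fract_add_one, sawtooth]

lemma hasDerivAt_sawtooth (hj : 0 < j) {y : ℝ} (h : sawtooth j y ≠ -j) :
    HasDerivAt (sawtooth j) 1 y := by
  obtain ⟨k, hk⟩ := exists_mem_Ico hj y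
  have hk0 : 2 * j * k < y := by
    refine lt_of_le_of_ne hk.1 fun he => h ?_
    rw [sawtooth_of_mem hj hk, ← he]
    ring
  have he : sawtooth j =ᶠ[𝓝 y] fun z => z - 2 * j * k - j := by
    filter_upwards [Ioo_mem_nhds hk0 hk.2] with z hz using sawtooth_of_mem hj ⟨hz.1.le, hz.2⟩
  exact (((hasDerivAt_id y).sub_const _).sub_const _).congr_of_eventuallyEq he

/-- The sawtooth jumps only from `j` to `-j`, and `f` does not see this jump. -/
lemma continuous_comp_sawtooth {f : ℝ → ℝ} (hf : Continuous f) (h : f (-j) = f j) :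
    Continuous fun y => f (sawtooth j y) := by
  have h1 : Continuous fun t => f (2 * j * Int.fract t - j) :=
    ContinuousOn.comp_fract'' (f := fun t => f (2 * j * t - j)) (by fun_prop) (by
      simp only [mul_zero, zero_sub, mul_one, h]
      congr 1; ring)
  exact h1.comp (continuous_id.div_const _)

end Sawtooth

/-- A solution on `[-j, j]` that is positive inside and vanishes at the end points gives an
arch wave. -/
theorem exists_isArchWave {μ κ s j : ℝ} (c : ℝ) {V V' : ℝ → ℝ} (hs : s ^ 2 = 1) (hj : 0 < j)
    (hV : ∀ y, HasDerivAt V (V' y) y) (hV' : ∀ y, HasDerivAt V' (2 * μ * (s * V y - κ)) y)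
    (hpos : ∀ y ∈ Ioo (-j) j, 0 < V y) (hl : V (-j) = 0) (hr : V j = 0)
    (h0 : V' 0 = 0) (hsl : ∀ y ∈ Ioo (-j) 0, 0 < V' y) (hsr : ∀ y ∈ Ioo 0 j, V' y < 0) :
    ∃ φ x₀ T p, IsArchWave μ c (4 * μ * (c + κ)) s (c + s * V 0) φ x₀ T p := by
  have hs0 : s ≠ 0 := by rintro rfl; norm_num at hs
  have cV : Continuous V := continuous_iff_continuousAt.2 fun y => (hV y).continuousAt
  set W : ℝ → ℝ := fun y => V (sawtooth j y) with hWdef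
  set W' : ℝ → ℝ := fun y => V' (sawtooth j y)
  have cW : Continuous W := continuous_comp_sawtooth cV (hl.trans hr.symm)
  have Wzero : ∀ y, W y = 0 ↔ ∃ k : ℤ, y = 2 * j * k := by
    intro y
    rw [← sawtooth_eq_neg_iff hj]
    have hm := sawtooth_mem hj y
    constructor
    · intro h
      by_contra hne
      exact (hpos _ ⟨lt_of_le_of_ne hm.1 (Ne.symm hne), hm.2⟩).ne' h
    · intro h
      simp only [hWdef, h, hl]
  have Wne : ∀ y, W y ≠ 0 → sawtooth j y ≠ -j := fun y hy h =>
    hy (by simp only [hWdef, h, hl])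
  have W0 : ∀ y, 0 ≤ W y := by
    intro y
    by_cases h : sawtooth j y = -j
    · simp only [hWdef, h, hl, le_refl]
    · have hm := sawtooth_mem hj y
      exact (hpos _ ⟨lt_of_le_of_ne hm.1 (Ne.symm h), hm.2⟩).le
  have Wd : ∀ y, W y ≠ 0 → HasDerivAt W (W' y) y := fun y hy => by
    exact ((hV _).comp y (hasDerivAt_sawtooth hj (Wne y hy))).congr_deriv (mul_one _)
  have Wd' : ∀ y, W y ≠ 0 → HasDerivAt W' (2 * μ * (s * W y - κ)) y := fun y hy => by
    exact ((hV' _).comp y (hasDerivAt_sawtooth hj (Wne y hy))).congr_deriv (mul_one _)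
  have Wper : Function.Periodic W (2 * j) := fun y => by
    simp only [hWdef, sawtooth_periodic hj y]
  have Wpos : ∀ y ∈ Ioo 0 (2 * j), W y ≠ 0 := by
    rintro y ⟨hy0, hy1⟩ h
    obtain ⟨k, rfl⟩ := (Wzero y).1 h
    have h1 : (0 : ℝ) < k := by
      by_contra hk
      nlinarith
    have h2 : (k : ℝ) < 1 := by
      by_contra hk
      nlinarith
    have h1' : (0 : ℤ) < k := by exact_mod_cast h1
    have h2' : k < 1 := by exact_mod_cast h2
    omega
  have hz : ∀ y z, y < z → ∃ t ∈ Icc y z, W t ≠ 0 := by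
    intro y z hyz
    by_contra! hcon
    obtain ⟨k, hk⟩ := exists_mem_Ico hj y
    have hm : (2 * j * k < min z (2 * j * (k + 1))) := lt_min (hk.1.trans_lt hyz) (by nlinarith)
    have hym : y < min z (2 * j * (k + 1)) := lt_min hyz hk.2
    -- This point lies strictly inside a tooth, where `V` is positive.
    set t := (y + min z (2 * j * (k + 1))) / 2 with ht
    have t1 : y < t := by linarith
    have t2 : t < min z (2 * j * (k + 1)) := by linarith
    have hW := hcon t ⟨t1.le, (t2.trans_le (min_le_left _ _)).le⟩
    rw [hWdef] at hW
    simp only at hW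
    rw [sawtooth_of_mem hj (k := k) ⟨hk.1.trans t1.le, t2.trans_le (min_le_right _ _)⟩] at hW
    have := t2.trans_le (min_le_right _ _)
    exact (hpos _ ⟨by linarith [hk.1], by linarith⟩).ne' hW
  have hmono := strictMono_arcX cW W0 hz
  obtain ⟨Y, hY, hT, hYadd⟩ := exists_orderIso_arcX_periodic cW W0 hz Wper
    (show (0 : ℝ) < 2 * j by positivity)
  set T := arcX W (2 * j) with hTdef
  have hYk : ∀ k : ℤ, Y (k * T) = 2 * j * k := by
    -- `Y` advances by `2 j` over each `T`; removing the linear drift leaves a periodic function,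
    -- which is then evaluated at the integer multiples of `T`.
    have hp : Function.Periodic (fun x => Y x - 2 * j / T * x) T := fun x => by
      simp only [hYadd]
      field_simp
      ring
    intro k
    have h1 := hp.int_mul k 0
    have h2 : Y 0 = 0 := by
      rw [← Y.symm.injective.eq_iff, OrderIso.symm_apply_apply, hY, arcX_zero]
    simp only [zero_add, h2, mul_zero, sub_zero] at h1
    have : 2 * j / T * (k * T) = 2 * j * k := by field_simp
    linarith
  have hYX : ∀ y, Y (arcX W y) = y := fun y => by rw [← hY, OrderIso.apply_symm_apply]
  have dφ : ∀ x, W (Y x) ≠ 0 → deriv (fun x => c + s * W (Y x)) x =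
      s * (W' (Y x) / √(W (Y x))) := fun x hx => (hasDerivAt_profile cW W0 hY Wd hx).deriv
  have sgn : ∀ x, W (Y x) ≠ 0 → s * deriv (fun x => c + s * W (Y x)) x =
      W' (Y x) / √(W (Y x)) := fun x hx => by
    rw [dφ x hx, ← mul_assoc, ← sq, hs, one_mul]
  have saw : ∀ y ∈ Ico 0 (2 * j), sawtooth j y = y - j := fun y hy => by
    simpa using sawtooth_of_mem hj (k := 0) (by simpa using hy)
  refine ⟨fun x => c + s * W (Y x), 0, T, arcX W j, ?_⟩
  constructor
  · exact solvesOff_profile hs cW W0 hY Wd Wd'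
  · exact hT
  · intro x
    simp only [hYadd, Wper (Y x)]
  · intro x
    have : c + s * W (Y x) = c ↔ W (Y x) = 0 := by simp [hs0]
    rw [this, Wzero]
    refine exists_congr fun k => ?_
    rw [← hYk k, Y.injective.eq_iff, zero_add]
  · rw [zero_add, ← arcX_zero (W := W)]
    exact ⟨hmono hj, hmono (by linarith)⟩
  · show c + s * V (sawtooth j (Y (arcX W j))) = _
    rw [hYX, saw j ⟨hj.le, by linarith⟩, sub_self]
  · rw [dφ _ (by rw [hYX]; exact Wpos j ⟨hj, by linarith⟩), hYX]
    have : W' j = 0 := by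
      show V' (sawtooth j j) = 0
      rw [saw j ⟨hj.le, by linarith⟩, sub_self, h0]
    rw [this]; simp
  · intro x hx
    have y1 : 0 < Y x := by
      have := Y.strictMono hx.1
      rwa [← arcX_zero (W := W), hYX] at this
    have y2 : Y x < j := by
      have := Y.strictMono hx.2
      rwa [hYX] at this
    have hne := Wpos (Y x) ⟨y1, by linarith⟩
    rw [sgn x hne]
    refine div_pos ?_ (Real.sqrt_pos.2 (lt_of_le_of_ne (W0 _) hne.symm))
    show 0 < V' (sawtooth j (Y x))
    rw [saw (Y x) ⟨y1.le, by linarith⟩]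
    exact hsl _ ⟨by linarith, by linarith⟩
  · intro x hx
    have y1 : j < Y x := by
      have := Y.strictMono hx.1
      rwa [hYX] at this
    have y2 : Y x < 2 * j := by
      have := Y.strictMono hx.2
      rwa [zero_add, hTdef, hYX] at this
    have hne := Wpos (Y x) ⟨by linarith, by linarith⟩
    rw [sgn x hne]
    refine div_neg_of_neg_of_pos ?_ (Real.sqrt_pos.2 (lt_of_le_of_ne (W0 _) hne.symm))
    show V' (sawtooth j (Y x)) < 0
    rw [saw (Y x) ⟨by linarith, by linarith⟩]
    exact hsr _ ⟨by linarith, by linarith⟩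


/-! ### Explicit profiles -/

section Profiles

variable {μ c m M : ℝ}

lemma sq_sqrt_two_mul (hμ : 0 < μ) : √(2 * μ) ^ 2 = 2 * μ := Real.sq_sqrt (by positivity)

lemma hasDerivAt_cos_profile (k B ν y : ℝ) :
    HasDerivAt (fun y => k + B * Real.cos (ν * y)) (-(B * ν) * Real.sin (ν * y)) y := by
  have h := ((((hasDerivAt_id y).const_mul ν).cos).const_mul B).const_add k
  exact h.congr_deriv (by simp; ring)

lemma hasDerivAt_sin_profile (k ν y : ℝ) :
    HasDerivAt (fun y => k * Real.sin (ν * y)) (k * ν * Real.cos (ν * y)) y := by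
  have h := (((hasDerivAt_id y).const_mul ν).sin).const_mul k
  exact h.congr_deriv (by simp; ring)

/-- Arches below the height `c`. -/
theorem exists_isArchWave_below (hμ : 0 < μ) (hm : m < c) (hM : c ≤ M) :
    ∃ φ x₀ T p, IsArchWave μ c (2 * μ * (m + M)) (-1) m φ x₀ T p := by
  set ν := √(2 * μ) with hν
  have ν2 : ν ^ 2 = 2 * μ := sq_sqrt_two_mul hμ
  have ν0 : 0 < ν := Real.sqrt_pos.2 (by positivity)
  set A := (m + M) / 2 with hA
  set B := (M - m) / 2 with hB
  have B0 : 0 < B := by simp only [hB]; linarith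
  have q1 : -1 ≤ (A - c) / B := by rw [le_div_iff₀ B0]; simp only [hA, hB]; linarith
  have q2 : (A - c) / B < 1 := by rw [div_lt_one B0]; simp only [hA, hB]; linarith
  -- Here `W = c - φ` is a harmonic oscillator of frequency `ν` about `c - A`, and `j` is the first
  -- positive zero of `(c - A) + B cos (ν y)`. For `M = c` the quotient is `-1` and the zero is
  -- double: this is the peak.
  set j := Real.arccos ((A - c) / B) / ν with hj
  have hjν : ν * j = Real.arccos ((A - c) / B) := by rw [hj]; field_simp
  have hcos : Real.cos (ν * j) = (A - c) / B := by rw [hjν, Real.cos_arccos q1 q2.le]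
  have j0 : 0 < j := div_pos (Real.arccos_pos.2 q2) ν0
  have jπ : ν * j ≤ Real.pi := by rw [hjν]; exact Real.arccos_le_pi _
  have hBc : B * ((A - c) / B) = A - c := by field_simp
  have h := exists_isArchWave (μ := μ) (κ := A - c) (s := -1) (j := j) c
    (V := fun y => (c - A) + B * Real.cos (ν * y)) (V' := fun y => -(B * ν) * Real.sin (ν * y))
    (by norm_num) j0 (hasDerivAt_cos_profile _ _ _)
    (fun y => (hasDerivAt_sin_profile _ _ y).congr_deriv
      (by linear_combination (-B * Real.cos (ν * y)) * ν2))
    (fun y hy => by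
      have h1 : |ν * y| < ν * j := by
        rw [abs_mul, abs_of_pos ν0]
        exact mul_lt_mul_of_pos_left (abs_lt.2 hy) ν0
      have h2 := Real.cos_lt_cos_of_nonneg_of_le_pi (abs_nonneg _) jπ h1
      rw [Real.cos_abs, hcos] at h2
      have h3 := mul_lt_mul_of_pos_left h2 B0
      rw [hBc] at h3
      linarith)
    (by simp only [mul_neg, Real.cos_neg, hcos, hBc]; ring)
    (by simp only [hcos, hBc]; ring) (by simp)
    (fun y hy => by
      have : Real.sin (ν * y) < 0 := Real.sin_neg_of_neg_of_neg_pi_lt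
        (mul_neg_of_pos_of_neg ν0 hy.2) (by nlinarith [hy.1])
      have hBν : 0 < B * ν := by positivity
      nlinarith)
    (fun y hy => by
      have : 0 < Real.sin (ν * y) := Real.sin_pos_of_pos_of_lt_pi
        (mul_pos ν0 hy.1) (by nlinarith [hy.2])
      have hBν : 0 < B * ν := by positivity
      nlinarith)
  have e1 : 4 * μ * (c + (A - c)) = 2 * μ * (m + M) := by simp only [hA]; ring
  have e2 : c + -1 * (c - A + B * Real.cos (ν * 0)) = m := by simp [hA, hB]; ring
  rwa [e1, e2] at h

lemma hasDerivAt_cosh_profile (k B ν y : ℝ) :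
    HasDerivAt (fun y => k + B * Real.cosh (ν * y)) (B * ν * Real.sinh (ν * y)) y := by
  have h := ((((hasDerivAt_id y).const_mul ν).cosh).const_mul B).const_add k
  exact h.congr_deriv (by simp; ring)

lemma hasDerivAt_sinh_profile (k ν y : ℝ) :
    HasDerivAt (fun y => k * Real.sinh (ν * y)) (k * ν * Real.cosh (ν * y)) y := by
  have h := (((hasDerivAt_id y).const_mul ν).sinh).const_mul k
  exact h.congr_deriv (by simp; ring)

/-- Arches above the height `c`. -/
theorem exists_isArchWave_above (hμ : 0 < μ) (hm : c < m) (hM : m < M) :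
    ∃ φ x₀ T p, IsArchWave μ c (2 * μ * (m + M)) 1 m φ x₀ T p := by
  set ν := √(2 * μ) with hν
  have ν2 : ν ^ 2 = 2 * μ := sq_sqrt_two_mul hμ
  have ν0 : 0 < ν := Real.sqrt_pos.2 (by positivity)
  set A := (m + M) / 2 with hA
  set B := (M - m) / 2 with hB
  have B0 : 0 < B := by simp only [hB]; linarith
  have q2 : 1 < (A - c) / B := by rw [one_lt_div B0]; simp only [hA, hB]; linarith
  -- Above `c` the linear equation for `W = φ - c` is hyperbolic. The condition `c < m` says
  -- precisely that the quotient exceeds `1`, so `(A - c) - B cosh (ν y)` has a positive zero.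
  set j := Real.arcosh ((A - c) / B) / ν with hj
  have hjν : ν * j = Real.arcosh ((A - c) / B) := by rw [hj]; field_simp
  have hcos : Real.cosh (ν * j) = (A - c) / B := by rw [hjν, Real.cosh_arcosh q2.le]
  have j0 : 0 < j := div_pos (Real.arcosh_pos q2) ν0
  have hBc : B * ((A - c) / B) = A - c := by field_simp
  have h := exists_isArchWave (μ := μ) (κ := A - c) (s := 1) (j := j) c
    (V := fun y => (A - c) + (-B) * Real.cosh (ν * y))
    (V' := fun y => -B * ν * Real.sinh (ν * y))
    (by norm_num) j0 (hasDerivAt_cosh_profile _ _ _)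
    (fun y => (hasDerivAt_sinh_profile _ _ y).congr_deriv
      (by linear_combination (-B * Real.cosh (ν * y)) * ν2))
    (fun y hy => by
      have h2 : Real.cosh (ν * y) < Real.cosh (ν * j) := by
        rw [Real.cosh_lt_cosh, abs_mul, abs_mul, abs_of_pos ν0, abs_of_pos j0]
        exact mul_lt_mul_of_pos_left (abs_lt.2 hy) ν0
      rw [hcos] at h2
      have h3 := mul_lt_mul_of_pos_left h2 B0
      rw [hBc] at h3
      linarith)
    (by simp only [mul_neg, Real.cosh_neg, hcos, neg_mul, hBc]; ring)
    (by simp only [hcos, neg_mul, hBc]; ring) (by simp)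
    (fun y hy => by
      have : Real.sinh (ν * y) < 0 := Real.sinh_neg_iff.2 (mul_neg_of_pos_of_neg ν0 hy.2)
      have hBν : 0 < B * ν := by positivity
      nlinarith)
    (fun y hy => by
      have : 0 < Real.sinh (ν * y) := Real.sinh_pos_iff.2 (mul_pos ν0 hy.1)
      have hBν : 0 < B * ν := by positivity
      nlinarith)
  have e1 : 4 * μ * (c + (A - c)) = 2 * μ * (m + M) := by simp only [hA]; ring
  have e2 : c + 1 * (A - c + -B * Real.cosh (ν * 0)) = m := by simp [hA, hB]; ring
  rwa [e1, e2] at h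

/-- A periodic solution below the height `c`, increasing from a minimum `m` at `x₀` to a maximum
`M` at `p` and then decreasing to the minimum at `x₀ + T`. -/
structure IsSmoothArch (μ c a m M : ℝ) (φ : ℝ → ℝ) (x₀ T p : ℝ) : Prop where
  solves : SolvesOff μ c a φ
  ne_height : ∀ x, φ x ≠ c
  period_pos : 0 < T
  periodic : Function.Periodic φ T
  mem : p ∈ Ioo x₀ (x₀ + T)
  value_left : φ x₀ = m
  value_mid : φ p = M
  critical : deriv φ x₀ = 0
  sign_left : ∀ x ∈ Ioo x₀ p, 0 < deriv φ x
  sign_right : ∀ x ∈ Ioo p (x₀ + T), deriv φ x < 0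

/-- The oscillator of `exists_isArchWave_below`, but now `W ≥ c - M > 0` for all `y`. The cosine
itself is used over its full period and nothing has to be folded. -/
theorem exists_isSmoothArch (hμ : 0 < μ) (hm : m < M) (hM : M < c) :
    ∃ φ x₀ T p, IsSmoothArch μ c (2 * μ * (m + M)) m M φ x₀ T p := by
  set ν := √(2 * μ) with hν
  have ν2 : ν ^ 2 = 2 * μ := sq_sqrt_two_mul hμ
  have ν0 : 0 < ν := Real.sqrt_pos.2 (by positivity)
  set A := (m + M) / 2 with hA
  set B := (M - m) / 2 with hB
  have B0 : 0 < B := by simp only [hB]; linarith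
  set W : ℝ → ℝ := fun y => (c - A) + B * Real.cos (ν * y) with hWdef
  set W' : ℝ → ℝ := fun y => -(B * ν) * Real.sin (ν * y) with hW'def
  have cW : Continuous W := by fun_prop
  have Wpos : ∀ y, 0 < W y := fun y => by
    have := Real.neg_one_le_cos (ν * y)
    have h1 : A + B < c := by simp only [hA, hB]; linarith
    simp only [hWdef]
    nlinarith
  have Wd : ∀ y, W y ≠ 0 → HasDerivAt W (W' y) y := fun y _ => hasDerivAt_cos_profile _ _ _ y
  have Wd' : ∀ y, W y ≠ 0 → HasDerivAt W' (2 * μ * (-1 * W y - (A - c))) y := fun y _ =>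
    (hasDerivAt_sin_profile _ _ y).congr_deriv
      (by linear_combination (-B * Real.cos (ν * y)) * ν2)
  set j := Real.pi / ν with hj
  have j0 : 0 < j := div_pos Real.pi_pos ν0
  have hjν : ν * j = Real.pi := by rw [hj]; field_simp
  have Wper : Function.Periodic W (2 * j) := fun y => by
    have : ν * (y + 2 * j) = ν * y + 2 * Real.pi := by rw [← hjν]; ring
    simp only [hWdef, this, Real.cos_add_two_pi]
  have hz : ∀ y z, y < z → ∃ t ∈ Icc y z, W t ≠ 0 := fun y z h =>
    ⟨y, left_mem_Icc.2 h.le, (Wpos y).ne'⟩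
  have W0 : ∀ y, 0 ≤ W y := fun y => (Wpos y).le
  have hmono := strictMono_arcX cW W0 hz
  obtain ⟨Y, hY, hT, hYadd⟩ := exists_orderIso_arcX_periodic cW W0 hz Wper
    (show (0 : ℝ) < 2 * j by positivity)
  have hYX : ∀ y, Y (arcX W y) = y := fun y => by rw [← hY, OrderIso.apply_symm_apply]
  have hY0 : Y 0 = 0 := by rw [← arcX_zero (W := W), hYX, arcX_zero]
  have dφ : ∀ x, deriv (fun x => c + -1 * W (Y x)) x = -1 * (W' (Y x) / √(W (Y x))) :=
    fun x => (hasDerivAt_profile cW W0 hY Wd (Wpos _).ne').deriv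
  have e1 : 4 * μ * (c + (A - c)) = 2 * μ * (m + M) := by simp only [hA]; ring
  refine ⟨fun x => c + -1 * W (Y x), 0, arcX W (2 * j), arcX W j, ?_⟩
  constructor
  · rw [← e1]
    exact solvesOff_profile (by norm_num) cW W0 hY Wd Wd'
  · intro x h
    have := Wpos (Y x)
    linarith
  · exact hT
  · intro x
    simp only [hYadd, Wper (Y x)]
  · rw [zero_add, ← arcX_zero (W := W)]
    exact ⟨hmono j0, hmono (by linarith)⟩
  · simp only [hY0, hWdef, hA, hB, mul_zero, Real.cos_zero]
    ring
  · show c + -1 * W (Y (arcX W j)) = M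
    rw [hYX]
    simp only [hWdef, hjν, Real.cos_pi, hA, hB]
    ring
  · rw [dφ, hY0]
    simp [hW'def]
  · intro x hx
    have y1 : 0 < Y x := by
      have := Y.strictMono hx.1
      rwa [hY0] at this
    have y2 : Y x < j := by
      have := Y.strictMono hx.2
      rwa [hYX] at this
    have : 0 < Real.sin (ν * Y x) := Real.sin_pos_of_pos_of_lt_pi
        (mul_pos ν0 y1) (by nlinarith)
    rw [dφ]
    have h2 : 0 < B * ν * Real.sin (ν * Y x) / √(W (Y x)) :=
      div_pos (by positivity) (Real.sqrt_pos.2 (Wpos _))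
    have h3 : -1 * (W' (Y x) / √(W (Y x))) = B * ν * Real.sin (ν * Y x) / √(W (Y x)) := by
      simp only [hW'def]; ring
    rwa [h3]
  · intro x hx
    have y1 : j < Y x := by
      have := Y.strictMono hx.1
      rwa [hYX] at this
    have y2 : Y x < 2 * j := by
      have := Y.strictMono hx.2
      rwa [zero_add, hYX] at this
    have hs : Real.sin (ν * Y x) < 0 := by
      have h1 : Real.sin (ν * Y x - Real.pi) = -Real.sin (ν * Y x) := Real.sin_sub_pi _
      have h2 : 0 < Real.sin (ν * Y x - Real.pi) :=
        Real.sin_pos_of_pos_of_lt_pi (by rw [← hjν]; nlinarith) (by rw [← hjν]; nlinarith)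
      linarith
    rw [dφ]
    have h2 : B * ν * Real.sin (ν * Y x) / √(W (Y x)) < 0 :=
      div_neg_of_neg_of_pos (by have : 0 < B * ν := by positivity
                                nlinarith) (Real.sqrt_pos.2 (Wpos _))
    have h3 : -1 * (W' (Y x) / √(W (Y x))) = B * ν * Real.sin (ν * Y x) / √(W (Y x)) := by
      simp only [hW'def]; ring
    rwa [h3]

/-- A solution with values in `[c, m)` that takes the value `c` only at `x₀`, decreases before and
increases after that point, and tends to `m` at both ends. -/
structure IsLineArch (μ c a m : ℝ) (φ : ℝ → ℝ) (x₀ : ℝ) : Prop where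
  solves : SolvesOff μ c a φ
  parameters : HasParameters μ c m m φ
  zeros : ∀ x, φ x = c ↔ x = x₀
  lt : ∀ x, φ x < m
  sign_left : ∀ x < x₀, deriv φ x < 0
  sign_right : ∀ x > x₀, 0 < deriv φ x
  limit_right : Tendsto φ atTop (𝓝 m)
  limit_left : Tendsto φ atBot (𝓝 m)

/-- The double root: `d (1 - exp (-ν |y|))` solves `W'' = 2 μ (W - d)` off `y = 0`. Its corner is
harmless, since `W` vanishes there and no equation is required at that point. -/
theorem exists_isLineArch (hμ : 0 < μ) (hm : c < m) :
    ∃ φ x₀, IsLineArch μ c (2 * μ * (m + m)) m φ x₀ := by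
  set ν := √(2 * μ) with hν
  have ν2 : ν ^ 2 = 2 * μ := sq_sqrt_two_mul hμ
  have ν0 : 0 < ν := Real.sqrt_pos.2 (by positivity)
  set d := m - c with hd
  have d0 : 0 < d := sub_pos.2 hm
  set W : ℝ → ℝ := fun y => d * (1 - Real.exp (-(ν * |y|))) with hWdef
  set W' : ℝ → ℝ := fun y => if 0 < y then d * ν * Real.exp (-(ν * y)) else
    -(d * ν) * Real.exp (ν * y) with hW'def
  have cW : Continuous W := by fun_prop
  have Wpos : ∀ y, y ≠ 0 → 0 < W y := fun y hy => by
    have : Real.exp (-(ν * |y|)) < 1 := by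
      rw [Real.exp_lt_one_iff]
      have := mul_pos ν0 (abs_pos.2 hy)
      linarith
    exact mul_pos d0 (by linarith)
  have Wzero : W 0 = 0 := by simp [hWdef]
  have Wne : ∀ y, W y ≠ 0 → y ≠ 0 := by rintro y h rfl; exact h Wzero
  have W0 : ∀ y, 0 ≤ W y := fun y => by
    rcases eq_or_ne y 0 with rfl | h
    · exact Wzero.ge
    · exact (Wpos y h).le
  have Wlt : ∀ y, W y < d := fun y => by
    have := Real.exp_pos (-(ν * |y|))
    simp only [hWdef]
    nlinarith
  have expd : ∀ k y : ℝ, HasDerivAt (fun y => Real.exp (k * y)) (k * Real.exp (k * y)) y := by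
    intro k y
    exact (((hasDerivAt_id y).const_mul k).exp).congr_deriv (by simp; ring)
  have Wd : ∀ y, W y ≠ 0 → HasDerivAt W (W' y) y := fun y hy => by
    rcases lt_or_gt_of_ne (Wne y hy) with h | h
    · have he : W =ᶠ[𝓝 y] fun y => d * (1 - Real.exp (ν * y)) := by
        filter_upwards [Iio_mem_nhds h] with z hz
        simp [hWdef, abs_of_neg (mem_Iio.1 hz)]
      refine ((((expd ν y).const_sub 1).const_mul d).congr_of_eventuallyEq he).congr_deriv ?_
      simp only [hW'def, if_neg h.not_gt]
      ring
    · have he : W =ᶠ[𝓝 y] fun y => d * (1 - Real.exp (-ν * y)) := by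
        filter_upwards [Ioi_mem_nhds h] with z hz
        simp [hWdef, abs_of_pos (mem_Ioi.1 hz)]
      refine ((((expd (-ν) y).const_sub 1).const_mul d).congr_of_eventuallyEq he).congr_deriv ?_
      simp only [hW'def, if_pos h, neg_mul]
      ring
  have Wd' : ∀ y, W y ≠ 0 → HasDerivAt W' (2 * μ * (1 * W y - d)) y := fun y hy => by
    rcases lt_or_gt_of_ne (Wne y hy) with h | h
    · have he : W' =ᶠ[𝓝 y] fun y => -(d * ν) * Real.exp (ν * y) := by
        filter_upwards [Iio_mem_nhds h] with z hz
        simp only [hW'def, if_neg (mem_Iio.1 hz).not_gt]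
      refine (((expd ν y).const_mul (-(d * ν))).congr_of_eventuallyEq he).congr_deriv ?_
      simp only [hWdef, abs_of_neg h, mul_neg, neg_neg]
      linear_combination (-d * Real.exp (ν * y)) * ν2
    · have he : W' =ᶠ[𝓝 y] fun y => (d * ν) * Real.exp (-ν * y) := by
        filter_upwards [Ioi_mem_nhds h] with z hz
        simp only [hW'def, if_pos (mem_Ioi.1 hz), neg_mul]
      refine (((expd (-ν) y).const_mul (d * ν)).congr_of_eventuallyEq he).congr_deriv ?_
      simp only [hWdef, abs_of_pos h, neg_mul]
      linear_combination (-d * Real.exp (-(ν * y))) * ν2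
  have hz : ∀ y z, y < z → ∃ t ∈ Icc y z, W t ≠ 0 := fun y z h => by
    by_cases hz0 : z = 0
    · exact ⟨y, left_mem_Icc.2 h.le, (Wpos y (by linarith)).ne'⟩
    · exact ⟨z, right_mem_Icc.2 h.le, (Wpos z hz0).ne'⟩
  -- `W` increases on the positive axis, so `x` grows at least linearly and covers the whole line.
  have lower : ∀ y, 1 ≤ y → √(W 1) * (y - 1) ≤ arcX W y := by
    intro y hy
    have h1 : arcX W y - arcX W 1 = ∫ t in (1 : ℝ)..y, √(W t) :=
      intervalIntegral.integral_interval_sub_left (cW.sqrt.intervalIntegrable _ _)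
        (cW.sqrt.intervalIntegrable _ _)
    have h2 : 0 ≤ arcX W 1 := by
      rw [← arcX_zero (W := W)]
      exact (strictMono_arcX cW W0 hz).monotone zero_le_one
    have h3 : ∫ t in (1 : ℝ)..y, √(W 1) ≤ ∫ t in (1 : ℝ)..y, √(W t) := by
      refine intervalIntegral.integral_mono_on hy intervalIntegrable_const
        (cW.sqrt.intervalIntegrable _ _) fun t ht => Real.sqrt_le_sqrt ?_
      simp only [hWdef, abs_one, abs_of_nonneg (zero_le_one.trans ht.1)]
      gcongr
      exact ht.1
    rw [intervalIntegral.integral_const, smul_eq_mul, mul_comm] at h3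
    linarith
  have top : Tendsto (arcX W) atTop atTop := by
    have h1 : Tendsto (fun y => √(W 1) * (y - 1)) atTop atTop :=
      (tendsto_atTop_add_const_right _ (-1) tendsto_id).const_mul_atTop
        (Real.sqrt_pos.2 (Wpos 1 one_ne_zero))
    refine tendsto_atTop_mono' _ ?_ h1
    filter_upwards [eventually_ge_atTop 1] with y hy using lower y hy
  have odd : ∀ y, arcX W (-y) = -arcX W y := by
    intro y
    have h1 := intervalIntegral.integral_comp_neg (a := 0) (b := y) (fun t => √(W t))
    have h2 : ∀ t, W (-t) = W t := fun t => by simp [hWdef]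
    simp only [h2, neg_zero] at h1
    rw [arcX, arcX, h1, intervalIntegral.integral_symm]
  have bot : Tendsto (arcX W) atBot atBot := by
    have := tendsto_neg_atTop_atBot.comp (top.comp tendsto_neg_atBot_atTop)
    refine this.congr fun y => ?_
    simp [odd]
  obtain ⟨Y, hY⟩ := exists_orderIso_arcX cW W0 hz top bot
  have hYX : ∀ y, Y (arcX W y) = y := fun y => by rw [← hY, OrderIso.apply_symm_apply]
  have hY0 : Y 0 = 0 := by rw [← arcX_zero (W := W), hYX, arcX_zero]
  have Wz : ∀ y, W y = 0 ↔ y = 0 := fun y =>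
    ⟨fun h => by_contra fun hy => (Wpos y hy).ne' h, fun h => h ▸ Wzero⟩
  have dφ : ∀ x, W (Y x) ≠ 0 → deriv (fun x => c + 1 * W (Y x)) x =
      1 * (W' (Y x) / √(W (Y x))) := fun x hx => (hasDerivAt_profile cW W0 hY Wd hx).deriv
  have Wlim : Tendsto (fun y => c + 1 * d * (1 - Real.exp (-(ν * y)))) atTop (𝓝 m) := by
    have h1 : Tendsto (fun y => Real.exp (-(ν * y))) atTop (𝓝 0) :=
      Real.tendsto_exp_neg_atTop_nhds_zero.comp (tendsto_id.const_mul_atTop ν0)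
    have h2 := ((h1.const_sub 1).const_mul (1 * d)).const_add c
    have h3 : c + 1 * d * (1 - 0) = m := by simp [hd]
    rwa [h3] at h2
  have lim : Tendsto (fun y => c + 1 * W y) atTop (𝓝 m) ∧
      Tendsto (fun y => c + 1 * W y) atBot (𝓝 m) := by
    constructor
    · refine Wlim.congr' ?_
      filter_upwards [eventually_ge_atTop 0] with y hy
      simp only [hWdef, abs_of_nonneg hy]
      ring
    · refine (Wlim.comp tendsto_neg_atBot_atTop).congr' ?_
      filter_upwards [eventually_le_atBot 0] with y hy
      simp only [hWdef, abs_of_nonpos hy, Function.comp_apply]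
      ring
  have e1 : 4 * μ * (c + d) = 2 * μ * (m + m) := by simp only [hd]; ring
  refine ⟨fun x => c + 1 * W (Y x), 0, ?_⟩
  constructor
  · rw [← e1]
    exact solvesOff_profile (by norm_num) cW W0 hY Wd Wd'
  · intro x hx
    have hx0 : W (Y x) ≠ 0 := fun h => hx (by simp [h])
    refine ⟨(hasDerivAt_profile cW W0 hY Wd hx0).differentiableAt, ?_⟩
    have hsq : W' (Y x) ^ 2 = ν ^ 2 * (d - W (Y x)) ^ 2 := by
      rcases lt_or_gt_of_ne (Wne _ hx0) with h | h
      · simp only [hW'def, if_neg h.not_gt, hWdef, abs_of_neg h, mul_neg, neg_neg]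
        ring
      · simp only [hW'def, if_pos h, hWdef, abs_of_pos h]
        ring
    rw [dφ x hx0, one_mul, div_pow, Real.sq_sqrt (W0 _), hsq, ν2,
      div_eq_div_iff hx0 (by simpa using hx0)]
    simp only [hd]
    ring
  · intro x
    have : c + 1 * W (Y x) = c ↔ W (Y x) = 0 := by simp
    rw [this, Wz, ← hY0, Y.injective.eq_iff, hY0]
  · intro x
    have := Wlt (Y x)
    linarith
  · intro x hx
    have y1 : Y x < 0 := by
      have := Y.strictMono hx
      rwa [hY0] at this
    have hp := Wpos _ y1.ne
    rw [dφ x hp.ne', one_mul]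
    refine div_neg_of_neg_of_pos ?_ (Real.sqrt_pos.2 hp)
    simp only [hW'def, if_neg y1.not_gt]
    have : 0 < d * ν * Real.exp (ν * Y x) := by positivity
    linarith
  · intro x hx
    have y1 : 0 < Y x := by
      have := Y.strictMono hx
      rwa [hY0] at this
    have hp := Wpos _ y1.ne'
    rw [dφ x hp.ne', one_mul]
    refine div_pos ?_ (Real.sqrt_pos.2 hp)
    simp only [hW'def, if_pos y1]
    positivity
  · exact lim.1.comp Y.tendsto_atTop
  · exact lim.2.comp Y.tendsto_atBot

end Profiles


/-! ### Behaviour at the singular height -/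

section Crest

variable {μ c m M e : ℝ} {φ : ℝ → ℝ} {l : Filter ℝ}

/-- In the parameter equation the numerator has a nonzero limit while the denominator tends to zero.
Absolute values cover approach from above and below `c`, and `e` fixes the sign of the square root,
so cusps and anticusps are treated together. -/
lemma tendsto_mul_deriv_atTop (hμ : 0 < μ) (hp : HasParameters μ c m M φ) (hm : m ≠ c)
    (hM : M ≠ c) (he : e ^ 2 = 1) (hl : Tendsto φ l (𝓝 c))
    (hev : ∀ᶠ x in l, φ x ≠ c ∧ 0 < e * deriv φ x) :
    Tendsto (fun x => e * deriv φ x) l atTop := by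
  have h1 : Tendsto (fun x => |c - φ x|) l (𝓝[>] 0) := by
    refine tendsto_nhdsWithin_iff.2 ⟨?_, ?_⟩
    · simpa using (hl.const_sub c).abs
    · filter_upwards [hev] with x hx using abs_pos.2 (sub_ne_zero.2 hx.1.symm)
  have h2 : Tendsto (fun x => |2 * μ * (M - φ x) * (φ x - m)|) l
      (𝓝 |2 * μ * (M - c) * (c - m)|) :=
    (((hl.const_sub M).const_mul (2 * μ)).mul (hl.sub_const m)).abs
  have h3 : 0 < |2 * μ * (M - c) * (c - m)| :=
    abs_pos.2 (mul_ne_zero (mul_ne_zero (by positivity) (sub_ne_zero.2 hM))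
      (sub_ne_zero.2 hm.symm))
  have h4 := Real.tendsto_sqrt_atTop.comp (h2.pos_mul_atTop h3 (tendsto_inv_nhdsGT_zero.comp h1))
  refine h4.congr' ?_
  filter_upwards [hev] with x hx
  have e1 : |2 * μ * (M - φ x) * (φ x - m)| * |c - φ x|⁻¹ = (e * deriv φ x) ^ 2 := by
    rw [← abs_inv, ← abs_mul, ← div_eq_mul_inv, ← (hp x hx.1).2, mul_pow, he, one_mul,
      abs_of_nonneg (sq_nonneg _)]
  simp only [Function.comp_apply]
  rw [e1, Real.sqrt_sq hx.2.le]

/-- With `M = c` the factor `c - φ` cancels, leaving `φ'² = 2 μ (φ - m)`. -/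
lemma tendsto_mul_deriv_nhds (hp : HasParameters μ c m c φ)
    (he : e ^ 2 = 1) (hl : Tendsto φ l (𝓝 c))
    (hev : ∀ᶠ x in l, φ x ≠ c ∧ 0 < e * deriv φ x) :
    Tendsto (fun x => e * deriv φ x) l (𝓝 √(2 * μ * (c - m))) := by
  have h2 : Tendsto (fun x => √(2 * μ * (φ x - m))) l (𝓝 √(2 * μ * (c - m))) :=
    ((hl.sub_const m).const_mul (2 * μ)).sqrt
  refine h2.congr' ?_
  filter_upwards [hev] with x hx
  have hne : c - φ x ≠ 0 := sub_ne_zero.2 hx.1.symm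
  have e1 : 2 * μ * (φ x - m) = (e * deriv φ x) ^ 2 := by
    rw [mul_pow, he, one_mul, (hp x hx.1).2]
    field_simp
  rw [e1, Real.sqrt_sq hx.2.le]

end Crest

/-! ### Arch waves -/

lemma deriv_periodic {φ : ℝ → ℝ} {T : ℝ} (h : Function.Periodic φ T) :
    Function.Periodic (deriv φ) T := fun x => by
  rw [← deriv_comp_add_const]
  exact congrArg (fun f => deriv f x) (funext h)

lemma exists_int_add_mem_Ico {T : ℝ} (hT : 0 < T) (x y : ℝ) :
    ∃ k : ℤ, x + k * T ∈ Ico y (y + T) := by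
  obtain ⟨k, hk, -⟩ := existsUnique_add_zsmul_mem_Ico hT x y
  exact ⟨k, by simpa using hk⟩

lemma periodic_add_int {φ : ℝ → ℝ} {T : ℝ} (h : Function.Periodic φ T) (x : ℝ) (k : ℤ) :
    φ (x + k * T) = φ x := h.int_mul k x

lemma volume_zeros_eq_zero {c x₀ T : ℝ} {φ : ℝ → ℝ} (h : ∀ x, φ x = c ↔ ∃ k : ℤ, x = x₀ + k * T) :
    volume {x | φ x = c} = 0 := by
  have : {x | φ x = c} ⊆ range fun k : ℤ => x₀ + k * T := by
    intro x hx
    obtain ⟨k, hk⟩ := (h x).1 hx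
    exact ⟨k, hk.symm⟩
  exact ((countable_range _).mono this).measure_zero _

lemma ne_of_mem_Ioo_zeros {c x₀ T : ℝ} {φ : ℝ → ℝ} (hT : 0 < T)
    (h : ∀ x, φ x = c ↔ ∃ k : ℤ, x = x₀ + k * T) (k : ℤ) {x : ℝ}
    (hx : x ∈ Ioo (x₀ + k * T) (x₀ + (k + 1) * T)) : φ x ≠ c := by
  intro hc
  obtain ⟨n, rfl⟩ := (h x).1 hc
  have h1 : (k : ℝ) < n := lt_of_mul_lt_mul_right (by linarith [hx.1]) hT.le
  have h2 : (n : ℝ) < k + 1 := lt_of_mul_lt_mul_right (by linarith [hx.2]) hT.le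
  have h1' : k < n := by exact_mod_cast h1
  have h2' : n < k + 1 := by exact_mod_cast h2
  omega

namespace IsArchWave

variable {μ c a s m M x₀ T p : ℝ} {φ : ℝ → ℝ}

lemma ne_of_mem (h : IsArchWave μ c a s m φ x₀ T p) {x : ℝ} (hx : x ∈ Ioo x₀ (x₀ + T)) :
    φ x ≠ c :=
  ne_of_mem_Ioo_zeros h.period_pos h.zeros 0 (by simpa using hx)

lemma ne_value (h : IsArchWave μ c a s m φ x₀ T p) : m ≠ c := by
  rw [← h.value]; exact h.ne_of_mem h.mem

lemma apply_left (h : IsArchWave μ c a s m φ x₀ T p) : φ x₀ = c :=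
  (h.zeros x₀).2 ⟨0, by simp⟩

lemma apply_right (h : IsArchWave μ c a s m φ x₀ T p) : φ (x₀ + T) = c :=
  (h.zeros _).2 ⟨1, by simp⟩

lemma comp_add_const (h : IsArchWave μ c a s m φ x₀ T p) (t : ℝ) :
    IsArchWave μ c a s m (fun x => φ (x + t)) (x₀ - t) T (p - t) := by
  have hd : ∀ x, deriv (fun x => φ (x + t)) x = deriv φ (x + t) :=
    fun x => _root_.deriv_comp_add_const φ t x
  refine ⟨h.solves.comp_add_const t, h.period_pos, fun x => ?_, fun x => ?_, ?_, ?_, ?_,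
    fun x hx => ?_, fun x hx => ?_⟩
  · rw [add_right_comm, h.periodic]
  · rw [h.zeros]
    exact exists_congr fun k => ⟨fun e => by linarith, fun e => by linarith⟩
  · exact ⟨by linarith [h.mem.1], by linarith [h.mem.2]⟩
  · simp [h.value]
  · simp [hd, h.critical]
  · rw [hd]
    exact h.sign_left _ ⟨by linarith [hx.1], by linarith [hx.2]⟩
  · rw [hd]
    exact h.sign_right _ ⟨by linarith [hx.1], by linarith [hx.2]⟩

lemma exists_shift (h : IsArchWave μ c a s m φ x₀ T p) {x : ℝ} (hx : φ x ≠ c) :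
    ∃ k : ℤ, x + k * T ∈ Ioo x₀ (x₀ + T) := by
  obtain ⟨k, hk⟩ := exists_int_add_mem_Ico h.period_pos x x₀
  refine ⟨k, lt_of_le_of_ne hk.1 fun he => hx ?_, hk.2⟩
  rw [← periodic_add_int h.periodic x k, ← he, h.apply_left]

/-- The first integral is known to be constant only within one arch. Periodicity brings every
regular point into that arch, and at the critical point `p` the value is `2 μ m M`. -/
lemma hasParameters (h : IsArchWave μ c a s m φ x₀ T p) (ha : a = 2 * μ * (m + M)) :
    HasParameters μ c m M φ := by
  refine h.solves.hasParameters_of_firstIntegral ha fun x hx => ?_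
  obtain ⟨k, hk⟩ := h.exists_shift hx
  have e1 : firstIntegral μ c a φ x = firstIntegral μ c a φ (x + k * T) := by
    simp only [firstIntegral, periodic_add_int h.periodic,
      periodic_add_int (deriv_periodic h.periodic)]
  rw [e1, h.solves.firstIntegral_eq isOpen_Ioo isPreconnected_Ioo (fun y hy => h.ne_of_mem hy)
    hk h.mem, firstIntegral, h.critical, h.value, ha]
  ring

lemma strictMonoOn (h : IsArchWave μ c a s m φ x₀ T p) :
    StrictMonoOn (fun x => s * φ x) (Icc x₀ p) := by
  refine strictMonoOn_of_deriv_pos (convex_Icc _ _)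
    (continuous_const.mul h.solves.continuous).continuousOn fun x hx => ?_
  rw [interior_Icc] at hx
  rw [deriv_const_mul_field]
  exact h.sign_left x hx

lemma strictAntiOn (h : IsArchWave μ c a s m φ x₀ T p) :
    StrictAntiOn (fun x => s * φ x) (Icc p (x₀ + T)) := by
  refine strictAntiOn_of_deriv_neg (convex_Icc _ _)
    (continuous_const.mul h.solves.continuous).continuousOn fun x hx => ?_
  rw [interior_Icc] at hx
  rw [deriv_const_mul_field]
  exact h.sign_right x hx

lemma range_bounds (h : IsArchWave μ c a s m φ x₀ T p) (x : ℝ) :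
    s * c ≤ s * φ x ∧ s * φ x ≤ s * m := by
  have hp := h.mem
  obtain ⟨k, hk⟩ := exists_int_add_mem_Ico h.period_pos x x₀
  rw [← periodic_add_int h.periodic x k, ← h.value]
  set y := x + k * T
  have e1 := h.apply_left
  have e2 := h.apply_right
  rcases le_total y p with hy | hy
  · have hm := h.strictMonoOn.monotoneOn
    have h1 := hm (left_mem_Icc.2 hp.1.le) ⟨hk.1, hy⟩ hk.1
    have h2 := hm ⟨hk.1, hy⟩ (right_mem_Icc.2 hp.1.le) hy
    simp only [e1] at h1
    exact ⟨h1, h2⟩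
  · have hm := h.strictAntiOn.antitoneOn
    have h1 := hm (left_mem_Icc.2 hp.2.le) ⟨hy, hk.2.le⟩ hy
    have h2 := hm ⟨hy, hk.2.le⟩ (right_mem_Icc.2 hp.2.le) hk.2.le
    simp only [e2] at h2
    exact ⟨h2, h1⟩

lemma eventually_right (h : IsArchWave μ c a s m φ x₀ T p) {x : ℝ} (hx : φ x = c) :
    ∀ᶠ y in 𝓝[>] x, φ y ≠ c ∧ 0 < s * deriv φ y := by
  obtain ⟨k, rfl⟩ := (h.zeros x).1 hx
  have hp := h.mem
  filter_upwards [Ioo_mem_nhdsGT (show x₀ + k * T < p + k * T by linarith [hp.1])] with y hy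
  have hm : y + (-k : ℤ) * T ∈ Ioo x₀ p := by
    push_cast
    constructor <;> linarith [hy.1, hy.2]
  rw [← periodic_add_int h.periodic y (-k), ← periodic_add_int (deriv_periodic h.periodic) y (-k)]
  exact ⟨h.ne_of_mem ⟨hm.1, hm.2.trans hp.2⟩, h.sign_left _ hm⟩

lemma eventually_left (h : IsArchWave μ c a s m φ x₀ T p) {x : ℝ} (hx : φ x = c) :
    ∀ᶠ y in 𝓝[<] x, φ y ≠ c ∧ 0 < -s * deriv φ y := by
  obtain ⟨k, rfl⟩ := (h.zeros x).1 hx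
  have hp := h.mem
  filter_upwards [Ioo_mem_nhdsLT (show p + (k - 1) * T < x₀ + k * T by linarith [hp.2])] with y hy
  have hm : y + (1 - k : ℤ) * T ∈ Ioo p (x₀ + T) := by
    push_cast
    constructor <;> linarith [hy.1, hy.2]
  rw [← periodic_add_int h.periodic y (1 - k),
    ← periodic_add_int (deriv_periodic h.periodic) y (1 - k)]
  have := h.sign_right _ hm
  exact ⟨h.ne_of_mem ⟨hp.1.trans hm.1, hm.2⟩, by linarith⟩

lemma smoothOnBothSides (h : IsArchWave μ c a s m φ x₀ T p) {x : ℝ} (hx : φ x = c) :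
    SmoothOnBothSides φ x := by
  obtain ⟨k, rfl⟩ := (h.zeros x).1 hx
  refine ⟨T, h.period_pos, h.solves.contDiffOn.mono fun y hy => ?_,
    h.solves.contDiffOn.mono fun y hy => ?_⟩
  · refine ne_of_mem_Ioo_zeros h.period_pos h.zeros (k - 1) ?_
    push_cast
    constructor <;> linarith [hy.1, hy.2]
  · refine ne_of_mem_Ioo_zeros h.period_pos h.zeros k ?_
    constructor <;> linarith [hy.1, hy.2]

lemma isTravelingWave (h : IsArchWave μ c a s m φ x₀ T p) : IsTravelingWave μ c φ :=
  h.solves.isTravelingWave (Or.inl (volume_zeros_eq_zero h.zeros))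

lemma isPeriodicWithCrests (h : IsArchWave μ c a s m φ x₀ T p) {Q : (ℝ → ℝ) → ℝ → Prop}
    (hQ : ∀ x, φ x = c → Q φ x) : IsPeriodicWithCrests c Q φ :=
  ⟨x₀, T, h.period_pos, h.periodic, h.zeros, h.solves.contDiffOn, hQ⟩

lemma tendsto_nhdsWithin (h : IsArchWave μ c a s m φ x₀ T p) {x : ℝ} (hx : φ x = c) (t : Set ℝ) :
    Tendsto φ (𝓝[t] x) (𝓝 c) := by
  rw [← hx]
  exact h.solves.continuous.continuousAt.tendsto.mono_left nhdsWithin_le_nhds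

lemma isPeakedPeriodicWave (hμ : 0 < μ) (hm : m < c)
    (h : IsArchWave μ c (2 * μ * (m + c)) (-1) m φ x₀ T p) : IsPeakedPeriodicWave μ c m φ := by
  have hp := h.hasParameters rfl
  refine ⟨h.isTravelingWave, hp, h.isPeriodicWithCrests fun x hx => ?_,
    ⟨⟨p, h.value⟩, ?_⟩, ⟨x₀, h.apply_left⟩, ?_⟩
  · refine ⟨h.solves.continuous.continuousAt, h.smoothOnBothSides hx, √(2 * μ * (c - m)),
      Real.sqrt_pos.2 (mul_pos (by positivity) (sub_pos.2 hm)), ?_, ?_⟩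
    · simpa using tendsto_mul_deriv_nhds (e := - -1) hp (by norm_num) (h.tendsto_nhdsWithin hx _)
        (h.eventually_left hx)
    · simpa using (tendsto_mul_deriv_nhds (e := -1) hp (by norm_num) (h.tendsto_nhdsWithin hx _)
        (h.eventually_right hx)).neg
  · rintro _ ⟨x, rfl⟩
    linarith [(h.range_bounds x).2]
  · rintro _ ⟨x, rfl⟩
    linarith [(h.range_bounds x).1]

lemma isCuspedPeriodicWave (hμ : 0 < μ) (hM : c < M)
    (h : IsArchWave μ c (2 * μ * (m + M)) (-1) m φ x₀ T p) : IsCuspedPeriodicWave μ c m M φ := by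
  have hp := h.hasParameters rfl
  refine ⟨h.isTravelingWave, hp, h.isPeriodicWithCrests fun x hx => ?_,
    ⟨⟨p, h.value⟩, ?_⟩, ⟨x₀, h.apply_left⟩, ?_⟩
  · refine ⟨h.solves.continuous.continuousAt, h.smoothOnBothSides hx, ?_, ?_⟩
    · simpa using tendsto_mul_deriv_atTop (e := - -1) hμ hp h.ne_value hM.ne' (by norm_num)
        (h.tendsto_nhdsWithin hx _) (h.eventually_left hx)
    · have := tendsto_neg_atTop_atBot.comp (tendsto_mul_deriv_atTop (e := -1) hμ hp h.ne_value
        hM.ne' (by norm_num) (h.tendsto_nhdsWithin hx _) (h.eventually_right hx))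
      simpa [Function.comp_def] using this
  · rintro _ ⟨x, rfl⟩
    linarith [(h.range_bounds x).2]
  · rintro _ ⟨x, rfl⟩
    linarith [(h.range_bounds x).1]

lemma isAnticuspedPeriodicWave (hμ : 0 < μ) (hM : c < M)
    (h : IsArchWave μ c (2 * μ * (m + M)) 1 m φ x₀ T p) :
    IsAnticuspedPeriodicWave μ c m M φ := by
  have hp := h.hasParameters rfl
  refine ⟨h.isTravelingWave, hp, h.isPeriodicWithCrests fun x hx => ?_,
    ⟨⟨x₀, h.apply_left⟩, ?_⟩, ⟨p, h.value⟩, ?_⟩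
  · refine ⟨h.solves.continuous.continuousAt, h.smoothOnBothSides hx, ?_, ?_⟩
    · have := tendsto_neg_atTop_atBot.comp (tendsto_mul_deriv_atTop (e := -1) hμ hp h.ne_value
        hM.ne' (by norm_num) (h.tendsto_nhdsWithin hx _) (h.eventually_left hx))
      simpa [Function.comp_def] using this
    · simpa using tendsto_mul_deriv_atTop (e := 1) hμ hp h.ne_value hM.ne' (by norm_num)
        (h.tendsto_nhdsWithin hx _) (h.eventually_right hx)
  · rintro _ ⟨x, rfl⟩
    linarith [(h.range_bounds x).1]
  · rintro _ ⟨x, rfl⟩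
    linarith [(h.range_bounds x).2]

/-- A solution with isolated periodic crests and the same extremum is a translate. -/
theorem eq_translate (h : IsArchWave μ c a s m φ x₀ T p) {ψ : ℝ → ℝ} (hψ : SolvesOff μ c a ψ)
    {x₁ T' q : ℝ} (hT' : 0 < T') (hper : Function.Periodic ψ T')
    (hz : ∀ x, ψ x = c ↔ ∃ k : ℤ, x = x₁ + k * T') (hq : ψ q = m) (hq' : deriv ψ q = 0) (x : ℝ) :
    ψ x = φ (x + (p - q)) := by
  have hw := h.comp_add_const (p - q)
  set w : ℝ → ℝ := fun x => φ (x + (p - q)) with hwdef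
  rw [sub_sub_cancel] at hw
  set y₀ := x₀ - (p - q)
  have hT := hw.period_pos
  have e1 : EqOn w ψ (Ioo y₀ (y₀ + T)) :=
    hw.solves.eqOn hψ isPreconnected_Ioo hw.mem (fun y hy => hw.ne_of_mem hy)
      (hw.value.trans hq.symm) (hw.critical.trans hq'.symm)
  have e2 : EqOn w ψ (Icc y₀ (y₀ + T)) := by
    rw [← closure_Ioo (by linarith : y₀ ≠ y₀ + T)]
    exact e1.closure hw.solves.continuous hψ.continuous
  have z1 : ψ y₀ = c := by
    rw [← e2 (left_mem_Icc.2 (by linarith)), hw.apply_left]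
  have z2 : ψ (y₀ + T) = c := by
    rw [← e2 (right_mem_Icc.2 (by linarith)), hw.apply_right]
  obtain ⟨k, hk⟩ := (hz _).1 z1
  obtain ⟨k', hk'⟩ := (hz _).1 z2
  -- Both ends of the arch are crests of `ψ`, so `T` is an integer multiple of `T'`. A multiple
  -- above one would put the crest `y₀ + T'` inside the arch.
  have hTT : T = (k' - k) * T' := by linarith
  have hkk : k < k' := by
    have : (k : ℝ) < k' := by
      by_contra hcon
      nlinarith
    exact_mod_cast this
  have hkk' : ¬ k + 1 < k' := by
    intro hlt
    have hlt' : (k : ℝ) + 1 < k' := by exact_mod_cast hlt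
    have hm : y₀ + T' ∈ Ioo y₀ (y₀ + T) := ⟨by linarith, by rw [hTT]; nlinarith⟩
    refine hw.ne_of_mem hm ?_
    rw [e1 hm, hper, z1]
  have hTeq : T = T' := by
    have : k' = k + 1 := by omega
    rw [hTT, this]
    push_cast
    ring
  obtain ⟨n, hn⟩ := exists_int_add_mem_Ico hT x y₀
  have e3 := e2 (Ico_subset_Icc_self hn)
  rw [periodic_add_int hw.periodic, hTeq, periodic_add_int hper] at e3
  exact e3.symm

/-- Common frame for the peaked, cusped and anticusped families: a lattice of crests and one
critical point at height `m` are enough to pin down a wave. -/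
theorem existsUniqueUpToTranslation (h : IsArchWave μ c a s m φ x₀ T p) {P : (ℝ → ℝ) → Prop}
    (hP : ∀ φ x₀ T p, IsArchWave μ c a s m φ x₀ T p → P φ)
    (hP' : ∀ ψ, P ψ → SolvesOff μ c a ψ ∧ (∃ x₁ T', 0 < T' ∧ Function.Periodic ψ T' ∧
      ∀ x, ψ x = c ↔ ∃ k : ℤ, x = x₁ + k * T') ∧ ∃ q, ψ q = m ∧ deriv ψ q = 0) :
    ExistsUniqueUpToTranslation P := by
  refine ⟨φ, hP _ _ _ _ h, fun ψ => ⟨fun hψ => ?_, ?_⟩⟩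
  · obtain ⟨h1, ⟨x₁, T', h2, h3, h4⟩, q, h5, h6⟩ := hP' ψ hψ
    exact ⟨p - q, h.eq_translate h1 h2 h3 h4 h5 h6⟩
  · rintro ⟨t, ht⟩
    obtain rfl : ψ = fun x => φ (x + t) := funext ht
    exact hP _ _ _ _ (h.comp_add_const t)

/-- An arch wave takes every admissible pair of value and slope. -/
theorem exists_data (hμ : 0 < μ) (h : IsArchWave μ c a s m φ x₀ T p) (ha : a = 2 * μ * (m + M))
    (hs : s ^ 2 = 1)
    {v d : ℝ} (hv : v ∈ uIcc c m) (hvc : v ≠ c) (hvM : v ≠ M)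
    (hd : (c - v) * d ^ 2 = 2 * μ * (M - v) * (v - m)) :
    ∃ z, φ z = v ∧ deriv φ z = d := by
  have hp := h.hasParameters ha
  have hcv : c - v ≠ 0 := sub_ne_zero.2 hvc.symm
  by_cases hvm : v = m
  · refine ⟨p, h.value.trans hvm.symm, ?_⟩
    rw [h.critical]
    rw [hvm, sub_self, mul_zero] at hd
    have := (mul_eq_zero.1 hd).resolve_left (hvm ▸ hcv)
    exact (pow_eq_zero_iff two_ne_zero).1 this |>.symm
  have hd0 : d ≠ 0 := by
    rintro rfl
    have : 2 * μ * (M - v) * (v - m) ≠ 0 :=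
      mul_ne_zero (mul_ne_zero (by positivity) (sub_ne_zero.2 hvM.symm)) (sub_ne_zero.2 hvm)
    exact this (by rw [← hd]; ring)
  have hs0 : s ≠ 0 := by rintro rfl; norm_num at hs
  -- The parameter equation gives the slope up to sign; the two flanks of the arch supply the two
  -- signs.
  have key : ∀ z, φ z = v → 0 < (s * deriv φ z) * (s * d) → deriv φ z = d := by
    intro z hz hpos
    have e1 := hp.mul_sq (x := z) (by rwa [hz])
    rw [hz, ← hd] at e1
    rcases sq_eq_sq_iff_eq_or_eq_neg.1 (mul_left_cancel₀ hcv e1) with e2 | e2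
    · exact e2
    · rw [e2] at hpos
      nlinarith [mul_self_nonneg (s * d)]
  have hc := h.solves.continuous
  have hpm := h.mem
  rcases lt_or_gt_of_ne (mul_ne_zero hs0 hd0) with hsd | hsd
  · have := intermediate_value_uIcc (f := φ) (a := x₀ + T) (b := p) hc.continuousOn
    rw [h.apply_right, h.value, uIcc_of_ge hpm.2.le] at this
    obtain ⟨z, hz, hzv⟩ := this hv
    have hz1 : z ≠ p := by rintro rfl; exact hvm (hzv.symm.trans h.value)
    have hz2 : z ≠ x₀ + T := by rintro rfl; exact hvc (hzv.symm.trans h.apply_right)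
    refine ⟨z, hzv, key z hzv (mul_pos_of_neg_of_neg ?_ hsd)⟩
    exact h.sign_right z ⟨lt_of_le_of_ne hz.1 hz1.symm, lt_of_le_of_ne hz.2 hz2⟩
  · have := intermediate_value_uIcc (f := φ) (a := x₀) (b := p) hc.continuousOn
    rw [h.apply_left, h.value, uIcc_of_le hpm.1.le] at this
    obtain ⟨z, hz, hzv⟩ := this hv
    have hz1 : z ≠ p := by rintro rfl; exact hvm (hzv.symm.trans h.value)
    have hz2 : z ≠ x₀ := by rintro rfl; exact hvc (hzv.symm.trans h.apply_left)
    refine ⟨z, hzv, key z hzv (mul_pos ?_ hsd)⟩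
    exact h.sign_left z ⟨lt_of_le_of_ne hz.1 hz2.symm, lt_of_le_of_ne hz.2 hz1⟩

end IsArchWave


/-! ### Smooth periodic waves -/

lemma IsTravelingWave.continuous {μ c : ℝ} {φ : ℝ → ℝ} (h : IsTravelingWave μ c φ) :
    Continuous φ := by
  obtain ⟨g, hg, -⟩ := h
  exact hg.1

lemma deriv_eq_zero_of_isLeast {φ : ℝ → ℝ} {m q : ℝ} (h : IsLeast (range φ) m) (hq : φ q = m) :
    deriv φ q = 0 :=
  IsLocalMin.deriv_eq_zero (Eventually.of_forall fun x => by rw [hq]; exact h.2 ⟨x, rfl⟩)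

lemma deriv_eq_zero_of_isGreatest {φ : ℝ → ℝ} {m q : ℝ} (h : IsGreatest (range φ) m)
    (hq : φ q = m) : deriv φ q = 0 :=
  IsLocalMax.deriv_eq_zero (Eventually.of_forall fun x => by rw [hq]; exact h.2 ⟨x, rfl⟩)

lemma exists_apply_eq {φ : ℝ → ℝ} (hφ : Continuous φ) {x y v : ℝ} (hv : v ∈ uIcc (φ x) (φ y)) :
    ∃ z, φ z = v := by
  obtain ⟨z, -, hz⟩ := intermediate_value_uIcc hφ.continuousOn hv
  exact ⟨z, hz⟩

lemma add_div_two_mem_uIcc (x y : ℝ) : (x + y) / 2 ∈ uIcc x y := by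
  rw [mem_uIcc]
  rcases le_total x y with h | h
  · left; constructor <;> linarith
  · right; constructor <;> linarith

/-- A slope is determined by the parameters and its sign. -/
lemma HasParameters.deriv_eq {μ c m M d z : ℝ} {φ : ℝ → ℝ} (hp : HasParameters μ c m M φ)
    (hz : φ z ≠ c) (hd : (c - φ z) * d ^ 2 = 2 * μ * (M - φ z) * (φ z - m))
    (hs : 0 < deriv φ z * d) : deriv φ z = d := by
  have e1 := hp.mul_sq hz
  rw [← hd] at e1
  rcases sq_eq_sq_iff_eq_or_eq_neg.1 (mul_left_cancel₀ (sub_ne_zero.2 hz.symm) e1) with e2 | e2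
  · exact e2
  · rw [e2] at hs
    nlinarith [mul_self_nonneg d]

namespace IsSmoothArch

variable {μ c a m M x₀ T p : ℝ} {φ : ℝ → ℝ}

lemma comp_add_const (h : IsSmoothArch μ c a m M φ x₀ T p) (t : ℝ) :
    IsSmoothArch μ c a m M (fun x => φ (x + t)) (x₀ - t) T (p - t) := by
  have hd : ∀ x, deriv (fun x => φ (x + t)) x = deriv φ (x + t) :=
    fun x => _root_.deriv_comp_add_const φ t x
  refine ⟨h.solves.comp_add_const t, fun x => h.ne_height _, h.period_pos, fun x => ?_, ?_, ?_,
    ?_, ?_, fun x hx => ?_, fun x hx => ?_⟩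
  · rw [add_right_comm, h.periodic]
  · exact ⟨by linarith [h.mem.1], by linarith [h.mem.2]⟩
  · simp [h.value_left]
  · simp [h.value_mid]
  · simp [hd, h.critical]
  · rw [hd]
    exact h.sign_left _ ⟨by linarith [hx.1], by linarith [hx.2]⟩
  · rw [hd]
    exact h.sign_right _ ⟨by linarith [hx.1], by linarith [hx.2]⟩

lemma hasParameters (h : IsSmoothArch μ c a m M φ x₀ T p) (ha : a = 2 * μ * (m + M)) :
    HasParameters μ c m M φ := by
  refine h.solves.hasParameters_of_firstIntegral ha fun x _ => ?_
  rw [h.solves.firstIntegral_eq isOpen_univ isPreconnected_univ (fun y _ => h.ne_height y)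
    (mem_univ x) (mem_univ x₀), firstIntegral, h.critical, h.value_left, ha]
  ring

lemma apply_right (h : IsSmoothArch μ c a m M φ x₀ T p) : φ (x₀ + T) = m := by
  rw [h.periodic, h.value_left]

lemma range_bounds (h : IsSmoothArch μ c a m M φ x₀ T p) (x : ℝ) : m ≤ φ x ∧ φ x ≤ M := by
  have hp := h.mem
  have hc := h.solves.continuous.continuousOn (s := Icc x₀ p)
  have hc' := h.solves.continuous.continuousOn (s := Icc p (x₀ + T))
  have m1 : StrictMonoOn φ (Icc x₀ p) := strictMonoOn_of_deriv_pos (convex_Icc _ _) hc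
    fun x hx => h.sign_left x (by rwa [interior_Icc] at hx)
  have m2 : StrictAntiOn φ (Icc p (x₀ + T)) := strictAntiOn_of_deriv_neg (convex_Icc _ _) hc'
    fun x hx => h.sign_right x (by rwa [interior_Icc] at hx)
  obtain ⟨k, hk⟩ := exists_int_add_mem_Ico h.period_pos x x₀
  rw [← periodic_add_int h.periodic x k]
  set y := x + k * T
  have e1 := h.value_left
  have e2 := h.apply_right
  have e3 := h.value_mid
  rcases le_total y p with hy | hy
  · have h1 := m1.monotoneOn (left_mem_Icc.2 hp.1.le) ⟨hk.1, hy⟩ hk.1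
    have h2 := m1.monotoneOn ⟨hk.1, hy⟩ (right_mem_Icc.2 hp.1.le) hy
    constructor <;> linarith
  · have h1 := m2.antitoneOn (left_mem_Icc.2 hp.2.le) ⟨hy, hk.2.le⟩ hy
    have h2 := m2.antitoneOn ⟨hy, hk.2.le⟩ (right_mem_Icc.2 hp.2.le) hk.2.le
    constructor <;> linarith

lemma isSmoothPeriodicWave (h : IsSmoothArch μ c (2 * μ * (m + M)) m M φ x₀ T p) :
    IsSmoothPeriodicWave μ c m M φ := by
  refine ⟨h.solves.isTravelingWave (Or.inl ?_), h.hasParameters rfl, ?_,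
    ⟨T, h.period_pos, h.periodic⟩, ⟨⟨x₀, h.value_left⟩, ?_⟩, ⟨⟨p, h.value_mid⟩, ?_⟩⟩
  · have : {x | φ x = c} = ∅ := eq_empty_of_forall_notMem fun x hx => h.ne_height x hx
    simp [this]
  · have := h.solves.contDiffOn
    rwa [show {x | φ x ≠ c} = univ from eq_univ_of_forall h.ne_height, contDiffOn_univ] at this
  · rintro _ ⟨x, rfl⟩
    exact (h.range_bounds x).1
  · rintro _ ⟨x, rfl⟩
    exact (h.range_bounds x).2

lemma exists_data (h : IsSmoothArch μ c a m M φ x₀ T p)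
    (ha : a = 2 * μ * (m + M)) {v d : ℝ} (hv : v ∈ Icc m M)
    (hd : (c - v) * d ^ 2 = 2 * μ * (M - v) * (v - m)) : ∃ z, φ z = v ∧ deriv φ z = d := by
  have hp := h.hasParameters ha
  have hc := h.solves.continuous
  have hpm := h.mem
  obtain ⟨z₀, hz₀⟩ := exists_apply_eq hc (x := x₀) (y := p) (v := v) (by
    rw [h.value_left, h.value_mid]
    exact Icc_subset_uIcc hv)
  have hvc : v ≠ c := hz₀ ▸ h.ne_height z₀
  rcases eq_or_ne d 0 with rfl | hd0
  · refine ⟨z₀, hz₀, ?_⟩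
    have := hp.mul_sq (h.ne_height z₀)
    rw [hz₀, ← hd] at this
    have := mul_left_cancel₀ (sub_ne_zero.2 hvc.symm) this
    simpa using this
  have hne : 2 * μ * (M - v) * (v - m) ≠ 0 := by
    rw [← hd]
    exact mul_ne_zero (sub_ne_zero.2 hvc.symm) (pow_ne_zero 2 hd0)
  have hvm : v ≠ m := by rintro rfl; exact hne (by ring)
  have hvM : v ≠ M := by rintro rfl; exact hne (by ring)
  rcases lt_or_gt_of_ne hd0 with hsd | hsd
  · have := intermediate_value_uIcc (f := φ) (a := x₀ + T) (b := p) hc.continuousOn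
    rw [h.apply_right, h.value_mid, uIcc_of_ge hpm.2.le] at this
    obtain ⟨z, hz, hzv⟩ := this (Icc_subset_uIcc hv)
    have hz1 : z ≠ p := by rintro rfl; exact hvM (hzv.symm.trans h.value_mid)
    have hz2 : z ≠ x₀ + T := by rintro rfl; exact hvm (hzv.symm.trans h.apply_right)
    refine ⟨z, hzv, hp.deriv_eq (h.ne_height z) (by rw [hzv]; exact hd)
      (mul_pos_of_neg_of_neg ?_ hsd)⟩
    exact h.sign_right z ⟨lt_of_le_of_ne hz.1 hz1.symm, lt_of_le_of_ne hz.2 hz2⟩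
  · have := intermediate_value_uIcc (f := φ) (a := x₀) (b := p) hc.continuousOn
    rw [h.value_left, h.value_mid, uIcc_of_le hpm.1.le] at this
    obtain ⟨z, hz, hzv⟩ := this (Icc_subset_uIcc hv)
    have hz1 : z ≠ p := by rintro rfl; exact hvM (hzv.symm.trans h.value_mid)
    have hz2 : z ≠ x₀ := by rintro rfl; exact hvm (hzv.symm.trans h.value_left)
    refine ⟨z, hzv, hp.deriv_eq (h.ne_height z) (by rw [hzv]; exact hd) (mul_pos ?_ hsd)⟩
    exact h.sign_left z ⟨lt_of_le_of_ne hz.1 hz2.symm, lt_of_le_of_ne hz.2 hz1⟩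

end IsSmoothArch

/-! ### Existence and uniqueness up to translation of the periodic families -/

section Families

variable {μ c m M : ℝ}

theorem existsUnique_smooth (hμ : 0 < μ) (hm : m < M) (hM : M < c) :
    ExistsUniqueUpToTranslation (IsSmoothPeriodicWave μ c m M) := by
  obtain ⟨φ, x₀, T, p, h⟩ := exists_isSmoothArch hμ hm hM
  refine ⟨φ, h.isSmoothPeriodicWave, fun ψ => ⟨fun hψ => ?_, ?_⟩⟩
  · obtain ⟨q, hq⟩ := hψ.minimum.1
    obtain ⟨q', hq'⟩ := hψ.maximum.1
    have hlt : ∀ x, ψ x ≠ c := fun x => ((hψ.maximum.2 ⟨x, rfl⟩).trans_lt hM).ne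
    -- At the midpoint of `m` and `M` the slope is nonzero, which forces the constant `a = 2 μ (m +
    -- M)`.
    obtain ⟨z, hz⟩ := exists_apply_eq hψ.wave.continuous (add_div_two_mem_uIcc (ψ q) (ψ q'))
    rw [hq, hq'] at hz
    have hs := hψ.wave.solvesOff_of_hasParameters hμ hψ.parameters (x := z) (hlt z)
      (by rw [hz]; intro h; linarith) (by rw [hz]; intro h; linarith)
    have hw := h.comp_add_const (x₀ - q)
    have e := hs.eqOn hw.solves isPreconnected_univ (mem_univ q) (fun y _ => hlt y)
      (by simp [hq, h.value_left]) (by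
        have e1 := hw.critical
        rw [sub_sub_cancel] at e1
        rw [e1, deriv_eq_zero_of_isLeast hψ.minimum hq])
    exact ⟨x₀ - q, fun x => e (mem_univ x)⟩
  · rintro ⟨t, ht⟩
    obtain rfl : ψ = fun x => φ (x + t) := funext ht
    exact (h.comp_add_const t).isSmoothPeriodicWave

theorem existsUnique_peaked (hμ : 0 < μ) (hm : m < c) :
    ExistsUniqueUpToTranslation (IsPeakedPeriodicWave μ c m) := by
  obtain ⟨φ, x₀, T, p, h⟩ := exists_isArchWave_below hμ hm le_rfl
  refine h.existsUniqueUpToTranslation (fun φ x₀ T p h => h.isPeakedPeriodicWave hμ hm)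
    fun ψ hψ => ?_
  obtain ⟨q, hq⟩ := hψ.minimum.1
  obtain ⟨q', hq'⟩ := hψ.maximum.1
  obtain ⟨z, hz⟩ := exists_apply_eq hψ.wave.continuous (add_div_two_mem_uIcc (ψ q) (ψ q'))
  rw [hq, hq'] at hz
  refine ⟨hψ.wave.solvesOff_of_hasParameters hμ hψ.parameters (x := z) ?_ ?_ ?_, ?_, q, hq,
    deriv_eq_zero_of_isLeast hψ.minimum hq⟩
  iterate 3 (rw [hz]; intro h; linarith)
  obtain ⟨x₁, T', h1, h2, h3, -⟩ := hψ.peaks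
  exact ⟨x₁, T', h1, h2, h3⟩

theorem existsUnique_cusped (hμ : 0 < μ) (hm : m < c) (hM : c < M) :
    ExistsUniqueUpToTranslation (IsCuspedPeriodicWave μ c m M) := by
  obtain ⟨φ, x₀, T, p, h⟩ := exists_isArchWave_below hμ hm hM.le
  refine h.existsUniqueUpToTranslation (fun φ x₀ T p h => h.isCuspedPeriodicWave hμ hM)
    fun ψ hψ => ?_
  obtain ⟨q, hq⟩ := hψ.minimum.1
  obtain ⟨q', hq'⟩ := hψ.maximum.1
  obtain ⟨z, hz⟩ := exists_apply_eq hψ.wave.continuous (add_div_two_mem_uIcc (ψ q) (ψ q'))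
  rw [hq, hq'] at hz
  refine ⟨hψ.wave.solvesOff_of_hasParameters hμ hψ.parameters (x := z) ?_ ?_ ?_, ?_, q, hq,
    deriv_eq_zero_of_isLeast hψ.minimum hq⟩
  iterate 3 (rw [hz]; intro h; linarith)
  obtain ⟨x₁, T', h1, h2, h3, -⟩ := hψ.cusps
  exact ⟨x₁, T', h1, h2, h3⟩

theorem existsUnique_anticusped (hμ : 0 < μ) (hm : c < m) (hM : m < M) :
    ExistsUniqueUpToTranslation (IsAnticuspedPeriodicWave μ c m M) := by
  obtain ⟨φ, x₀, T, p, h⟩ := exists_isArchWave_above hμ hm hM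
  refine h.existsUniqueUpToTranslation
    (fun φ x₀ T p h => h.isAnticuspedPeriodicWave hμ (hm.trans hM)) fun ψ hψ => ?_
  obtain ⟨q, hq⟩ := hψ.maximum.1
  obtain ⟨q', hq'⟩ := hψ.minimum.1
  obtain ⟨z, hz⟩ := exists_apply_eq hψ.wave.continuous (add_div_two_mem_uIcc (ψ q) (ψ q'))
  rw [hq, hq'] at hz
  refine ⟨hψ.wave.solvesOff_of_hasParameters hμ hψ.parameters (x := z) ?_ ?_ ?_, ?_, q, hq,
    deriv_eq_zero_of_isGreatest hψ.maximum hq⟩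
  iterate 3 (rw [hz]; intro h; linarith)
  obtain ⟨x₁, T', h1, h2, h3, -⟩ := hψ.anticusps
  exact ⟨x₁, T', h1, h2, h3⟩

end Families

/-! ### Anticusped waves on the line -/

namespace IsLineArch

variable {μ c a m x₀ : ℝ} {φ : ℝ → ℝ}

lemma comp_add_const (h : IsLineArch μ c a m φ x₀) (t : ℝ) :
    IsLineArch μ c a m (fun x => φ (x + t)) (x₀ - t) := by
  have hd : ∀ x, deriv (fun x => φ (x + t)) x = deriv φ (x + t) :=
    fun x => _root_.deriv_comp_add_const φ t x
  refine ⟨h.solves.comp_add_const t, fun x hx => ?_, fun x => ?_, fun x => h.lt _,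
    fun x hx => ?_, fun x hx => ?_, h.limit_right.comp (tendsto_atTop_add_const_right _ t tendsto_id),
    h.limit_left.comp (tendsto_atBot_add_const_right _ t tendsto_id)⟩
  · rw [hd]
    exact ⟨(h.solves.comp_add_const t).differentiableAt x hx, (h.parameters _ hx).2⟩
  · rw [h.zeros]
    exact ⟨fun e => by linarith, fun e => by linarith⟩
  · rw [hd]
    exact h.sign_left _ (by linarith)
  · rw [hd]
    exact h.sign_right _ (by linarith)

lemma apply_crest (h : IsLineArch μ c a m φ x₀) : φ x₀ = c := (h.zeros x₀).2 rfl

lemma le (h : IsLineArch μ c a m φ x₀) (x : ℝ) : c ≤ φ x := by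
  have hc := h.solves.continuous
  rcases le_total x₀ x with hx | hx
  · have : MonotoneOn φ (Ici x₀) := monotoneOn_of_deriv_nonneg (convex_Ici _) hc.continuousOn
      (fun y hy => by
        rw [interior_Ici] at hy
        exact (h.solves.differentiableAt y fun e =>
          (ne_of_gt hy) ((h.zeros y).1 e)).differentiableWithinAt)
      fun y hy => (h.sign_right y (by rwa [interior_Ici] at hy)).le
    rw [← h.apply_crest]
    exact this self_mem_Ici hx hx
  · have : AntitoneOn φ (Iic x₀) := antitoneOn_of_deriv_nonpos (convex_Iic _) hc.continuousOn
      (fun y hy => by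
        rw [interior_Iic] at hy
        exact (h.solves.differentiableAt y fun e =>
          (ne_of_lt hy) ((h.zeros y).1 e)).differentiableWithinAt)
      fun y hy => (h.sign_left y (by rwa [interior_Iic] at hy)).le
    rw [← h.apply_crest]
    exact this hx self_mem_Iic hx

lemma isAnticuspedLineWave (hμ : 0 < μ) (hm : c < m) (h : IsLineArch μ c a m φ x₀) :
    IsAnticuspedLineWave μ c m φ := by
  have hc := h.solves.continuous
  have ht : ∀ s, Tendsto φ (𝓝[s] x₀) (𝓝 c) := fun s => by
    rw [← h.apply_crest]
    exact hc.continuousAt.tendsto.mono_left nhdsWithin_le_nhds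
  have hne : ∀ x, x ≠ x₀ → φ x ≠ c := fun x hx e => hx ((h.zeros x).1 e)
  have vol : volume {x | φ x = c} = 0 := by
    have : {x | φ x = c} = {x₀} := by ext x; simp [h.zeros]
    simp [this]
  refine ⟨h.solves.isTravelingWave (Or.inl vol), h.parameters, h.solves.contDiffOn,
    ⟨x₀, h.zeros, hc.continuousAt, ⟨1, one_pos, ?_, ?_⟩, ?_, ?_⟩, ⟨⟨x₀, h.apply_crest⟩, ?_⟩,
    ⟨?_, ?_⟩, h.limit_right, h.limit_left⟩
  · exact h.solves.contDiffOn.mono fun x hx => hne x hx.2.ne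
  · exact h.solves.contDiffOn.mono fun x hx => hne x hx.1.ne'
  · have := tendsto_neg_atTop_atBot.comp (tendsto_mul_deriv_atTop (e := -1) hμ h.parameters
      hm.ne' hm.ne' (by norm_num) (ht (Iio x₀)) (by
        filter_upwards [self_mem_nhdsWithin] with x hx
        exact ⟨hne x (ne_of_lt hx), by linarith [h.sign_left x hx]⟩))
    simpa [Function.comp_def] using this
  · simpa using tendsto_mul_deriv_atTop (e := 1) hμ h.parameters
      hm.ne' hm.ne' (by norm_num) (ht (Ioi x₀)) (by
        filter_upwards [self_mem_nhdsWithin] with x hx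
        exact ⟨hne x (ne_of_gt hx), by linarith [h.sign_right x hx]⟩)
  · rintro _ ⟨x, rfl⟩
    exact h.le x
  · rintro _ ⟨x, rfl⟩
    exact (h.lt x).le
  · intro b hb
    exact le_of_tendsto h.limit_right (Eventually.of_forall fun x => hb ⟨x, rfl⟩)

lemma exists_data (hμ : 0 < μ) (h : IsLineArch μ c a m φ x₀) {v d : ℝ} (hv : v ∈ Ioo c m)
    (hd : (c - v) * d ^ 2 = 2 * μ * (m - v) * (v - m)) : ∃ z, φ z = v ∧ deriv φ z = d := by
  have hc := h.solves.continuous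
  have hd0 : d ≠ 0 := by
    rintro rfl
    have : 2 * μ * (m - v) * (v - m) ≠ 0 :=
      mul_ne_zero (mul_ne_zero (by positivity) (sub_pos.2 hv.2).ne') (sub_neg.2 hv.2).ne
    exact this (by rw [← hd]; ring)
  rcases lt_or_gt_of_ne hd0 with hsd | hsd
  · obtain ⟨y, hy, hy'⟩ := ((h.limit_left.eventually_const_lt hv.2).and
      (eventually_lt_atBot x₀)).exists
    obtain ⟨z, hz, hzv⟩ := intermediate_value_Icc' hy'.le hc.continuousOn
      (show v ∈ Icc (φ x₀) (φ y) from ⟨h.apply_crest.le.trans hv.1.le, hy.le⟩)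
    have hzx : z ≠ x₀ := by rintro rfl; exact hv.1.ne' (hzv.symm.trans h.apply_crest)
    refine ⟨z, hzv, h.parameters.deriv_eq (by rw [hzv]; exact hv.1.ne') (by rw [hzv]; exact hd)
      (mul_pos_of_neg_of_neg (h.sign_left z (lt_of_le_of_ne hz.2 hzx)) hsd)⟩
  · obtain ⟨y, hy, hy'⟩ := ((h.limit_right.eventually_const_lt hv.2).and
      (eventually_gt_atTop x₀)).exists
    obtain ⟨z, hz, hzv⟩ := intermediate_value_Icc hy'.le hc.continuousOn
      (show v ∈ Icc (φ x₀) (φ y) from ⟨h.apply_crest.le.trans hv.1.le, hy.le⟩)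
    have hzx : z ≠ x₀ := by rintro rfl; exact hv.1.ne' (hzv.symm.trans h.apply_crest)
    refine ⟨z, hzv, h.parameters.deriv_eq (by rw [hzv]; exact hv.1.ne') (by rw [hzv]; exact hd)
      (mul_pos (h.sign_right z (lt_of_le_of_ne hz.1 hzx.symm)) hsd)⟩

/-- A solution that agrees with a translate of a line arch near a point on one side of its crest
has its crest at the corresponding point and agrees on the whole side. -/
lemma eqOn_side (hμ : 0 < μ) (h : IsLineArch μ c a m φ x₀) {ψ : ℝ → ℝ} (hψ : SolvesOff μ c a ψ)
    (hp : HasParameters μ c m m ψ) (hle : ∀ x, c ≤ ψ x ∧ ψ x ≤ m) {x₁ ξ : ℝ} {s : Set ℝ}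
    (hs : IsPreconnected s) (hξ : ξ ∈ s) (hx₁ : x₁ ∈ closure s) (hc : ψ x₁ = c)
    (hne : ∀ x ∈ s, ψ x ≠ c) (hd : deriv ψ ξ ≠ 0) :
    EqOn ψ (fun x => φ (x + (x₀ - x₁))) s := by
  have e0 := hp.mul_sq (hne ξ hξ)
  have hm : ψ ξ ≠ m := by
    intro e
    rw [e, sub_self, mul_zero] at e0
    rcases mul_eq_zero.1 e0 with e1 | e1
    · exact hne ξ hξ (by linarith)
    · exact hd ((pow_eq_zero_iff two_ne_zero).1 e1)
  obtain ⟨z, hz, hz'⟩ := h.exists_data hμ (v := ψ ξ) (d := deriv ψ ξ)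
    ⟨lt_of_le_of_ne (hle ξ).1 (hne ξ hξ).symm, lt_of_le_of_ne (hle ξ).2 hm⟩ e0
  have hw := h.comp_add_const (z - ξ)
  have e1 : EqOn ψ (fun x => φ (x + (z - ξ))) s := by
    refine hψ.eqOn hw.solves hs hξ hne (by simp [hz]) ?_
    rw [_root_.deriv_comp_add_const, add_sub_cancel, hz']
  have e2 := e1.closure hψ.continuous hw.solves.continuous hx₁
  have e3 : x₁ = x₀ - (z - ξ) := (hw.zeros x₁).1 (by rw [← hc]; exact e2.symm)
  have e4 : z - ξ = x₀ - x₁ := by linarith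
  rwa [e4] at e1

end IsLineArch

lemma exists_deriv_ne_zero {ψ : ℝ → ℝ} {x y : ℝ} (hc : Continuous ψ) (hxy : x < y)
    (hd : ∀ z ∈ Ioo x y, DifferentiableAt ℝ ψ z) (h : ψ x ≠ ψ y) :
    ∃ z ∈ Ioo x y, deriv ψ z ≠ 0 := by
  obtain ⟨z, hz, e⟩ := exists_deriv_eq_slope ψ hxy hc.continuousOn
    fun z hz => (hd z hz).differentiableWithinAt
  refine ⟨z, hz, ?_⟩
  rw [e]
  exact div_ne_zero (sub_ne_zero.2 h.symm) (sub_ne_zero.2 hxy.ne')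

/-- There is no critical point to start from, and ODE uniqueness does not cross the crest. Each side
is matched on its own from a point of nonzero slope; the crest fixes the same translation for both.
-/
theorem existsUnique_line {μ c m : ℝ} (hμ : 0 < μ) (hm : c < m) :
    ExistsUniqueUpToTranslation (IsAnticuspedLineWave μ c m) := by
  obtain ⟨φ, x₀, h⟩ := exists_isLineArch hμ hm
  refine ⟨φ, h.isAnticuspedLineWave hμ hm, fun ψ => ⟨fun hψ => ?_, ?_⟩⟩
  · obtain ⟨x₁, hz, -⟩ := hψ.anticusp
    have hcψ := hψ.wave.continuous
    have hx₁ : ψ x₁ = c := (hz x₁).2 rfl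
    have hlt : (c + m) / 2 < m := by linarith
    obtain ⟨y, hy, hy'⟩ := ((hψ.limit_right.eventually_const_lt hlt).and
      (eventually_gt_atTop x₁)).exists
    obtain ⟨y₂, hy₂, hy₂'⟩ := ((hψ.limit_left.eventually_const_lt hlt).and
      (eventually_lt_atBot x₁)).exists
    obtain ⟨z, hzv⟩ := exists_apply_eq hcψ (x := x₁) (y := y) (v := (c + m) / 2) (by
      rw [hx₁]
      exact Icc_subset_uIcc ⟨by linarith, hy.le⟩)
    have hs : SolvesOff μ c (2 * μ * (m + m)) ψ :=
      hψ.wave.solvesOff_of_hasParameters hμ hψ.parameters (x := z)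
        (by rw [hzv]; intro h; linarith) (by rw [hzv]; intro h; linarith)
        (by rw [hzv]; intro h; linarith)
    have hle : ∀ x, c ≤ ψ x ∧ ψ x ≤ m := fun x =>
      ⟨hψ.minimum.2 ⟨x, rfl⟩, hψ.supremum.1 ⟨x, rfl⟩⟩
    have hne : ∀ x, x ≠ x₁ → ψ x ≠ c := fun x hx e => hx ((hz x).1 e)
    obtain ⟨ξ, hξ, hξ'⟩ := exists_deriv_ne_zero hcψ hy'
      (fun z hz => hs.differentiableAt z (hne z hz.1.ne')) (by rw [hx₁]; intro h; linarith)
    obtain ⟨ξ₂, hξ₂, hξ₂'⟩ := exists_deriv_ne_zero hcψ hy₂'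
      (fun z hz => hs.differentiableAt z (hne z hz.2.ne)) (by rw [hx₁]; intro h; linarith)
    have r := h.eqOn_side hμ hs hψ.parameters hle isPreconnected_Ioi (s := Ioi x₁) hξ.1
      (by rw [closure_Ioi]; exact self_mem_Ici) hx₁ (fun x hx => hne x (ne_of_gt hx)) hξ'
    have l := h.eqOn_side hμ hs hψ.parameters hle isPreconnected_Iio (s := Iio x₁) hξ₂.2
      (by rw [closure_Iio]; exact self_mem_Iic) hx₁ (fun x hx => hne x (ne_of_lt hx)) hξ₂'
    refine ⟨x₀ - x₁, fun x => ?_⟩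
    rcases lt_trichotomy x x₁ with hx | hx | hx
    · exact l hx
    · rw [hx, hx₁, add_sub_cancel, h.apply_crest]
    · exact r hx
  · rintro ⟨t, ht⟩
    obtain rfl : ψ = fun x => φ (x + t) := funext ht
    exact (h.comp_add_const t).isAnticuspedLineWave hμ hm


/-! ### Elementary waves -/

section Elementary

variable {μ c m M : ℝ} {w : ℝ → ℝ}

/-- In all four cases the value `(c + m) / 2` is attained and differs from `c`, `m` and `M`, so the
slope there is nonzero and determines the constant. -/
lemma IsElementaryWave.solvesOff (hμ : 0 < μ) (h : IsElementaryWave μ c m M w) :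
    SolvesOff μ c (2 * μ * (m + M)) w := by
  have key : ∀ {x y}, IsTravelingWave μ c w → HasParameters μ c m M w → m ≠ c →
      (c + m) / 2 ≠ M → (c + m) / 2 ∈ uIcc (w x) (w y) → SolvesOff μ c (2 * μ * (m + M)) w := by
    intro x y hw hp h1 h2 h3
    obtain ⟨z, hz⟩ := exists_apply_eq hw.continuous h3
    exact hw.solvesOff_of_hasParameters hμ hp (x := z) (by rw [hz]; intro h; apply h1; linarith)
      (by rw [hz]; intro h; apply h1; linarith) (by rwa [hz])
  rcases h with ⟨h1, rfl, h⟩ | ⟨h1, h2, h⟩ | ⟨h1, h2, h⟩ | ⟨h1, rfl, h⟩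
  · obtain ⟨q, hq⟩ := h.minimum.1
    obtain ⟨q', hq'⟩ := h.maximum.1
    exact key (x := q') (y := q) h.wave h.parameters h1.ne (by intro h; linarith)
      (by rw [hq, hq']; exact add_div_two_mem_uIcc _ _)
  · obtain ⟨q, hq⟩ := h.minimum.1
    obtain ⟨q', hq'⟩ := h.maximum.1
    exact key (x := q') (y := q) h.wave h.parameters h1.ne (by intro h; linarith)
      (by rw [hq, hq']; exact add_div_two_mem_uIcc _ _)
  · obtain ⟨q, hq⟩ := h.minimum.1
    obtain ⟨q', hq'⟩ := h.maximum.1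
    exact key (x := q) (y := q') h.wave h.parameters h1.ne' (by intro h; linarith)
      (by rw [hq, hq']; exact add_div_two_mem_uIcc _ _)
  · obtain ⟨q, hq⟩ := h.minimum.1
    have hlt : (c + m) / 2 < m := by linarith
    obtain ⟨y, hy⟩ := (h.limit_right.eventually_const_lt hlt).exists
    exact key (x := q) (y := y) h.wave h.parameters h1.ne' hlt.ne
      (by rw [hq]; exact Icc_subset_uIcc ⟨by linarith, hy.le⟩)

lemma IsElementaryWave.ne (h : IsElementaryWave μ c m M w) : m ≠ c := by
  rcases h with ⟨h1, -, -⟩ | ⟨h1, -, -⟩ | ⟨h1, -, -⟩ | ⟨h1, -, -⟩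
  exacts [h1.ne, h1.ne, h1.ne', h1.ne']

lemma IsElementaryWave.hasParameters (h : IsElementaryWave μ c m M w) :
    HasParameters μ c m M w := by
  rcases h with ⟨-, rfl, h⟩ | ⟨-, -, h⟩ | ⟨-, -, h⟩ | ⟨-, rfl, h⟩
  exacts [h.parameters, h.parameters, h.parameters, h.parameters]

lemma IsElementaryWave.mem_uIcc (h : IsElementaryWave μ c m M w) (x : ℝ) : w x ∈ uIcc c m := by
  rw [Set.mem_uIcc]
  rcases h with ⟨-, rfl, h⟩ | ⟨-, -, h⟩ | ⟨-, -, h⟩ | ⟨-, rfl, h⟩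
  · exact Or.inr ⟨h.minimum.2 ⟨x, rfl⟩, h.maximum.2 ⟨x, rfl⟩⟩
  · exact Or.inr ⟨h.minimum.2 ⟨x, rfl⟩, h.maximum.2 ⟨x, rfl⟩⟩
  · exact Or.inl ⟨h.minimum.2 ⟨x, rfl⟩, h.maximum.2 ⟨x, rfl⟩⟩
  · exact Or.inl ⟨h.minimum.2 ⟨x, rfl⟩, h.supremum.1 ⟨x, rfl⟩⟩

/-- An elementary wave either has periodic crests and attains its other extremum, or it has
exactly one crest. -/
lemma IsElementaryWave.crests (h : IsElementaryWave μ c m M w) :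
    ((∃ q, w q = m) ∧ ∃ x₁ T : ℝ, 0 < T ∧ ∀ x, w x = c ↔ ∃ k : ℤ, x = x₁ + k * T) ∨
      ∃ x₁, ∀ x, w x = c ↔ x = x₁ := by
  rcases h with ⟨-, rfl, h⟩ | ⟨-, -, h⟩ | ⟨-, -, h⟩ | ⟨-, rfl, h⟩
  · obtain ⟨x₁, T, h1, -, h2, -⟩ := h.peaks
    exact Or.inl ⟨h.minimum.1, x₁, T, h1, h2⟩
  · obtain ⟨x₁, T, h1, -, h2, -⟩ := h.cusps
    exact Or.inl ⟨h.minimum.1, x₁, T, h1, h2⟩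
  · obtain ⟨x₁, T, h1, -, h2, -⟩ := h.anticusps
    exact Or.inl ⟨h.maximum.1, x₁, T, h1, h2⟩
  · obtain ⟨x₁, h1, -⟩ := h.anticusp
    exact Or.inr ⟨x₁, h1⟩

/-- A bound for `|φ - c| φ'²` on an elementary wave with parameters of sum `S` and amplitude
`d`. -/
noncomputable def slopeBound (μ c S d : ℝ) : ℝ := 2 * μ * (|S - 2 * c| + 2 * d) * d

/-- Bound both factors of `2 μ |M - w| |w - m|`, writing `M - w = (m + M - 2 c) - (m - c) - (w -
c)`. Only the sum and the amplitude appear, because a composite wave fixes only the sum. -/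
lemma IsElementaryWave.abs_mul_sq_le (hμ : 0 < μ) (h : IsElementaryWave μ c m M w) {x : ℝ}
    (hx : w x ≠ c) : |w x - c| * deriv w x ^ 2 ≤ slopeBound μ c (m + M) |m - c| := by
  have e1 := congrArg abs (h.hasParameters.mul_sq hx)
  rw [abs_mul, abs_of_nonneg (sq_nonneg (deriv w x)), abs_sub_comm] at e1
  rw [e1, abs_mul, abs_mul, abs_of_pos (by positivity : 0 < 2 * μ), slopeBound]
  have hm := h.mem_uIcc x
  have b1 : |w x - m| ≤ |m - c| := abs_sub_right_of_mem_uIcc hm |>.trans_eq' (abs_sub_comm _ _)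
  have b2 : |w x - c| ≤ |m - c| := abs_sub_left_of_mem_uIcc hm
  have b3 : |M - w x| ≤ |m + M - 2 * c| + 2 * |m - c| := by
    have : M - w x = (m + M - 2 * c) - (m - c) - (w x - c) := by ring
    rw [this]
    have t1 := abs_sub ((m + M - 2 * c) - (m - c)) (w x - c)
    have t2 := abs_sub (m + M - 2 * c) (m - c)
    linarith
  have h2 : 0 ≤ 2 * μ := by positivity
  have h3 : 0 ≤ |m + M - 2 * c| + 2 * |m - c| := by positivity
  exact mul_le_mul (mul_le_mul_of_nonneg_left b3 h2) b1 (abs_nonneg _) (mul_nonneg h2 h3)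

end Elementary

/-! ### Hölder estimate near the singular height -/

/-- Off the height `c`, `|w - c|^(3/2)` has slope at most `(3/2) √K`. Apply the mean value theorem
from the last zero before `y` and square. -/
lemma abs_pow_three_le_of_lt {c K : ℝ} {w : ℝ → ℝ} (hw : Continuous w)
    (hd : ∀ x, w x ≠ c → DifferentiableAt ℝ w x ∧ |w x - c| * deriv w x ^ 2 ≤ K)
    (hK : 0 ≤ K) {x y : ℝ} (hxy : x ≤ y) (hx : w x = c) :
    |w y - c| ^ 3 ≤ 9 / 4 * K * (y - x) ^ 2 := by
  by_cases hy : w y = c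
  · simp only [hy, sub_self, abs_zero, zero_pow three_ne_zero]
    positivity
  have hcomp : IsCompact (Icc x y ∩ {t | w t = c}) :=
    isCompact_Icc.inter_right (isClosed_eq hw continuous_const)
  obtain ⟨x', ⟨hx'm, hx'c⟩, hx'⟩ := hcomp.exists_isGreatest ⟨x, left_mem_Icc.2 hxy, hx⟩
  have hlt : x' < y := lt_of_le_of_ne hx'm.2 (by rintro rfl; exact hy hx'c)
  have hne : ∀ t ∈ Ioc x' y, w t ≠ c := fun t ht e =>
    absurd (hx' ⟨⟨hx'm.1.trans ht.1.le, ht.2⟩, e⟩) (not_le.2 ht.1)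
  -- This is `|w - c|^(3/2)`, written so that it can be differentiated without a case split on the
  -- sign.
  set f : ℝ → ℝ := fun t => ((w t - c) ^ 2) ^ (3 / 4 : ℝ) with hf
  have hfd : ∀ t ∈ Ioo x' y, HasDerivAt f
      (2 * (w t - c) * deriv w t * (3 / 4) * ((w t - c) ^ 2) ^ ((3 / 4 : ℝ) - 1)) t := by
    intro t ht
    have h1 := (((hd t (hne t ⟨ht.1, ht.2.le⟩)).1.hasDerivAt.sub_const c).pow 2).rpow_const
      (p := 3 / 4) (Or.inl (pow_ne_zero 2 (sub_ne_zero.2 (hne t ⟨ht.1, ht.2.le⟩))))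
    refine h1.congr_deriv ?_
    simp
  have hfc : ContinuousOn f (Icc x' y) :=
    Continuous.continuousOn (((hw.sub continuous_const).pow 2).rpow_const
      fun t => Or.inr (by norm_num))
  obtain ⟨ξ, hξ, e⟩ := exists_hasDerivAt_eq_slope f _ hlt hfc hfd
  have hξc := hne ξ ⟨hξ.1, hξ.2.le⟩
  have hpos : 0 < |w ξ - c| := abs_pos.2 (sub_ne_zero.2 hξc)
  have sq_rpow : ∀ (s r : ℝ), (s ^ 2) ^ r = |s| ^ (2 * r) := fun s r => by
    rw [← sq_abs, ← Real.rpow_natCast, ← Real.rpow_mul (abs_nonneg s)]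
    norm_num
  have fx' : f x' = 0 := by
    have hx'c : w x' = c := hx'c
    simp only [hf, hx'c, sub_self]
    rw [zero_pow two_ne_zero, Real.zero_rpow (by norm_num)]
  have fy : f y ^ 2 = |w y - c| ^ 3 := by
    simp only [hf]
    rw [sq_rpow, ← Real.rpow_natCast, ← Real.rpow_mul (abs_nonneg _), ← Real.rpow_natCast]
    norm_num
  rw [fx', sub_zero, eq_div_iff (sub_pos.2 hlt).ne'] at e
  rw [← fy, ← e, mul_pow]
  have e2 : (2 * (w ξ - c) * deriv w ξ * (3 / 4) * ((w ξ - c) ^ 2) ^ ((3 / 4 : ℝ) - 1)) ^ 2 =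
      9 / 4 * (|w ξ - c| * deriv w ξ ^ 2) := by
    have e3 : (((w ξ - c) ^ 2) ^ ((3 / 4 : ℝ) - 1)) ^ 2 = |w ξ - c|⁻¹ := by
      rw [sq_rpow, ← Real.rpow_natCast, ← Real.rpow_mul hpos.le, ← Real.rpow_neg_one]
      norm_num
    rw [mul_pow, e3, mul_pow, mul_pow, mul_pow, ← sq_abs (w ξ - c)]
    field_simp
    ring
  rw [e2]
  have h1 := (hd ξ hξc).2
  have h2 : (y - x') ^ 2 ≤ (y - x) ^ 2 :=
    pow_le_pow_left₀ (sub_pos.2 hlt).le (by linarith [hx'm.1]) 2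
  have h3 : 0 ≤ |w ξ - c| * deriv w ξ ^ 2 := by positivity
  gcongr

lemma abs_pow_three_le {c K : ℝ} {w : ℝ → ℝ} (hw : Continuous w)
    (hd : ∀ x, w x ≠ c → DifferentiableAt ℝ w x ∧ |w x - c| * deriv w x ^ 2 ≤ K)
    (hK : 0 ≤ K) {x y : ℝ} (hx : w x = c) : |w y - c| ^ 3 ≤ 9 / 4 * K * (y - x) ^ 2 := by
  rcases le_total x y with h | h
  · exact abs_pow_three_le_of_lt hw hd hK h hx
  · have := abs_pow_three_le_of_lt (w := fun t => w (-t)) (c := c) (K := K) (by fun_prop)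
      (fun t ht => ⟨(hd (-t) ht).1.comp t differentiableAt_id.neg, by
        rw [deriv_comp_neg, neg_sq]; exact (hd (-t) ht).2⟩) hK (neg_le_neg h) (by simpa using hx)
    simp only [neg_neg] at this
    rwa [show (-y - -x) ^ 2 = (y - x) ^ 2 by ring] at this

lemma IsElementaryWave.abs_pow_three_le {μ c m M : ℝ} {w : ℝ → ℝ} (hμ : 0 < μ)
    (h : IsElementaryWave μ c m M w) {x y : ℝ} (hx : w x = c) :
    |w y - c| ^ 3 ≤ 9 / 4 * slopeBound μ c (m + M) |m - c| * (y - x) ^ 2 :=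
  MuHS.abs_pow_three_le (h.solvesOff hμ).continuous
    (fun _ ht => ⟨(h.solvesOff hμ).differentiableAt _ ht, h.abs_mul_sq_le hμ ht⟩)
    (by unfold slopeBound; positivity) hx

/-! ### Composite waves -/

section Composite

variable {μ c S : ℝ} {φ : ℝ → ℝ}

/-- If `x` is outside the component of `y` in `{w ≠ c}`, the height `c` is attained between. -/
lemma exists_zero_mem_uIcc {w : ℝ → ℝ} {x y : ℝ}
    (hx : x ∉ connectedComponentIn {t | w t ≠ c} y) : ∃ z ∈ uIcc x y, w z = c := by
  by_contra! hcon
  exact hx (isPreconnected_uIcc.subset_connectedComponentIn right_mem_uIcc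
    (fun t ht => hcon t ht) left_mem_uIcc)

lemma IsElementaryWave.abs_pow_three_le_of_notMem {m M : ℝ} {w : ℝ → ℝ} (hμ : 0 < μ)
    (h : IsElementaryWave μ c m M w) {x y : ℝ}
    (hx : x ∉ connectedComponentIn {t | w t ≠ c} y) :
    |w y - c| ^ 3 ≤ 9 / 4 * slopeBound μ c (m + M) |m - c| * (y - x) ^ 2 := by
  obtain ⟨z, hz, hzc⟩ := exists_zero_mem_uIcc hx
  have h1 := h.abs_pow_three_le hμ (y := y) hzc
  have h2 : (y - z) ^ 2 ≤ (y - x) ^ 2 := sq_le_sq.2 (by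
    rw [abs_sub_comm y z, abs_sub_comm y x]
    exact abs_sub_right_of_mem_uIcc hz |>.trans_eq' (abs_sub_comm _ _) |>.trans_eq
      (abs_sub_comm _ _))
  have h3 : 0 ≤ 9 / 4 * slopeBound μ c (m + M) |m - c| := by unfold slopeBound; positivity
  exact h1.trans (mul_le_mul_of_nonneg_left h2 h3)

/-- The amplitude of an elementary wave with a short component is bounded in terms of the sum
of the parameters. -/
lemma IsElementaryWave.amplitude_le {m M : ℝ} {w : ℝ → ℝ} (hμ : 0 < μ)
    (h : IsElementaryWave μ c m M w) {x y : ℝ} (hy : w y ≠ c) (hyx : y ∈ Ioo (x - 1) (x + 1))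
    (h1 : x + 1 ∉ connectedComponentIn {t | w t ≠ c} y)
    (h2 : x - 1 ∉ connectedComponentIn {t | w t ≠ c} y) :
    |m - c| ≤ 1 + 18 * μ * |m + M - 2 * c| + 36 * μ := by
  rcases h.crests with ⟨⟨q, hq⟩, x₁, T, hT, hz⟩ | ⟨x₁, hz⟩
  · obtain ⟨k, hk⟩ := exists_int_add_mem_Ico hT y x₁
    -- Crests occur in `[x - 1, y]` and in `[y, x + 1]`, while those adjacent to `y` are `T` apart.
    have hT2 : T ≤ 2 := by
      by_contra! hcon
      have hsub : Ioo (x₁ + (-k : ℤ) * T) (x₁ + ((-k : ℤ) + 1) * T) ⊆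
          connectedComponentIn {t | w t ≠ c} y := by
        refine isPreconnected_Ioo.subset_connectedComponentIn ?_ fun t ht =>
          ne_of_mem_Ioo_zeros hT hz (-k) ht
        refine ⟨lt_of_le_of_ne (by push_cast; linarith [hk.1]) fun e => hy ((hz y).2 ⟨-k, e.symm⟩),
          by push_cast; linarith [hk.2]⟩
      obtain ⟨z1, hz1, hz1c⟩ := exists_zero_mem_uIcc h1
      obtain ⟨z2, hz2, hz2c⟩ := exists_zero_mem_uIcc h2
      rw [uIcc_of_ge hyx.2.le] at hz1
      rw [uIcc_of_le hyx.1.le] at hz2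
      have n1 : z1 ∉ Ioo (x₁ + (-k : ℤ) * T) (x₁ + ((-k : ℤ) + 1) * T) := fun hm =>
        ne_of_mem_Ioo_zeros hT hz (-k) hm hz1c
      have n2 : z2 ∉ Ioo (x₁ + (-k : ℤ) * T) (x₁ + ((-k : ℤ) + 1) * T) := fun hm =>
        ne_of_mem_Ioo_zeros hT hz (-k) hm hz2c
      rw [mem_Ioo, not_and_or, not_lt, not_lt] at n1 n2
      push_cast at n1 n2
      rcases n1 with n1 | n1
      · have hyz : y = z1 := le_antisymm hz1.1 (by linarith [hk.1])
        exact hy (hyz ▸ hz1c)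
      rcases n2 with n2 | n2
      · linarith [hz1.2, hz2.1]
      · linarith [hz2.2, hk.2]
    obtain ⟨n, hn⟩ := exists_int_add_mem_Ico hT q x₁
    have e := h.abs_pow_three_le hμ (y := q) ((hz (x₁ + (-n : ℤ) * T)).2 ⟨-n, rfl⟩)
    rw [hq] at e
    have hd := abs_pos.2 (sub_ne_zero.2 h.ne)
    set d := |m - c|
    have hq2 : (q - (x₁ + (-n : ℤ) * T)) ^ 2 ≤ 4 := by
      push_cast
      have b1 : 0 ≤ q - (x₁ + -n * T) := by linarith [hn.1]
      have b2 : q - (x₁ + -n * T) ≤ 2 := by linarith [hn.2]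
      nlinarith
    -- `18 = (9/4) * 2 * 4`: the Hölder constant, the `2 μ` of `slopeBound`, and the squared
    -- distance from the extremum to a crest.
    have e2 : d ^ 3 ≤ 18 * μ * (|m + M - 2 * c| + 2 * d) * d := by
      refine e.trans ((mul_le_mul_of_nonneg_left hq2
        (by unfold slopeBound; positivity)).trans_eq ?_)
      unfold slopeBound
      ring
    have e3 : d ^ 2 ≤ 18 * μ * (|m + M - 2 * c| + 2 * d) := by
      refine le_of_mul_le_mul_right ?_ hd
      linarith [e2, (by ring : d ^ 3 = d ^ 2 * d)]
    by_contra! hcon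
    have b0 : 0 ≤ μ * |m + M - 2 * c| := by positivity
    have b1 : 1 < d := by nlinarith
    nlinarith
  -- With a single crest, the zeros found on the two sides of `y` coincide, so `y` itself would be
  -- that crest.
  · exfalso
    have hyx₁ : y ≠ x₁ := fun e => hy ((hz y).2 e)
    obtain ⟨z1, hz1, hz1c⟩ := exists_zero_mem_uIcc h1
    obtain ⟨z2, hz2, hz2c⟩ := exists_zero_mem_uIcc h2
    rw [uIcc_of_ge hyx.2.le] at hz1
    rw [uIcc_of_le hyx.1.le] at hz2
    rw [hz] at hz1c hz2c
    exact hyx₁ (le_antisymm (by linarith [hz1.1]) (by linarith [hz2.2]))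

lemma slopeBound_mono (hμ : 0 < μ) {d d' : ℝ} (hd : 0 ≤ d) (h : d ≤ d') :
    slopeBound μ c S d ≤ slopeBound μ c S d' := by
  unfold slopeBound
  have : 0 ≤ d' := hd.trans h
  gcongr

lemma IsComposite.exists_eventuallyEq (hμ : 0 < μ) (h : IsComposite μ c S φ) {x : ℝ}
    (hx : φ x ≠ c) : ∃ w, SolvesOff μ c (2 * μ * S) w ∧ φ =ᶠ[𝓝 x] w := by
  obtain ⟨m, M, w, rfl, hw, hC, he⟩ := h x hx
  have hs := hw.solvesOff hμ
  refine ⟨w, hs, ?_⟩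
  have hmem := mem_connectedComponentIn (F := {y | φ y ≠ c}) hx
  have ho : IsOpen (connectedComponentIn {y | φ y ≠ c} x) := by
    rw [hC]; exact (isOpen_ne_height hs.continuous).connectedComponentIn
  filter_upwards [ho.mem_nhds hmem] with y hy using he hy

/-- A Hölder bound on one component of a composite wave. -/
lemma IsComposite.exists_bound (hμ : 0 < μ) (h : IsComposite μ c S φ) (z x : ℝ) :
    ∃ K, 0 ≤ K ∧ ∀ y, φ y ≠ c → z ∈ connectedComponentIn {t | φ t ≠ c} y →
      x ∉ connectedComponentIn {t | φ t ≠ c} y → |φ y - c| ^ 3 ≤ K * (y - x) ^ 2 := by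
  by_cases hz : φ z = c
  · exact ⟨0, le_rfl, fun y _ hzy => absurd hz (connectedComponentIn_subset _ _ hzy)⟩
  obtain ⟨m, M, w, rfl, hw, hC, he⟩ := h z hz
  refine ⟨9 / 4 * slopeBound μ c (m + M) |m - c|, by unfold slopeBound; positivity,
    fun y hy hzy hxy => ?_⟩
  have e1 := connectedComponentIn_eq hzy
  have hyC : y ∈ connectedComponentIn {t | φ t ≠ c} z :=
    e1 ▸ mem_connectedComponentIn (F := {t | φ t ≠ c}) hy
  rw [he hyC]
  refine hw.abs_pow_three_le_of_notMem hμ fun hx => hxy ?_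
  rw [e1, hC]
  rw [hC] at hyC
  rwa [connectedComponentIn_eq hyC]

/-- At height `c`, components with unrelated parameters may accumulate. Those reaching `x + 1` or `x
- 1` receive their own constants; every other component meeting the unit window stays inside it and
obeys the common `K₀`, thanks to the amplitude bound. -/
lemma IsComposite.continuous (hμ : 0 < μ) (h : IsComposite μ c S φ) : Continuous φ := by
  rw [continuous_iff_continuousAt]
  intro x
  by_cases hx : φ x = c
  swap
  · obtain ⟨w, hw, he⟩ := h.exists_eventuallyEq hμ hx
    exact hw.continuous.continuousAt.congr he.symm
  obtain ⟨K₁, hK₁, b₁⟩ := h.exists_bound hμ (x + 1) x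
  obtain ⟨K₂, hK₂, b₂⟩ := h.exists_bound hμ (x - 1) x
  set K₀ := 9 / 4 * slopeBound μ c S (1 + 18 * μ * |S - 2 * c| + 36 * μ) with hK₀def
  have hK₀ : 0 ≤ K₀ := by
    have : 0 ≤ 1 + 18 * μ * |S - 2 * c| + 36 * μ := by positivity
    simp only [hK₀def]
    unfold slopeBound
    positivity
  have bound : ∀ y ∈ Ioo (x - 1) (x + 1), |φ y - c| ^ 3 ≤ (K₀ + K₁ + K₂) * (y - x) ^ 2 := by
    intro y hy
    by_cases hyc : φ y = c
    · rw [hyc, sub_self, abs_zero, zero_pow three_ne_zero]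
      exact mul_nonneg (by linarith) (sq_nonneg _)
    have hxC : x ∉ connectedComponentIn {t | φ t ≠ c} y := fun hm =>
      connectedComponentIn_subset _ _ hm hx
    have up : ∀ {K}, K ≤ K₀ + K₁ + K₂ → |φ y - c| ^ 3 ≤ K * (y - x) ^ 2 →
        |φ y - c| ^ 3 ≤ (K₀ + K₁ + K₂) * (y - x) ^ 2 := fun hK hb =>
      hb.trans (mul_le_mul_of_nonneg_right hK (sq_nonneg _))
    by_cases m₁ : x + 1 ∈ connectedComponentIn {t | φ t ≠ c} y
    · exact up (by linarith) (b₁ y hyc m₁ hxC)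
    by_cases m₂ : x - 1 ∈ connectedComponentIn {t | φ t ≠ c} y
    · exact up (by linarith) (b₂ y hyc m₂ hxC)
    obtain ⟨m, M, w, rfl, hw, hC, he⟩ := h y hyc
    have hyw : φ y = w y := he (mem_connectedComponentIn (F := {t | φ t ≠ c}) hyc)
    rw [hC] at m₁ m₂ hxC
    have hd := hw.amplitude_le hμ (hyw ▸ hyc) hy m₁ m₂
    have hb := hw.abs_pow_three_le_of_notMem hμ hxC
    rw [← hyw] at hb
    refine up (K := 9 / 4 * slopeBound μ c (m + M) |m - c|) ?_ hb
    have := slopeBound_mono (c := c) (S := m + M) hμ (abs_nonneg _) hd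
    linarith
  rw [Metric.continuousAt_iff']
  intro ε hε
  have hlim : Tendsto (fun y => (K₀ + K₁ + K₂) * (y - x) ^ 2) (𝓝 x) (𝓝 0) := by
    have : Continuous fun y => (K₀ + K₁ + K₂) * (y - x) ^ 2 := by fun_prop
    simpa using this.tendsto x
  filter_upwards [hlim.eventually_lt_const (pow_pos hε 3),
    Ioo_mem_nhds (show x - 1 < x by linarith) (show x < x + 1 by linarith)] with y hy hym
  rw [hx, Real.dist_eq]
  exact lt_of_pow_lt_pow_left₀ 3 hε.le ((bound y hym).trans_lt hy)

theorem IsComposite.solvesOff (hμ : 0 < μ) (h : IsComposite μ c S φ) :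
    SolvesOff μ c (2 * μ * S) φ := by
  refine ⟨h.continuous hμ, fun x hx => ?_, fun x hx => ?_⟩
  · obtain ⟨w, hw, he⟩ := h.exists_eventuallyEq hμ hx
    exact (hw.differentiableAt x (he.eq_of_nhds ▸ hx)).congr_of_eventuallyEq he
  · obtain ⟨w, hw, he⟩ := h.exists_eventuallyEq hμ hx
    rw [he.eq_of_nhds, he.deriv.eq_of_nhds]
    exact (hw.hasDerivAt_deriv x (he.eq_of_nhds ▸ hx)).congr_of_eventuallyEq he.deriv

lemma exceptional_iff (hμ : 0 < μ) : 2 * μ * S = 4 * μ * c ↔ S = 2 * c := by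
  constructor
  · intro h
    have : 2 * μ * (S - 2 * c) = 0 := by linarith
    have := (mul_eq_zero.1 this).resolve_left (by positivity)
    linarith
  · rintro rfl
    ring

theorem IsComposite.isTravelingWave (hμ : 0 < μ) (h : IsComposite μ c S φ)
    (h0 : volume {x | φ x = c} = 0 ∨ S = 2 * c) : IsTravelingWave μ c φ :=
  (h.solvesOff hμ).isTravelingWave (h0.imp_right (exceptional_iff hμ).2)

theorem IsComposite.isTravelingWave_iff (hμ : 0 < μ) (h : IsComposite μ c S φ)
    (hne : ∃ x, φ x ≠ c) :
    IsTravelingWave μ c φ ↔ (volume {x | φ x = c} = 0 ∨ S = 2 * c) := by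
  refine ⟨fun hw => ?_, h.isTravelingWave hμ⟩
  obtain ⟨a, ha, h0⟩ := hw.exists_solvesOff
  obtain ⟨x, hx⟩ := hne
  have := ha.eq_const (h.solvesOff hμ) hx (EventuallyEq.refl _ _)
  rw [this, exceptional_iff hμ] at h0
  exact h0

end Composite


/-! ### Bounded solutions and the matching elementary waves -/

section Matching

variable {μ c a : ℝ} {φ : ℝ → ℝ}

lemma SolvesOff.mul_sq_eq (x : ℝ) :
    (φ x - c) * deriv φ x ^ 2 = 2 * μ * φ x ^ 2 - a * φ x + firstIntegral μ c a φ x := by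
  rw [firstIntegral]
  ring

/-- A solution that rises above the singular height, and above all zeros of the potential, keeps
rising. -/
lemma SolvesOff.deriv_pos_of_le (h : SolvesOff μ c a φ) {x : ℝ} (hx : c < φ x)
    (hd : 0 < deriv φ x)
    (hr : ∀ t, φ x ≤ t → 0 < 2 * μ * t ^ 2 - a * t + firstIntegral μ c a φ x) {y : ℝ}
    (hy : x ≤ y) : φ x ≤ φ y ∧ 0 < deriv φ y ∧
      (φ y - c) * deriv φ y ^ 2 = 2 * μ * φ y ^ 2 - a * φ y + firstIntegral μ c a φ x := by
  set b := firstIntegral μ c a φ x with hb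
  set F : Set ℝ := {y | φ x ≤ φ y}
  have hF : IsClosed F := isClosed_le continuous_const h.continuous
  have hFc : ∀ y ∈ F, φ y ≠ c := fun y hy => (hx.trans_le hy).ne'
  -- Continuity induction. The set is closed because `F` stays away from the height `c`; on it the
  -- potential is positive, which upgrades `φ' ≥ 0` to `φ' > 0` and lets it extend to the right.
  set s : Set ℝ := F ∩ (fun y => (deriv φ y, firstIntegral μ c a φ y)) ⁻¹' (Ici 0 ×ˢ {b})
  have hs : IsClosed s := by
    refine ContinuousOn.preimage_isClosed_of_isClosed (fun y hy => ?_) hF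
      (isClosed_Ici.prod isClosed_singleton)
    exact ((h.continuousAt_deriv (hFc y hy)).prodMk
      (h.hasDerivAt_firstIntegral (hFc y hy)).continuousAt).continuousWithinAt
  have key : ∀ y ∈ s, φ x ≤ φ y ∧ 0 < deriv φ y ∧
      (φ y - c) * deriv φ y ^ 2 = 2 * μ * φ y ^ 2 - a * φ y + b := by
    rintro y ⟨h1, h2, h3⟩
    have e := SolvesOff.mul_sq_eq (μ := μ) (c := c) (a := a) (φ := φ) y
    rw [show firstIntegral μ c a φ y = b from h3] at e
    refine ⟨h1, lt_of_le_of_ne h2 fun h0 => ?_, e⟩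
    have := hr _ h1
    replace h0 : (0 : ℝ) = deriv φ y := h0
    rw [← e, ← h0] at this
    simp at this
  refine key y ((hs.inter isClosed_Icc).Icc_subset_of_forall_mem_nhdsWithin (b := y)
    ⟨le_refl (φ x), hd.le, rfl⟩ ?_ ⟨hy, le_rfl⟩)
  rintro z ⟨hz, -⟩
  obtain ⟨h1, h2, -⟩ := key z hz
  have hzb : firstIntegral μ c a φ z = b := hz.2.2
  have ev : ∀ᶠ t in 𝓝 z, c < φ t ∧ 0 < deriv φ t :=
    (h.continuous.continuousAt.eventually_const_lt (hx.trans_le h1)).and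
      ((h.continuousAt_deriv (hFc z h1)).eventually_const_lt h2)
  obtain ⟨ε, hε, he⟩ := Metric.eventually_nhds_iff_ball.1 ev
  rw [Real.ball_eq_Ioo] at he
  have hmono : StrictMonoOn φ (Ioo (z - ε) (z + ε)) :=
    strictMonoOn_of_deriv_pos (convex_Ioo _ _) h.continuous.continuousOn fun t ht =>
      (he t (interior_subset ht)).2
  have hzm : z ∈ Ioo (z - ε) (z + ε) := ⟨by linarith, by linarith⟩
  filter_upwards [Ioo_mem_nhdsGT (show z < z + ε by linarith)] with t ht
  have htm : t ∈ Ioo (z - ε) (z + ε) := ⟨by linarith [ht.1], ht.2⟩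
  refine ⟨h1.trans (hmono hzm htm ht.1).le, (he t htm).2.le, ?_⟩
  exact (h.firstIntegral_eq isOpen_Ioo isPreconnected_Ioo (fun y hy => (he y hy).1.ne')
    htm hzm).trans hzb

/-- If `φ ≤ K`, the potential has a positive minimum `ρ` on `[φ x, K]`, so `φ' ≥ √(ρ / (K - c))`
from `x` on, and `φ` eventually passes `K`. -/
lemma SolvesOff.not_bounded_of_deriv_pos (h : SolvesOff μ c a φ) {x : ℝ} (hx : c < φ x)
    (hd : 0 < deriv φ x)
    (hr : ∀ t, φ x ≤ t → 0 < 2 * μ * t ^ 2 - a * t + firstIntegral μ c a φ x) (K : ℝ) :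
    ¬ ∀ y, φ y ≤ K := by
  intro hK
  have key := fun {y} => h.deriv_pos_of_le hx hd hr (y := y)
  set b := firstIntegral μ c a φ x
  obtain ⟨t₀, ht₀, hmin⟩ := isCompact_Icc.exists_isMinOn (nonempty_Icc.2 (hK x))
    (f := fun t : ℝ => 2 * μ * t ^ 2 - a * t + b) (by fun_prop)
  set ρ := 2 * μ * t₀ ^ 2 - a * t₀ + b
  have hρ : 0 < ρ := hr _ ht₀.1
  have hKc : 0 < K - c := by linarith [hK x]
  set δ := √(ρ / (K - c))
  have hδ : 0 < δ := Real.sqrt_pos.2 (div_pos hρ hKc)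
  have hδd : ∀ y, x ≤ y → δ ≤ deriv φ y := by
    intro y hy
    obtain ⟨h1, h2, h3⟩ := key hy
    refine Real.sqrt_le_iff.2 ⟨h2.le, ?_⟩
    rw [div_le_iff₀ hKc]
    calc ρ ≤ 2 * μ * φ y ^ 2 - a * φ y + b := hmin ⟨h1, hK y⟩
      _ = (φ y - c) * deriv φ y ^ 2 := h3.symm
      _ ≤ (K - c) * deriv φ y ^ 2 :=
        mul_le_mul_of_nonneg_right (by linarith [hK y]) (sq_nonneg _)
      _ = deriv φ y ^ 2 * (K - c) := mul_comm _ _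
  have hKx : 0 < K + 1 - φ x := by linarith [hK x]
  have hle : x ≤ x + (K + 1 - φ x) / δ := by
    have := div_pos hKx hδ
    linarith
  have := (convex_Ici x).mul_sub_le_image_sub_of_le_deriv h.continuous.continuousOn
    (fun y hy => (h.differentiableAt y
      (hx.trans_le (key (interior_subset hy)).1).ne').differentiableWithinAt)
    (fun y hy => hδd y (interior_subset hy)) x self_mem_Ici _ hle hle
  rw [add_sub_cancel_left, mul_div_cancel₀ _ hδ.ne'] at this
  linarith [hK (x + (K + 1 - φ x) / δ)]

/-- A solution above the singular height, and above all zeros of the potential, is unbounded. -/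
lemma SolvesOff.not_bounded (h : SolvesOff μ c a φ) {x : ℝ} (hx : c < φ x)
    (hd : deriv φ x ≠ 0 ∨ a < 4 * μ * φ x)
    (hr : ∀ t, φ x < t → 0 < 2 * μ * t ^ 2 - a * t + firstIntegral μ c a φ x) (K : ℝ) :
    ¬ ∀ y, φ y ≤ K := by
  -- At a critical point `φ'' > 0`, so slightly to the right the slope is positive and the value
  -- larger. A negative slope is reduced to a positive one by `x ↦ -x`.
  by_cases h0 : deriv φ x = 0
  · have ha := hd.resolve_left (not_not.2 h0)
    have hdd := h.hasDerivAt_deriv x hx.ne'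
    have hpos : 0 < (4 * μ * φ x - a - deriv φ x ^ 2) / (2 * (φ x - c)) := by
      rw [h0]
      exact div_pos (by linarith) (by linarith)
    have ev : ∀ᶠ t in 𝓝 x, c < φ t ∧ (t ≠ x → 0 < slope (deriv φ) x t) :=
      (h.continuous.continuousAt.eventually_const_lt hx).and
        (eventually_nhdsWithin_iff.1
          ((hasDerivAt_iff_tendsto_slope.1 hdd).eventually_const_lt hpos))
    obtain ⟨ε, hε, he⟩ := Metric.eventually_nhds_iff_ball.1 ev
    rw [Real.ball_eq_Ioo] at he
    have hdp : ∀ t ∈ Ioo x (x + ε), 0 < deriv φ t := by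
      intro t ht
      have := (he t ⟨by linarith [ht.1], ht.2⟩).2 ht.1.ne'
      rw [slope_def_field, h0, sub_zero] at this
      exact (div_pos_iff_of_pos_right (sub_pos.2 ht.1)).1 this
    have hmono : StrictMonoOn φ (Icc x (x + ε / 2)) :=
      strictMonoOn_of_deriv_pos (convex_Icc _ _) h.continuous.continuousOn fun t ht => by
        rw [interior_Icc] at ht
        exact hdp t ⟨ht.1, by linarith [ht.2]⟩
    have hlt := hmono (left_mem_Icc.2 (by linarith)) (right_mem_Icc.2 (by linarith))
      (show x < x + ε / 2 by linarith)
    have hb := h.firstIntegral_eq isOpen_Ioo isPreconnected_Ioo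
      (fun y hy => (he y hy).1.ne') (x := x + ε / 2) (y := x) ⟨by linarith, by linarith⟩
      ⟨by linarith, by linarith⟩
    refine h.not_bounded_of_deriv_pos (hx.trans hlt) (hdp _ ⟨by linarith, by linarith⟩)
      (fun t ht => ?_) K
    rw [hb]
    exact hr t (hlt.trans_le ht)
  · have hr' : ∀ t, φ x ≤ t → 0 < 2 * μ * t ^ 2 - a * t + firstIntegral μ c a φ x := by
      intro t ht
      rcases ht.eq_or_lt with rfl | ht
      · rw [← SolvesOff.mul_sq_eq]
        exact mul_pos (sub_pos.2 hx) (by positivity)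
      · exact hr t ht
    rcases lt_or_gt_of_ne h0 with h0 | h0
    · intro hK
      have hdn : deriv (fun y => φ (-y)) (-x) = -deriv φ x := by
        rw [deriv_comp_neg, neg_neg]
      refine h.comp_neg.not_bounded_of_deriv_pos (x := -x) (by rwa [neg_neg])
        (by rw [hdn]; linarith) ?_ K fun y => hK _
      rw [firstIntegral, hdn, neg_neg, neg_sq]
      exact hr'
    · exact h.not_bounded_of_deriv_pos hx h0 hr' K

lemma exists_roots_or_pos (hμ : 0 < μ) (a b : ℝ) :
    (∃ m M, m ≤ M ∧ a = 2 * μ * (m + M) ∧ b = 2 * μ * m * M) ∨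
      ∀ t, 0 < 2 * μ * t ^ 2 - a * t + b := by
  rcases le_or_gt 0 (a ^ 2 - 8 * μ * b) with h | h
  · left
    have hs := Real.sq_sqrt h
    have hs0 := Real.sqrt_nonneg (a ^ 2 - 8 * μ * b)
    set s := √(a ^ 2 - 8 * μ * b)
    refine ⟨(a - s) / (4 * μ), (a + s) / (4 * μ), ?_, ?_, ?_⟩
    · gcongr
      linarith
    · field_simp
      ring
    · field_simp
      linarith
  · right
    intro t
    have : 0 < 8 * μ * (2 * μ * t ^ 2 - a * t + b) := by
      nlinarith [sq_nonneg (4 * μ * t - a)]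
    exact pos_of_mul_pos_right this (by positivity)

lemma solvesOff_const (μ c k : ℝ) : SolvesOff μ c (4 * μ * k) fun _ => k := by
  refine ⟨continuous_const, fun _ _ => differentiableAt_const _, fun x _ => ?_⟩
  simp only [deriv_const', sub_self, ne_eq, OfNat.ofNat_ne_zero, not_false_eq_true, zero_pow,
    zero_div]
  exact hasDerivAt_const x 0

theorem isTravelingWave_const (μ c k : ℝ) : IsTravelingWave μ c fun _ => k := by
  refine (solvesOff_const μ c k).isTravelingWave ?_
  by_cases h : k = c
  · exact Or.inr (h ▸ rfl)
  · simp [h]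

lemma SolvesOff.eq_const_of_critical (h : SolvesOff μ c a φ) {x : ℝ} (hx : φ x ≠ c)
    (hd : deriv φ x = 0) (ha : a = 4 * μ * φ x) : ∃ k, ∀ y, φ y = k := by
  have hk := ha ▸ solvesOff_const μ c (φ x)
  exact ⟨φ x, fun y => (hk.eqOn h isPreconnected_univ (mem_univ x) (fun _ _ => hx) rfl
    (by rw [hd, deriv_const]) (mem_univ y)).symm⟩

/-- A bounded solution is constant, a smooth periodic wave, or agrees to first order with an
elementary wave at a given point off the singular height. -/
theorem SolvesOff.trichotomy (hμ : 0 < μ) (h : SolvesOff μ c a φ) {K : ℝ} (hK : ∀ y, φ y ≤ K)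
    {x : ℝ} (hx : φ x ≠ c) :
    (∃ k, ∀ y, φ y = k) ∨ (∃ m M, m < M ∧ M < c ∧ IsSmoothPeriodicWave μ c m M φ) ∨
      ∃ m M w, a = 2 * μ * (m + M) ∧ IsElementaryWave μ c m M w ∧ φ x = w x ∧
        deriv φ x = deriv w x := by
  have e := SolvesOff.mul_sq_eq (μ := μ) (c := c) (a := a) (φ := φ) x
  have translate : ∀ {w : ℝ → ℝ} {z : ℝ}, w z = φ x → deriv w z = deriv φ x →
      φ x = (fun y => w (y + (z - x))) x ∧ deriv φ x = deriv (fun y => w (y + (z - x))) x := by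
    intro w z h0 h1
    rw [_root_.deriv_comp_add_const]
    simp [h0, h1]
  rcases exists_roots_or_pos hμ a (firstIntegral μ c a φ x) with ⟨m, M, hmM, ha, hb⟩ | hr
  swap
  -- Without real roots the potential is positive everywhere; this forces `φ x > c` and a nonzero
  -- slope, hence unboundedness.
  · have hpos := hr (φ x)
    rw [← e] at hpos
    have hd : deriv φ x ≠ 0 := fun h0 => by simp [h0] at hpos
    have hxc : c < φ x := sub_pos.1 (pos_of_mul_pos_left hpos (sq_nonneg _))
    exact absurd hK (h.not_bounded hxc (Or.inl hd) (fun t _ => hr t) K)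
  have e' : (φ x - c) * deriv φ x ^ 2 = 2 * μ * ((φ x - m) * (φ x - M)) := by
    rw [e, hb, ha]
    ring
  have e'' : (c - φ x) * deriv φ x ^ 2 = 2 * μ * (M - φ x) * (φ x - m) := by
    linarith [e']
  have hconst : φ x = m → m = M → ∃ k, ∀ y, φ y = k := by
    intro h1 h2
    refine h.eq_const_of_critical hx ?_ (by rw [ha, h1, ← h2]; ring)
    rw [h1, sub_self, zero_mul, mul_zero, ← h1] at e'
    simpa using (mul_eq_zero.1 e').resolve_left (sub_ne_zero.2 hx)
  rcases lt_or_gt_of_ne hx with hxc | hxc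
  -- Below `c` the signs give `m ≤ φ x ≤ M`. For `M < c` the solution turns back before the singular
  -- height; for `M ≥ c` it reaches it.
  · have hprod : (φ x - m) * (φ x - M) ≤ 0 := by
      have h1 : (φ x - c) * deriv φ x ^ 2 ≤ 0 :=
        mul_nonpos_of_nonpos_of_nonneg (by linarith) (sq_nonneg _)
      rw [e'] at h1
      by_contra! hcon
      have : 0 < 2 * μ * ((φ x - m) * (φ x - M)) := by positivity
      linarith
    have hm : m ≤ φ x := by
      by_contra! hlt
      have := mul_pos_of_neg_of_neg (show φ x - m < 0 by linarith) (show φ x - M < 0 by linarith)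
      linarith
    have hM : φ x ≤ M := by
      by_contra! hlt
      have := mul_pos (show 0 < φ x - m by linarith) (show 0 < φ x - M by linarith)
      linarith
    rcases hmM.eq_or_lt with heq | hlt
    · exact Or.inl (hconst (by linarith) heq)
    right
    rcases lt_or_ge M c with hMc | hMc
    · left
      refine ⟨m, M, hlt, hMc, ?_⟩
      obtain ⟨w, x₀, T, p, hw⟩ := exists_isSmoothArch hμ hlt hMc
      obtain ⟨z, hz0, hz1⟩ := hw.exists_data rfl ⟨hm, hM⟩ e''
      obtain ⟨t0, t1⟩ := translate hz0 hz1
      have hw' := hw.comp_add_const (z - x)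
      have heq := hw'.solves.eqOn (ha ▸ h) isPreconnected_univ (mem_univ x)
        (fun y _ => hw'.ne_height y) t0.symm t1.symm
      rw [← show (fun y => w (y + (z - x))) = φ from funext fun y => heq (mem_univ y)]
      exact hw'.isSmoothPeriodicWave
    · right
      have hmc : m < c := hm.trans_lt hxc
      obtain ⟨w, x₀, T, p, hw⟩ := exists_isArchWave_below hμ hmc hMc
      obtain ⟨z, hz0, hz1⟩ := hw.exists_data hμ rfl (by norm_num)
        (by rw [Set.mem_uIcc]; exact Or.inr ⟨hm, hxc.le⟩) hx (hxc.trans_le hMc).ne e''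
      obtain ⟨t0, t1⟩ := translate hz0 hz1
      have hw' := hw.comp_add_const (z - x)
      refine ⟨m, M, _, ha, ?_, t0, t1⟩
      rcases hMc.eq_or_lt with rfl | hMc
      · exact Or.inl ⟨hmc, rfl, hw'.isPeakedPeriodicWave hμ hmc⟩
      · exact Or.inr (Or.inl ⟨hmc, hMc, hw'.isCuspedPeriodicWave hμ hMc⟩)
  -- Above `c`, a solution at or beyond the larger root is constant or escapes, and strictly between
  -- the roots the square of the slope would be negative. So `c < φ x ≤ m`.
  · rcases le_or_gt M (φ x) with hM | hM
    · rcases (hmM.trans hM).eq_or_lt with hm | hm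
      · exact Or.inl (hconst hm.symm (le_antisymm hmM (hm ▸ hM)))
      · refine absurd hK (h.not_bounded hxc (Or.inr ?_) (fun t ht => ?_) K)
        · rw [ha]
          nlinarith
        · have : 2 * μ * t ^ 2 - a * t + firstIntegral μ c a φ x =
              2 * μ * ((t - m) * (t - M)) := by
            rw [hb, ha]
            ring
          rw [this]
          exact mul_pos (by positivity) (mul_pos (by linarith) (by linarith))
    have hm : φ x ≤ m := by
      by_contra! hlt
      have h1 : 0 ≤ (φ x - c) * deriv φ x ^ 2 := mul_nonneg (by linarith) (sq_nonneg _)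
      have h2 : 2 * μ * ((φ x - m) * (φ x - M)) < 0 :=
        mul_neg_of_pos_of_neg (by positivity)
          (mul_neg_of_pos_of_neg (by linarith) (by linarith))
      linarith
    have hcm : c < m := hxc.trans_le hm
    right; right
    rcases hmM.eq_or_lt with rfl | hlt
    · obtain ⟨w, x₀, hw⟩ := exists_isLineArch hμ hcm
      obtain ⟨z, hz0, hz1⟩ := hw.exists_data hμ ⟨hxc, hM⟩ e''
      obtain ⟨t0, t1⟩ := translate hz0 hz1
      exact ⟨m, m, _, ha, Or.inr (Or.inr (Or.inr ⟨hcm, rfl,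
        (hw.comp_add_const (z - x)).isAnticuspedLineWave hμ hcm⟩)), t0, t1⟩
    · obtain ⟨w, x₀, T, p, hw⟩ := exists_isArchWave_above hμ hcm hlt
      obtain ⟨z, hz0, hz1⟩ := hw.exists_data hμ rfl (by norm_num)
        (by rw [Set.mem_uIcc]; exact Or.inl ⟨hxc.le, hm⟩) hx hM.ne e''
      obtain ⟨t0, t1⟩ := translate hz0 hz1
      exact ⟨m, M, _, ha, Or.inr (Or.inr (Or.inl ⟨hcm, hlt,
        (hw.comp_add_const (z - x)).isAnticuspedPeriodicWave hμ (hcm.trans hlt)⟩)), t0, t1⟩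

/-- Classification of the bounded traveling waves. -/
theorem isTravelingWave_iff_of_bounded (hμ : 0 < μ) {K : ℝ} (hK : ∀ y, φ y ≤ K) :
    IsTravelingWave μ c φ ↔ ((∃ k, ∀ x, φ x = k) ∨
      (∃ m M, m < M ∧ M < c ∧ IsSmoothPeriodicWave μ c m M φ) ∨
      (∃ S, IsComposite μ c S φ ∧ (volume {x | φ x = c} = 0 ∨ S = 2 * c))) := by
  constructor
  · intro hw
    obtain ⟨a, h, h0⟩ := hw.exists_solvesOff
    by_contra! hcon
    obtain ⟨hconst, hsmooth, hcomp⟩ := hcon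
    have haS : a = 2 * μ * (a / (2 * μ)) := by field_simp
    refine absurd (h0.imp_right fun e => (exceptional_iff hμ).1 (haS.symm.trans e))
      (not_or.2 (hcomp (a / (2 * μ)) fun x hx => ?_))
    rcases h.trichotomy hμ hK hx with ⟨k, hk⟩ | ⟨m, M, h1, h2, h3⟩ | ⟨m, M, w, ha, he, e0, e1⟩
    · exact absurd (hk _) (hconst k).choose_spec
    · exact absurd h3 (hsmooth m M h1 h2)
    · exact ⟨m, M, w, by rw [ha]; field_simp, he,
        h.connectedComponentIn_eq (ha ▸ he.solvesOff hμ) hx e0 e1⟩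
  · rintro (⟨k, hk⟩ | ⟨m, M, -, -, h⟩ | ⟨S, h, h0⟩)
    · rw [funext hk]
      exact isTravelingWave_const μ c k
    · exact h.wave
    · exact h.isTravelingWave hμ h0

end Matching

end MuHS

/-! ### The main theorem -/

theorem mainTheorem7 (μ c : ℝ) (hμ : 0 < μ) :
    -- smooth periodic waves
    (∀ m M : ℝ, m < M → M < c →
      MuHS.ExistsUniqueUpToTranslation (MuHS.IsSmoothPeriodicWave μ c m M)) ∧
    -- peaked periodic waves, the borderline case `M = c`
    (∀ m : ℝ, m < c →
      MuHS.ExistsUniqueUpToTranslation (MuHS.IsPeakedPeriodicWave μ c m)) ∧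
    -- cusped periodic waves
    (∀ m M : ℝ, m < c → c < M →
      MuHS.ExistsUniqueUpToTranslation (MuHS.IsCuspedPeriodicWave μ c m M)) ∧
    -- anticusped periodic waves
    (∀ m M : ℝ, c < m → m < M →
      MuHS.ExistsUniqueUpToTranslation (MuHS.IsAnticuspedPeriodicWave μ c m M)) ∧
    -- anticusped waves on the line
    (∀ m : ℝ, c < m →
      MuHS.ExistsUniqueUpToTranslation (MuHS.IsAnticuspedLineWave μ c m)) ∧
    -- composite waves, and plateaus
    (∀ (S : ℝ) (φ : ℝ → ℝ), MuHS.IsComposite μ c S φ → (∃ x, φ x ≠ c) →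
      (MuHS.IsTravelingWave μ c φ ↔ (volume {x | φ x = c} = 0 ∨ S = 2 * c))) ∧
    -- the list is complete
    (∀ φ : ℝ → ℝ, (∃ K : ℝ, ∀ x, |φ x| ≤ K) →
      (MuHS.IsTravelingWave μ c φ ↔
        ((∃ k : ℝ, ∀ x, φ x = k) ∨
         (∃ m M : ℝ, m < M ∧ M < c ∧ MuHS.IsSmoothPeriodicWave μ c m M φ) ∨
         (∃ S : ℝ, MuHS.IsComposite μ c S φ ∧
            (volume {x | φ x = c} = 0 ∨ S = 2 * c))))) := by
  refine ⟨fun m M => MuHS.existsUnique_smooth hμ, fun m => MuHS.existsUnique_peaked hμ,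
    fun m M => MuHS.existsUnique_cusped hμ, fun m M => MuHS.existsUnique_anticusped hμ,
    fun m => MuHS.existsUnique_line hμ, fun S φ h hne => h.isTravelingWave_iff hμ hne, ?_⟩
  rintro φ ⟨K, hK⟩
  exact MuHS.isTravelingWave_iff_of_bounded hμ fun y => (le_abs_self _).trans (hK y)
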